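/- Notation: $e(x)=e^{2\pi i x}$; $\mathbb H_n$ is the Siegel upper half space of genus $n$; $\mathrm{Mp}_{2n}(\mathbb Z)$ is the group of pairs $(\gamma,\omega)$ with $\gamma=\left(\begin{smallmatrix}a&b\\c&d\end{smallmatrix}\right)\in\mathrm{Sp}_{2n}(\mathbb Z)$ and $\omega$ a holomorphic function on $\mathbb H_n$ with $\omega(\tau)^2=\det(c\tau+d)$; $\Gamma(M)\subset \mathrm{Mp}_{2n}(\mathbb Z)$ is the subgroup given by $\gamma\equiv 1 \pmod M$. Let $g\ge 2$ and $k\in\frac12\mathbb Z$. A Jacobi form of genus $g-1$, weight $k$ and index $m\in\mathbb Z_{\ge 0}$ is a holomorphic function $\phi$ on $\mathbb H_{g-1}\times\mathbb C^{g-1}$ such that $$\phi\big(\gamma\tau_1,{}^t(c\tau_1+d)^{-1}z\big)=\omega(\tau_1)^{2k}\,e\big(m\,{}^tz(c\tau_1+d)^{-1}cz\big)\,\phi(\tau_1,z)\quad\text{for all }(\gamma,\omega)\in\mathrm{Mp}_{2(g-1)}(\mathbb Z),$$ $$\phi(\tau_1,z+\tau_1\alpha+\beta)=e\big(-m({}^t\alpha\tau_1\alpha+2\,{}^t\alpha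 z)\big)\,\phi(\tau_1,z)\quad\text{for all }\alpha,\beta\in\mathbb Z^{g-1},$$ and which has a Fourier expansion $\phi(\tau_1,z)=\sum_{n,r}c(\phi;n,r)\,e(\mathrm{tr}(n\tau_1)+{}^trz)$, with $n$ running through the half-integral symmetric matrices and $r$ through $\mathbb Z^{g-1}$, where $c(\phi;n,r)=0$ unless $\left(\begin{smallmatrix}n&r/2\\{}^tr/2&m\end{smallmatrix}\right)\ge 0$. A symmetric formal Fourier–Jacobi series of genus $g$, cogenus $1$ and weight $k$ is a formal series $f=\sum_{m\ge 0}\phi_m(\tau_1,z)\,q_2^m$ in which $\phi_m$ is a Jacobi form of genus $g-1$, weight $k$ and index $m$, and whose coefficients $c(f;t)=c(\phi_m;n,r)$, $t=\left(\begin{smallmatrix}n&r/2\\{}^tr/2&m\end{smallmatrix}\right)$, satisfy $c(f;{}^tu\,t\,u)=s^{2k}\,c(f;t)$ for all positive semidefinite half-integral $t$, all $u\in\mathrm{GL}_g(\mathbb Z)$ and each $s\in\mathbb C$ with $s^2=\det u$ (that is, $c(f;{}^tu\,t\,u)=\det(u)^kc(f;t)$ if $k\in\mathbb Z$). It is called cuspidal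 if $\phi_0=0$. A holomorphic function $h$ on $\mathbb H_{g-1}$ is a Siegel cusp form of weight $k$ and genus $g-1$ for $\Gamma(M)$ if $h(\gamma\tau_1)=\omega(\tau_1)^{2k}h(\tau_1)$ for all $(\gamma,\omega)\in\Gamma(M)$, and if for every $(\gamma,\omega)\in\mathrm{Mp}_{2(g-1)}(\mathbb Z)$ the function $\omega(\tau_1)^{-2k}h(\gamma\tau_1)$ has a Fourier expansion $\sum_{n>0}c(n)\,e(\mathrm{tr}(n\tau_1)/M)$ over positive definite half-integral symmetric matrices $n$. Put $\|h\|_\infty=\sup_{\tau_1\in\mathbb H_{g-1}}|h(\tau_1)|\det(\operatorname{Im}\tau_1)^{k/2}\in[0,\infty]$. **Proposition.** Let $f=\sum_m\phi_m q_2^m$ be a cuspidal symmetric formal Fourier–Jacobi series of genus $g\ge2$, cogenus $1$ and weight $k$, and let $N$ be a positive integer. For $\lambda,\mu\in\frac1N\mathbb Z^{g-1}$ and $m\ge 0$ put $$\eta_m(\tau_1)=e(m\,{}^t\lambda\tau_1\lambda)\,\phi_m(\tau_1,\tau_1\lambda+\mu).$$ Then every $\eta_m$ is a Siegel cusp form of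 weight $k$ and genus $g-1$ for $\Gamma(N^2)$. Moreover, there is a constant $C>0$, depending only on $f$ (hence on $g$ and $k$) and $N$, such that for all $\lambda,\mu\in\frac1N\mathbb Z^{g-1}$ and all $m>0$ $$\|\eta_m\|_\infty\le C\,m^{k+\frac{g-1}{2}}.$$ -/

import Mathlib

open scoped Matrix ENNReal

noncomputable section

namespace FormalFJ

/-- `e(x) = exp(2πi x)`. -/
def e (x : ℂ) : ℂ := Complex.exp (2 * Real.pi * Complex.I * x)

/-- The Siegel upper half space of genus `n`: symmetric complex matrices with positive definite
imaginary part. Complex differentiability on this set (`DifferentiableOn ℂ`) only tests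
increments inside the space of symmetric matrices, in which the set is open, so it is
holomorphy on the Siegel upper half space. -/
def siegelUpperHalfSpace (n : ℕ) : Set (Matrix (Fin n) (Fin n) ℂ) :=
  {τ | τ.IsSymm ∧ (τ.map Complex.im).PosDef}

/-- `c τ + d` for `γ = (a b; c d)`. -/
def denom {n : ℕ} (γ : Matrix (Fin n ⊕ Fin n) (Fin n ⊕ Fin n) ℤ)
    (τ : Matrix (Fin n) (Fin n) ℂ) : Matrix (Fin n) (Fin n) ℂ :=
  γ.toBlocks₂₁.map (fun x : ℤ => (x : ℂ)) * τ + γ.toBlocks₂₂.map (fun x : ℤ => (x : ℂ))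

/-- `γ τ = (a τ + b) (c τ + d)⁻¹` for `γ = (a b; c d)`. -/
def moebius {n : ℕ} (γ : Matrix (Fin n ⊕ Fin n) (Fin n ⊕ Fin n) ℤ)
    (τ : Matrix (Fin n) (Fin n) ℂ) : Matrix (Fin n) (Fin n) ℂ :=
  (γ.toBlocks₁₁.map (fun x : ℤ => (x : ℂ)) * τ + γ.toBlocks₁₂.map (fun x : ℤ => (x : ℂ))) *
    (denom γ τ)⁻¹

/-- Elements `(γ, ω)` of the metaplectic group `Mp_{2n}(ℤ)`: an integral symplectic matrix `γ`
with a holomorphic square root `ω` of `τ ↦ det (c τ + d)` on the Siegel upper half space. -/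
structure Mp (n : ℕ) where
  γ : Matrix (Fin n ⊕ Fin n) (Fin n ⊕ Fin n) ℤ
  mem : γ ∈ Matrix.symplecticGroup (Fin n) ℤ
  ω : Matrix (Fin n) (Fin n) ℂ → ℂ
  holo : DifferentiableOn ℂ ω (siegelUpperHalfSpace n)
  sq : ∀ τ ∈ siegelUpperHalfSpace n, ω τ ^ 2 = (denom γ τ).det

/-- The principal congruence subgroup `Γ(M)` of `Mp_{2n}(ℤ)` (all `(γ, ω)` with `γ ≡ 1 mod M`). -/
def principalCongruence (n M : ℕ) : Set (Mp n) :=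
  {g | g.γ.map (fun x : ℤ => (x : ZMod M)) = 1}

/-- The slash action of weight `k = κ / 2`: `(F |_k (γ, ω)) (τ) = ω(τ)^{-2k} F(γ τ)`. -/
def slash {n : ℕ} (κ : ℤ) (F : Matrix (Fin n) (Fin n) ℂ → ℂ) (g : Mp n)
    (τ : Matrix (Fin n) (Fin n) ℂ) : ℂ :=
  g.ω τ ^ (-κ) * F (moebius g.γ τ)

/-- Half-integral symmetric matrices: `t i i ∈ ℤ` and `2 t i j ∈ ℤ`. -/
def HalfIntegral {ι : Type} (t : Matrix ι ι ℚ) : Prop :=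
  t.IsSymm ∧ (∀ i, ∃ a : ℤ, t i i = a) ∧ ∀ i j, ∃ a : ℤ, 2 * t i j = a

/-- The type of half-integral symmetric `n × n` matrices. -/
abbrev HalfInt (n : ℕ) : Type := {t : Matrix (Fin n) (Fin n) ℚ // HalfIntegral t}

/-- `tr (t τ)` for a rational matrix `t`. -/
def traceMul {n : ℕ} (t : Matrix (Fin n) (Fin n) ℚ) (τ : Matrix (Fin n) (Fin n) ℂ) : ℂ :=
  (t.map (fun x : ℚ => (x : ℂ)) * τ).trace

/-- `F` is a Siegel cusp form of genus `n` and weight `k = κ / 2` for `Γ(M)`: it is holomorphic,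
invariant under the weight `k` action of `Γ(M)`, and at every cusp (i.e. for every `F |_k g` with
`g ∈ Mp_{2n}(ℤ)`) it has a Fourier expansion supported on positive definite matrices. -/
structure IsSiegelCuspForm (n : ℕ) (κ : ℤ) (M : ℕ) (F : Matrix (Fin n) (Fin n) ℂ → ℂ) :
    Prop where
  holo : DifferentiableOn ℂ F (siegelUpperHalfSpace n)
  invariant : ∀ g ∈ principalCongruence n M, ∀ τ ∈ siegelUpperHalfSpace n,
    slash κ F g τ = F τ
  cuspidal : ∀ g : Mp n, ∃ c : HalfInt n → ℂ,
    (∀ t, c t ≠ 0 → (t.1.map (fun x : ℚ => (x : ℝ))).PosDef) ∧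
    ∀ τ ∈ siegelUpperHalfSpace n,
      HasSum (fun t : HalfInt n => c t * e (traceMul t.1 τ / M)) (slash κ F g τ)

/-- `‖F‖_∞ = sup_τ |F(τ)| det(Im τ)^{k/2}` with `k = κ / 2`, as an element of `[0, ∞]`. -/
def heckeNorm {n : ℕ} (κ : ℤ) (F : Matrix (Fin n) (Fin n) ℂ → ℂ) : ℝ≥0∞ :=
  ⨆ τ ∈ siegelUpperHalfSpace n,
    ENNReal.ofReal (‖F τ‖ * (τ.map Complex.im).det ^ ((κ : ℝ) / 4))

/-- The matrix `(T, r/2; rᵀ/2, m)` of size `n + 1`. -/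
def blockMatrix {n : ℕ} (T : Matrix (Fin n) (Fin n) ℚ) (r : Fin n → ℤ) (m : ℕ) :
    Matrix (Fin n ⊕ Unit) (Fin n ⊕ Unit) ℚ :=
  Matrix.fromBlocks T (Matrix.of fun i _ => (r i : ℚ) / 2) (Matrix.of fun _ j => (r j : ℚ) / 2)
    (Matrix.of fun _ _ => (m : ℚ))

/-- `φ(τ, z) = ∑_{T, r} c(T, r) e(tr(T τ) + rᵀ z)`, where `T` runs over half-integral matrices and
`r` over `ℤⁿ`, with `c(T, r) = 0` unless `(T, r/2; rᵀ/2, m)` is positive semidefinite. -/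
def HasJacobiFourierExpansion {n : ℕ} (m : ℕ)
    (φ : Matrix (Fin n) (Fin n) ℂ → (Fin n → ℂ) → ℂ)
    (c : Matrix (Fin n) (Fin n) ℚ → (Fin n → ℤ) → ℂ) : Prop :=
  (∀ (T : HalfInt n) (r : Fin n → ℤ), c T.1 r ≠ 0 →
    ((blockMatrix T.1 r m).map (fun x : ℚ => (x : ℝ))).PosSemidef) ∧
  ∀ τ ∈ siegelUpperHalfSpace n, ∀ z : Fin n → ℂ,
    HasSum (fun p : HalfInt n × (Fin n → ℤ) =>
      c p.1.1 p.2 * e (traceMul p.1.1 τ + (fun i => (p.2 i : ℂ)) ⬝ᵥ z)) (φ τ z)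

/-- Jacobi forms of genus `n`, weight `k = κ / 2` and index `m` (for the full Jacobi group). -/
structure IsJacobiForm (n : ℕ) (κ : ℤ) (m : ℕ)
    (φ : Matrix (Fin n) (Fin n) ℂ → (Fin n → ℂ) → ℂ) : Prop where
  holo : DifferentiableOn ℂ (fun p : Matrix (Fin n) (Fin n) ℂ × (Fin n → ℂ) => φ p.1 p.2)
    (siegelUpperHalfSpace n ×ˢ Set.univ)
  modular : ∀ g : Mp n, ∀ τ ∈ siegelUpperHalfSpace n, ∀ z : Fin n → ℂ,
    φ (moebius g.γ τ) (((denom g.γ τ)⁻¹)ᵀ *ᵥ z) =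
      g.ω τ ^ κ *
        e (m * (z ⬝ᵥ (((denom g.γ τ)⁻¹ * g.γ.toBlocks₂₁.map (fun x : ℤ => (x : ℂ))) *ᵥ z))) *
        φ τ z
  elliptic : ∀ a b : Fin n → ℤ, ∀ τ ∈ siegelUpperHalfSpace n, ∀ z : Fin n → ℂ,
    φ τ (z + τ *ᵥ (fun i => (a i : ℂ)) + fun i => (b i : ℂ)) =
      e (-m * ((fun i => (a i : ℂ)) ⬝ᵥ (τ *ᵥ fun i => (a i : ℂ)) +
        2 * ((fun i => (a i : ℂ)) ⬝ᵥ z))) * φ τ z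
  fourier : ∃ c, HasJacobiFourierExpansion m φ c

/-- `f = ∑_{m ≥ 0} φ_m(τ₁, z) q₂^m` is a symmetric formal Fourier-Jacobi series of genus
`g = n + 1`, cogenus `1` and weight `k = κ / 2`: every `φ_m` is a Jacobi form of weight `k` and
index `m`, and the Fourier coefficients `c(f; t)`, `t = (T, r/2; rᵀ/2, m)`, satisfy
`c(f; uᵀ t u) = det(u)^k c(f; t)` for `u ∈ GL_g(ℤ)`. Here `det(u)^k` is read on the metaplectic
cover as `s^{2k}` for every square root `s` of `det u`; for integral `k` it is the usual power. -/
structure IsSymmetricFormalFJ (n : ℕ) (κ : ℤ)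
    (φ : ℕ → Matrix (Fin n) (Fin n) ℂ → (Fin n → ℂ) → ℂ) : Prop where
  jacobi : ∀ m, IsJacobiForm n κ m (φ m)
  symmetric : ∃ c : Matrix (Fin n ⊕ Unit) (Fin n ⊕ Unit) ℚ → ℂ,
    (∀ m, HasJacobiFourierExpansion m (φ m) (fun T r => c (blockMatrix T r m))) ∧
    ∀ (u : GL (Fin n ⊕ Unit) ℤ) (t : Matrix (Fin n ⊕ Unit) (Fin n ⊕ Unit) ℚ),
      HalfIntegral t → (t.map (fun x : ℚ => (x : ℝ))).PosSemidef →
      ∀ s : ℂ, s ^ 2 = (u.val.det : ℂ) →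
        c ((u.val.map (fun x : ℤ => (x : ℚ)))ᵀ * t * u.val.map (fun x : ℤ => (x : ℚ))) =
          s ^ κ * c t

/-- A formal Fourier-Jacobi series is cuspidal if `φ_0 = 0`. -/
def IsCuspidal {n : ℕ} (φ : ℕ → Matrix (Fin n) (Fin n) ℂ → (Fin n → ℂ) → ℂ) : Prop :=
  ∀ τ ∈ siegelUpperHalfSpace n, ∀ z, φ 0 τ z = 0

/-- `v ∈ (1/N) ℤⁿ`. -/
def InTorsionLattice {n : ℕ} (N : ℕ) (v : Fin n → ℚ) : Prop :=
  ∀ i, ∃ a : ℤ, (N : ℚ) * v i = a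

/-- `η_m(τ₁) = e(m λᵀ τ₁ λ) φ_m(τ₁, τ₁ λ + μ)`. -/
def torsionSpecialization {n : ℕ} (φ : ℕ → Matrix (Fin n) (Fin n) ℂ → (Fin n → ℂ) → ℂ)
    (lam mu : Fin n → ℚ) (m : ℕ) (τ : Matrix (Fin n) (Fin n) ℂ) : ℂ :=
  e (m * ((fun i => (lam i : ℂ)) ⬝ᵥ (τ *ᵥ fun i => (lam i : ℂ)))) *
    φ m τ (τ *ᵥ (fun i => (lam i : ℂ)) + fun i => (mu i : ℂ))

end FormalFJ

end

open scoped Matrix ENNReal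

namespace FormalFJ

/-! Write n = g − 1 and, for real vectors l and u, let η_{l,u}(τ) = e(m lᵗτl) φ_m(τ, τl + u)
(`eta`). The Gaussian factor absorbs the exponential in the Jacobi transformation law: a symplectic
γ turns η_{l,u} into the weight factor times a constant phase times η_{(l,u)γ} (`eta_moebius`), and
integral shifts of (l, u) again cost only a phase (`eta_add_int`). At torsion points, Γ(N²) shifts
(l, u) by N times integral vectors and all phases become trivial, while a general γ leads to another
torsion point, so one shape of Fourier expansion serves every cusp. Its exponents are positive
definite because the GL_g(ℤ)-symmetry moves a degenerate t to index 0, where φ₀ = 0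
(`FJCoeff.posDef`).

For the norm bound, the supremum of |η_{l,u}| det(Im τ)^{k/2} over all torsion parameters is
invariant under the modular group, so by reduction theory (`siegel_induction`) it need only be
estimated on a Siegel set. Three estimates combine.

(1) For each fixed m > 0, absolute convergence gives some finite bound B(m) with no control in m
(`exists_boundedAt`). It bounds the coefficients of φ_m by a power of the discriminant
(`coeff_le_det`), and in negative weight it forces them all to vanish (`coeff_eq_zero_of_neg`).

(2) Fix an exponent t. The t-th coefficient of η_m is a sum of coefficients of f at matrices of
index m, but each of these matrices represents the value t_ii at an integral vector. By symmetry the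
coefficient equals, in absolute value, one of index m' ≤ t_ii, so only finitely many B(m') enter,
whatever m is. Determinants are preserved, which costs m^{k/2}; the number of summands is O(m^{n/2})
(`exists_coeff_le`, `exists_torsionCoeff_le`).

(3) Any bound B for the η_m bounds all their Fourier coefficients, and on a Siegel set the terms
outside a finite set of exponents, chosen independently of m, then contribute at most B/2. The
finitely many remaining terms are handled by (2). So B improves to B/2 + C m^{k+n/2}
(`exists_boundedAt_half`); iterating from the finite B(m) leaves 2C m^{k+n/2}. -/

/-! ### Unimodular matrices and reduction of positive definite forms -/

/-- Every nonzero integral vector is a multiple of a given column of a unimodular matrix. -/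
theorem exists_GL_col {ι : Type} [Fintype ι] [DecidableEq ι] (v : ι → ℤ) (hv : v ≠ 0) (i₀ : ι) :
    ∃ (u : GL ι ℤ) (d : ℤ), ∀ j, v j = d * u.val j i₀ := by
  -- Smith normal form of the rank-one module ℤv yields a basis of the lattice with one member of
  -- which v is a multiple; a transposition then puts that member at position `i₀`.
  obtain ⟨k, snf⟩ := Submodule.smithNormalForm (Pi.basisFun ℤ ι) (Submodule.span ℤ {v})
  have hrank : Module.finrank ℤ (Submodule.span ℤ {v}) = 1 := by
    have := finrank_span_eq_card (R := ℤ) (b := fun _ : Unit => v)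
      ((linearIndependent_unique_iff).2 hv)
    rwa [Set.range_const, Fintype.card_unit] at this
  have hk : k = 1 := by
    have := Module.finrank_eq_card_basis snf.bN
    simpa [hrank] using this.symm
  subst hk
  have hvm : v ∈ Submodule.span ℤ {v} := Submodule.mem_span_singleton_self v
  have hrep := snf.bN.sum_repr ⟨v, hvm⟩
  have hrep' := congrArg (Subtype.val) hrep
  simp only [Fin.sum_univ_one, Submodule.coe_smul, snf.snf] at hrep'
  let b := snf.bM.reindex (Equiv.swap (snf.f 0) i₀)
  have hb : b i₀ = snf.bM (snf.f 0) := by simp [b]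
  let A : Matrix ι ι ℤ := (Pi.basisFun ℤ ι).toMatrix b
  have hA1 : A * b.toMatrix (Pi.basisFun ℤ ι) = 1 := Module.Basis.toMatrix_mul_toMatrix_flip _ _
  have hA2 : b.toMatrix (Pi.basisFun ℤ ι) * A = 1 := Module.Basis.toMatrix_mul_toMatrix_flip _ _
  refine ⟨⟨A, b.toMatrix (Pi.basisFun ℤ ι), hA1, hA2⟩,
    (snf.bN.repr ⟨v, hvm⟩) 0 * snf.a 0, fun j => ?_⟩
  have h1 : A j i₀ = snf.bM (snf.f 0) j := by
    simp [A, Module.Basis.toMatrix_apply, hb]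
  rw [show (Units.mk A (b.toMatrix (Pi.basisFun ℤ ι)) hA1 hA2 : GL ι ℤ).val j i₀ = A j i₀ from rfl,
    h1]
  have := congrFun hrep' j
  simp only [Pi.smul_apply, smul_eq_mul] at this
  rw [← this]; ring

/-- The quadratic form `x ↦ xᵗ y x`. -/
def quad {ι : Type} [Fintype ι] (y : Matrix ι ι ℝ) (x : ι → ℝ) : ℝ := x ⬝ᵥ (y *ᵥ x)

theorem quad_smul {ι : Type} [Fintype ι] (y : Matrix ι ι ℝ) (a : ℝ) (x : ι → ℝ) :
    quad y (a • x) = a ^ 2 * quad y x := by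
  simp only [quad, Matrix.mulVec_smul, smul_dotProduct, dotProduct_smul, smul_eq_mul]; ring

theorem quad_pos {ι : Type} [Fintype ι] {y : Matrix ι ι ℝ} (hy : y.PosDef) {x : ι → ℝ}
    (hx : x ≠ 0) : 0 < quad y x := by
  simpa [quad] using hy.dotProduct_mulVec_pos hx

theorem quad_nonneg {ι : Type} [Fintype ι] {y : Matrix ι ι ℝ} (hy : y.PosSemidef) (x : ι → ℝ) :
    0 ≤ quad y x := by
  simpa [quad] using hy.dotProduct_mulVec_nonneg x

theorem quad_single {ι : Type} [Fintype ι] [DecidableEq ι] (y : Matrix ι ι ℝ) (i : ι) :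
    quad y (Pi.single i 1) = y i i := by
  simp [quad]

theorem quad_conj {ι κ : Type} [Fintype ι] [Fintype κ] (y : Matrix ι ι ℝ) (u : Matrix ι κ ℝ)
    (x : κ → ℝ) : quad (uᵀ * y * u) x = quad y (u *ᵥ x) := by
  simp only [quad]
  rw [← Matrix.mulVec_mulVec, ← Matrix.mulVec_mulVec, Matrix.dotProduct_mulVec,
    Matrix.vecMul_transpose]

theorem continuous_quad {ι : Type} [Fintype ι] (y : Matrix ι ι ℝ) : Continuous (quad y) := by
  unfold quad dotProduct Matrix.mulVec dotProduct
  fun_prop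

/-- A positive definite form dominates a multiple of the sum of squares. -/
theorem exists_quad_ge {ι : Type} [Fintype ι] {y : Matrix ι ι ℝ} (hy : y.PosDef) :
    ∃ a > 0, ∀ x : ι → ℝ, a * ∑ i, x i ^ 2 ≤ quad y x := by
  classical
  rcases isEmpty_or_nonempty ι with h | h
  · exact ⟨1, one_pos, fun x => by simp [quad, dotProduct]⟩
  have hK : IsCompact {x : ι → ℝ | ∑ i, x i ^ 2 = 1} := by
    refine Metric.isCompact_of_isClosed_isBounded
      (isClosed_eq (by fun_prop) continuous_const) ?_
    refine (Metric.isBounded_closedBall (x := (0 : ι → ℝ)) (r := 1)).subset fun x hx => ?_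
    rw [mem_closedBall_zero_iff, pi_norm_le_iff_of_nonneg zero_le_one]
    intro i
    rw [Real.norm_eq_abs, abs_le_one_iff_mul_self_le_one, ← pow_two, ← (show _ = (1:ℝ) from hx)]
    exact Finset.single_le_sum (f := fun i => x i ^ 2) (fun i _ => sq_nonneg _) (Finset.mem_univ i)
  obtain ⟨i₀⟩ := h
  obtain ⟨x₀, hx₀, hmin⟩ := hK.exists_isMinOn
    ⟨Pi.single i₀ 1, by
      show ∑ i, (Pi.single i₀ (1:ℝ) : ι → ℝ) i ^ 2 = 1
      rw [Finset.sum_eq_single i₀] <;> simp +contextual⟩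
    (continuous_quad y).continuousOn
  have hx₀' : x₀ ≠ 0 := by
    rintro rfl
    simp at hx₀
  refine ⟨quad y x₀, quad_pos hy hx₀', fun x => ?_⟩
  by_cases hx : x = 0
  · subst hx; simp [quad]
  have hs : 0 < ∑ i, x i ^ 2 := by
    obtain ⟨i, hi⟩ := Function.ne_iff.mp hx
    exact Finset.sum_pos' (fun i _ => sq_nonneg _) ⟨i, Finset.mem_univ i, by
      have : x i ≠ 0 := hi
      positivity⟩
  set s := ∑ i, x i ^ 2 with hsdef
  have h1 : quad y x₀ ≤ quad y ((Real.sqrt s)⁻¹ • x) := by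
    apply hmin
    show ∑ i, ((Real.sqrt s)⁻¹ • x) i ^ 2 = 1
    simp only [Pi.smul_apply, smul_eq_mul, mul_pow, ← Finset.mul_sum]
    rw [← hsdef, inv_pow, Real.sq_sqrt hs.le, inv_mul_cancel₀ hs.ne']
  rw [quad_smul, inv_pow, Real.sq_sqrt hs.le] at h1
  calc quad y x₀ * s ≤ (s⁻¹ * quad y x) * s := by gcongr
    _ = quad y x := by field_simp

/-- A positive definite form attains its minimum over the nonzero integral vectors. -/
theorem exists_min_vector {ι : Type} [Fintype ι] [Nonempty ι] {y : Matrix ι ι ℝ} (hy : y.PosDef) :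
    ∃ v : ι → ℤ, v ≠ 0 ∧ ∀ w : ι → ℤ, w ≠ 0 →
      quad y (fun i => (v i : ℝ)) ≤ quad y (fun i => (w i : ℝ)) := by
  classical
  obtain ⟨a, ha, hq⟩ := exists_quad_ge hy
  obtain ⟨i₀⟩ := ‹Nonempty ι›
  set e₀ : ι → ℤ := Pi.single i₀ 1 with he₀
  have he : e₀ ≠ 0 := by
    intro h; have := congrFun h i₀; simp [e₀] at this
  set q : (ι → ℤ) → ℝ := fun v => quad y (fun i => (v i : ℝ)) with hqdef
  set R : ℝ := q e₀ / a with hR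
  have hfin : {v : ι → ℤ | v ≠ 0 ∧ q v ≤ q e₀}.Finite := by
    refine (Set.Finite.pi' (fun _ : ι => Set.finite_Icc (-⌈R⌉) ⌈R⌉)).subset ?_
    rintro v ⟨-, hv⟩ i
    have h1 : a * ∑ i, (v i : ℝ) ^ 2 ≤ q e₀ := (hq _).trans hv
    have h2 : ∑ i, (v i : ℝ) ^ 2 ≤ R := by
      rw [hR, le_div_iff₀ ha]; linarith
    have h3 : (v i : ℝ) ^ 2 ≤ R :=
      (Finset.single_le_sum (f := fun i => (v i : ℝ) ^ 2) (fun i _ => sq_nonneg _)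
        (Finset.mem_univ i)).trans h2
    have h4 : ((v i ^ 2 : ℤ) : ℝ) ≤ (⌈R⌉ : ℤ) := by
      push_cast; exact h3.trans (Int.le_ceil R)
    have h5 : v i ^ 2 ≤ ⌈R⌉ := by exact_mod_cast h4
    have h6 : |v i| ≤ v i ^ 2 := by
      rw [← sq_abs]
      rcases eq_or_lt_of_le (abs_nonneg (v i)) with h | h
      · rw [← h]; norm_num
      · nlinarith
    exact abs_le.mp (h6.trans h5)
  obtain ⟨v, ⟨hv0, hv⟩, hmin⟩ := Set.exists_min_image _ q hfin ⟨e₀, he, le_rfl⟩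
  refine ⟨v, hv0, fun w hw => ?_⟩
  by_cases h : q w ≤ q e₀
  · exact hmin w ⟨hw, h⟩
  · exact hv.trans (le_of_not_ge h)

/-- Completing the square in `x 0`; what remains is the form of the Schur complement of `y 0 0`. -/
theorem quad_fin_succ {n : ℕ} {y : Matrix (Fin (n + 1)) (Fin (n + 1)) ℝ} (hy : y.IsSymm)
    (h0 : y 0 0 ≠ 0) (x : Fin (n + 1) → ℝ) :
    quad y x = y 0 0 * (x 0 + ∑ i : Fin n, y 0 i.succ / y 0 0 * x i.succ) ^ 2 +
      quad (Matrix.of fun i j : Fin n => y i.succ j.succ - y 0 i.succ * y 0 j.succ / y 0 0)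
        (fun i => x i.succ) := by
  have hs : ∀ i : Fin n, y i.succ 0 = y 0 i.succ := fun i => hy.apply 0 i.succ
  have h1 : ∑ i : Fin n, y 0 i.succ / y 0 0 * x i.succ =
      (∑ i : Fin n, y 0 i.succ * x i.succ) / y 0 0 := by
    rw [Finset.sum_div]; exact Finset.sum_congr rfl fun i _ => by ring
  have h2 : quad (Matrix.of fun i j : Fin n =>
        y i.succ j.succ - y 0 i.succ * y 0 j.succ / y 0 0) (fun i => x i.succ) =
      ∑ i : Fin n, x i.succ * ∑ j : Fin n, y i.succ j.succ * x j.succ -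
        (∑ i : Fin n, y 0 i.succ * x i.succ) ^ 2 / y 0 0 := by
    simp only [quad, dotProduct, Matrix.mulVec, Matrix.of_apply]
    rw [pow_two, Finset.sum_mul, Finset.sum_div, ← Finset.sum_sub_distrib]
    refine Finset.sum_congr rfl fun i _ => ?_
    have : ∑ j : Fin n, (y i.succ j.succ - y 0 i.succ * y 0 j.succ / y 0 0) * x j.succ =
        ∑ j : Fin n, y i.succ j.succ * x j.succ -
          y 0 i.succ / y 0 0 * ∑ j : Fin n, y 0 j.succ * x j.succ := by
      rw [Finset.mul_sum, ← Finset.sum_sub_distrib]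
      exact Finset.sum_congr rfl fun j _ => by ring
    rw [this]; ring
  rw [h1, h2]
  simp only [quad, dotProduct, Matrix.mulVec, Fin.sum_univ_succ, hs]
  have h3 : ∑ i : Fin n, x i.succ * (y 0 i.succ * x 0 + ∑ j : Fin n, y i.succ j.succ * x j.succ) =
      x 0 * (∑ i : Fin n, y 0 i.succ * x i.succ) +
        ∑ i : Fin n, x i.succ * ∑ j : Fin n, y i.succ j.succ * x j.succ := by
    rw [Finset.mul_sum, ← Finset.sum_add_distrib]
    exact Finset.sum_congr rfl fun j _ => by ring
  rw [h3]
  field_simp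
  ring

theorem intCast_mulVec_ne_zero {ι : Type} [Fintype ι] [DecidableEq ι] (u : GL ι ℤ) {w : ι → ℤ}
    (hw : w ≠ 0) : u.val *ᵥ w ≠ 0 := by
  intro h
  apply hw
  have : u⁻¹.val *ᵥ (u.val *ᵥ w) = w := by
    rw [Matrix.mulVec_mulVec, ← Units.val_mul, inv_mul_cancel]; simp
  rw [← this, h, Matrix.mulVec_zero]

/-- The real matrix underlying a unimodular matrix. -/
def realGL {ι : Type} [Fintype ι] [DecidableEq ι] (u : GL ι ℤ) : Matrix ι ι ℝ :=
  u.val.map (fun x : ℤ => (x : ℝ))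

theorem realGL_apply {ι : Type} [Fintype ι] [DecidableEq ι] (u : GL ι ℤ) (i j : ι) :
    realGL u i j = (u.val i j : ℝ) := rfl

theorem realGL_mul {ι : Type} [Fintype ι] [DecidableEq ι] (u v : GL ι ℤ) :
    realGL (u * v) = realGL u * realGL v := by
  ext i j
  simp [realGL, Matrix.mul_apply]

theorem realGL_one {ι : Type} [Fintype ι] [DecidableEq ι] :
    realGL (1 : GL ι ℤ) = 1 := by
  ext i j
  simp [realGL, Matrix.one_apply]

theorem realGL_mulVec_intCast {ι : Type} [Fintype ι] [DecidableEq ι] (u : GL ι ℤ) (w : ι → ℤ) :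
    realGL u *ᵥ (fun i => (w i : ℝ)) = fun i => ((u.val *ᵥ w) i : ℝ) := by
  ext i
  simp [realGL, Matrix.mulVec, dotProduct]

theorem realGL_mulVec_single {ι : Type} [Fintype ι] [DecidableEq ι] (u : GL ι ℤ) (i : ι) :
    realGL u *ᵥ (Pi.single i 1) = fun j => (u.val j i : ℝ) := by
  ext j; simp [realGL]

theorem isUnit_realGL {ι : Type} [Fintype ι] [DecidableEq ι] (u : GL ι ℤ) :
    IsUnit (realGL u) :=
  ⟨⟨realGL u, realGL u⁻¹, by rw [← realGL_mul, mul_inv_cancel, realGL_one],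
    by rw [← realGL_mul, inv_mul_cancel, realGL_one]⟩, rfl⟩

theorem posDef_realGL_conj {ι : Type} [Fintype ι] [DecidableEq ι] {y : Matrix ι ι ℝ}
    (hy : y.PosDef) (u : GL ι ℤ) : ((realGL u)ᵀ * y * realGL u).PosDef := by
  have := hy.conjTranspose_mul_mul_same (B := realGL u)
    (Matrix.mulVec_injective_iff_isUnit.2 (isUnit_realGL u))
  simpa using this

/-- The unimodular matrix `(1, k; 0, u)`. -/
theorem exists_GL_block {n : ℕ} (u : GL (Fin n) ℤ) (k : Fin n → ℤ) :
    ∃ w : GL (Fin (n + 1)) ℤ, w.val 0 0 = 1 ∧ (∀ j, w.val 0 (Fin.succ j) = k j) ∧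
      (∀ i, w.val (Fin.succ i) 0 = 0) ∧
      ∀ i j, w.val (Fin.succ i) (Fin.succ j) = u.val i j := by
  let A : Matrix (Fin (n + 1)) (Fin (n + 1)) ℤ :=
    Matrix.of (Fin.cons (Fin.cons 1 k) fun i => Fin.cons 0 (u.val i))
  have h0 : A 0 0 = 1 := rfl
  have h1 : ∀ j : Fin n, A 0 j.succ = k j := fun j => rfl
  have h2 : ∀ i : Fin n, A i.succ 0 = 0 := fun j => rfl
  have h3 : ∀ i j : Fin n, A i.succ j.succ = u.val i j := fun i j => rfl
  have hdet : A.det = u.val.det := by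
    rw [Matrix.det_succ_column_zero, Fin.sum_univ_succ]
    simp only [h0, h2]
    simp
    congr 1
  have hu : IsUnit A.det := by
    rw [hdet]; exact (Matrix.isUnit_iff_isUnit_det _).1 u.isUnit
  exact ⟨Matrix.nonsingInvUnit A hu, h0, h1, h2, h3⟩

set_option maxHeartbeats 800000 in
/-- Reduction theory for `GL_n(ℤ)`: every positive definite form is equivalent to one that is
comparable to its diagonal part, with a constant depending only on `n`. -/
theorem exists_reduced_basis (n : ℕ) : ∃ c : ℝ, 0 < c ∧ ∀ y : Matrix (Fin n) (Fin n) ℝ, y.PosDef →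
    ∃ u : GL (Fin n) ℤ, ∀ x : Fin n → ℝ,
      c * ∑ i, quad y (realGL u *ᵥ Pi.single i 1) * x i ^ 2 ≤ quad y (realGL u *ᵥ x) := by
  induction n with
  | zero => exact ⟨1, one_pos, fun y _ => ⟨1, fun x => by simp [quad, dotProduct]⟩⟩
  | succ n ih =>
    obtain ⟨c, hc, ih⟩ := ih
    -- Let P be the completed square and W the diagonal sum over the last n variables. The form is
    -- at least P + (3c/4) W, while the full diagonal sum is at most 2P + (n/2 + 1) W. The two
    -- entries of the minimum compare the P-parts and the W-parts.
    refine ⟨min (1 / 2) ((3 / 4 * c) / (n / 2 + 1)), by positivity, fun y hy => ?_⟩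
    obtain ⟨v, hv, hmin⟩ := exists_min_vector hy
    obtain ⟨u₁, d, hd⟩ := exists_GL_col v hv 0
    set y₁ := (realGL u₁)ᵀ * y * realGL u₁ with hy₁
    have hy₁pos : y₁.PosDef := posDef_realGL_conj hy u₁
    have hquad₁ : ∀ x, quad y₁ x = quad y (realGL u₁ *ᵥ x) := fun x => quad_conj _ _ _
    have hd0 : d ≠ 0 := by
      rintro rfl
      exact hv (funext fun j => by simpa using hd j)
    have h00 : 0 < y₁ 0 0 := hy₁pos.diag_pos
    -- The minimal vector is d times the first column of `u₁` with d² ≥ 1, so that column is itself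
    -- minimal.
    have hmin₁ : ∀ w : Fin (n + 1) → ℤ, w ≠ 0 → y₁ 0 0 ≤ quad y₁ (fun i => (w i : ℝ)) := by
      intro w hw
      have e1 : (fun i => (v i : ℝ)) = (d : ℝ) • (realGL u₁ *ᵥ Pi.single 0 1) := by
        rw [realGL_mulVec_single]
        ext j
        simp [hd j]
      have e2 := hmin _ (intCast_mulVec_ne_zero u₁ hw)
      rw [e1, quad_smul, ← hquad₁, quad_single, ← realGL_mulVec_intCast, ← hquad₁] at e2
      have : (1 : ℝ) ≤ (d : ℝ) ^ 2 := by
        have : (1 : ℤ) ≤ d ^ 2 := by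
          have := sq_nonneg d
          have : d ^ 2 ≠ 0 := pow_ne_zero 2 hd0
          omega
        exact_mod_cast this
      nlinarith
    have hsymm : y₁.IsSymm := by
      have := hy₁pos.isHermitian
      rwa [Matrix.IsHermitian, Matrix.conjTranspose_eq_transpose_of_trivial] at this
    set s : Matrix (Fin n) (Fin n) ℝ :=
      Matrix.of fun i j => y₁ i.succ j.succ - y₁ 0 i.succ * y₁ 0 j.succ / y₁ 0 0 with hs
    have hquad₂ : ∀ x, quad y₁ x = y₁ 0 0 * (x 0 + ∑ i : Fin n, y₁ 0 i.succ / y₁ 0 0 * x i.succ) ^ 2 +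
        quad s (fun i => x i.succ) := quad_fin_succ hsymm h00.ne'
    have hspos : s.PosDef := by
      refine Matrix.PosDef.of_dotProduct_mulVec_pos ?_ fun x hx => ?_
      · ext i j
        simp only [hs, Matrix.conjTranspose_apply, Matrix.of_apply, star_trivial]
        rw [hsymm.apply i.succ j.succ]; ring
      · have h1 := hquad₂ (Fin.cons (-∑ i : Fin n, y₁ 0 i.succ / y₁ 0 0 * x i) x)
        simp only [Fin.cons_zero, Fin.cons_succ] at h1
        have h2 : (Fin.cons (-∑ i : Fin n, y₁ 0 i.succ / y₁ 0 0 * x i) x : Fin (n + 1) → ℝ) ≠ 0 := by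
          intro h
          apply hx
          ext i
          simpa using congrFun h i.succ
        have h3 := quad_pos hy₁pos h2
        rw [h1] at h3
        simpa [quad] using h3
    obtain ⟨u₂, hu₂⟩ := ih s hspos
    set β : Fin n → ℝ := fun j => ∑ i : Fin n, y₁ 0 i.succ / y₁ 0 0 * (u₂.val i j : ℝ) with hβ
    -- Size reduction: subtracting integer multiples of the first basis vector brings the mixed
    -- coefficients into [−1/2, 1/2].
    obtain ⟨u₃, h300, h30, h3s0, h3s⟩ := exists_GL_block u₂ (fun j => -round (β j))
    set b : Fin n → ℝ := fun j => β j - round (β j) with hb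
    have hb2 : ∀ j, b j ^ 2 ≤ 1 / 4 := by
      intro j
      have := abs_sub_round (β j)
      rw [← sq_abs]
      have h0 := abs_nonneg (b j)
      have h1 : |b j| ≤ 1 / 2 := this
      nlinarith
    have hQ : ∀ x, quad y₁ (realGL u₃ *ᵥ x) = y₁ 0 0 * (x 0 + ∑ j, b j * x j.succ) ^ 2 +
        quad s (realGL u₂ *ᵥ fun j => x j.succ) := by
      intro x
      rw [hquad₂]
      have e0 : (realGL u₃ *ᵥ x) 0 = x 0 - ∑ j : Fin n, (round (β j) : ℝ) * x j.succ := by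
        simp [Matrix.mulVec, dotProduct, realGL_apply, Fin.sum_univ_succ, h300, h30,
          sub_eq_add_neg]
      have e1 : ∀ i : Fin n, (realGL u₃ *ᵥ x) i.succ = (realGL u₂ *ᵥ fun j => x j.succ) i := by
        intro i
        simp [Matrix.mulVec, dotProduct, realGL_apply, Fin.sum_univ_succ, h3s0, h3s]
      have e2 : ∑ i : Fin n, y₁ 0 i.succ / y₁ 0 0 * (realGL u₂ *ᵥ fun j => x j.succ) i =
          ∑ j, β j * x j.succ := by
        simp only [Matrix.mulVec, dotProduct, realGL_apply, Finset.mul_sum, hβ, Finset.sum_mul]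
        rw [Finset.sum_comm]
        exact Finset.sum_congr rfl fun i _ => Finset.sum_congr rfl fun j _ => by ring
      simp only [e1, e0, e2]
      congr 3
      rw [sub_add_eq_add_sub, add_sub_assoc, ← Finset.sum_sub_distrib]
      congr 1
      exact Finset.sum_congr rfl fun j _ => by simp only [hb]; ring
    refine ⟨u₁ * u₃, fun x => ?_⟩
    have hQ' : ∀ x, quad y (realGL (u₁ * u₃) *ᵥ x) = quad y₁ (realGL u₃ *ᵥ x) := by
      intro x
      rw [realGL_mul, ← Matrix.mulVec_mulVec, hquad₁]
    simp only [hQ']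
    rw [Fin.sum_univ_succ]
    have hA0 : quad y₁ (realGL u₃ *ᵥ Pi.single 0 1) = y₁ 0 0 := by
      rw [hQ]
      have : (fun j : Fin n => (Pi.single 0 1 : Fin (n + 1) → ℝ) j.succ) = 0 := by
        ext j; simp
      rw [this]; simp [quad]
    have hAs : ∀ j : Fin n, quad y₁ (realGL u₃ *ᵥ Pi.single j.succ 1) =
        y₁ 0 0 * b j ^ 2 + quad s (realGL u₂ *ᵥ Pi.single j 1) := by
      intro j
      rw [hQ]
      have : (fun i : Fin n => (Pi.single j.succ 1 : Fin (n + 1) → ℝ) i.succ) = Pi.single j 1 := by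
        ext i; simp [Pi.single_apply]
      rw [this]
      simp [Pi.single_apply]
    set A : Fin n → ℝ := fun j => quad y₁ (realGL u₃ *ᵥ Pi.single j.succ 1) with hA
    have hAmin : ∀ j, y₁ 0 0 ≤ A j := by
      intro j
      have hne : (Pi.single j.succ 1 : Fin (n + 1) → ℤ) ≠ 0 := by simp
      have := hmin₁ _ (intCast_mulVec_ne_zero u₃ hne)
      rw [← realGL_mulVec_intCast] at this
      convert this using 3
      ext i; simp [Pi.single_apply]
    -- A j exceeds the Schur part by `y₁ 0 0 * b j ^ 2`, which is at most A j / 4 because `y₁ 0 0`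
    -- is the minimum and |b j| ≤ 1/2.
    have hsA : ∀ j, 3 / 4 * A j ≤ quad s (realGL u₂ *ᵥ Pi.single j 1) := by
      intro j
      have h1 : A j = _ := hAs j
      nlinarith [hb2 j, hAmin j]
    have hlow : 3 / 4 * c * ∑ j, A j * x j.succ ^ 2 ≤ quad s (realGL u₂ *ᵥ fun j => x j.succ) := by
      refine le_trans ?_ (hu₂ _)
      rw [mul_comm (3 / 4 : ℝ) c, mul_assoc, Finset.mul_sum]
      refine mul_le_mul_of_nonneg_left (Finset.sum_le_sum fun j _ => ?_) hc.le
      rw [← mul_assoc]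
      exact mul_le_mul_of_nonneg_right (hsA j) (sq_nonneg _)
    have hY : y₁ 0 0 * (∑ j, b j * x j.succ) ^ 2 ≤ n / 4 * ∑ j, A j * x j.succ ^ 2 := by
      have h1 : (∑ j, b j * x j.succ) ^ 2 ≤ n * ∑ j, (b j * x j.succ) ^ 2 := by
        simpa using sq_sum_le_card_mul_sum_sq (s := Finset.univ) (f := fun j => b j * x j.succ)
      have h2 : y₁ 0 0 * ∑ j, (b j * x j.succ) ^ 2 ≤ 1 / 4 * ∑ j, A j * x j.succ ^ 2 := by
        rw [Finset.mul_sum, Finset.mul_sum]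
        refine Finset.sum_le_sum fun j _ => ?_
        rw [mul_pow]
        calc y₁ 0 0 * (b j ^ 2 * x j.succ ^ 2) ≤ A j * (1 / 4 * x j.succ ^ 2) := by
              gcongr
              · exact h00.le.trans (hAmin j)
              · exact hAmin j
              · exact hb2 j
          _ = 1 / 4 * (A j * x j.succ ^ 2) := by ring
      calc y₁ 0 0 * (∑ j, b j * x j.succ) ^ 2 ≤ y₁ 0 0 * (n * ∑ j, (b j * x j.succ) ^ 2) := by
            gcongr
        _ = n * (y₁ 0 0 * ∑ j, (b j * x j.succ) ^ 2) := by ring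
        _ ≤ n * (1 / 4 * ∑ j, A j * x j.succ ^ 2) := by gcongr
        _ = _ := by ring
    rw [hA0, hQ]
    set Y := ∑ j, b j * x j.succ with hYdef
    set W := ∑ j, A j * x j.succ ^ 2 with hW
    have hW0 : 0 ≤ W := Finset.sum_nonneg fun j _ =>
      mul_nonneg (h00.le.trans (hAmin j)) (sq_nonneg _)
    have hx0 : y₁ 0 0 * x 0 ^ 2 ≤ 2 * (y₁ 0 0 * (x 0 + Y) ^ 2) + n / 2 * W := by
      have : x 0 ^ 2 ≤ 2 * (x 0 + Y) ^ 2 + 2 * Y ^ 2 := by nlinarith [sq_nonneg (x 0 + 2 * Y)]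
      nlinarith
    set m := min (1 / 2 : ℝ) ((3 / 4 * c) / (n / 2 + 1)) with hm
    have hm0 : 0 < m := by positivity
    have hm1 : m ≤ 1 / 2 := min_le_left _ _
    have hm2 : m * (n / 2 + 1) ≤ 3 / 4 * c := by
      rw [← le_div_iff₀ (by positivity)]; exact min_le_right _ _
    have hP : 0 ≤ y₁ 0 0 * (x 0 + Y) ^ 2 := mul_nonneg h00.le (sq_nonneg _)
    have h1 : m * (y₁ 0 0 * x 0 ^ 2 + W) ≤
        m * (2 * (y₁ 0 0 * (x 0 + Y) ^ 2) + n / 2 * W + W) :=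
      mul_le_mul_of_nonneg_left (by linarith) hm0.le
    have h2 := mul_le_mul_of_nonneg_right hm1 hP
    have h3 := mul_le_mul_of_nonneg_right hm2 hW0
    linarith

/-! ### The symplectic action on the Siegel upper half space -/

/-- The complex matrix underlying an integral matrix. -/
abbrev cx {ι κ : Type} (A : Matrix ι κ ℤ) : Matrix ι κ ℂ := A.map (fun x : ℤ => (x : ℂ))

theorem cx_mul {ι κ l : Type} [Fintype κ] (A : Matrix ι κ ℤ) (B : Matrix κ l ℤ) :
    cx (A * B) = cx A * cx B := by
  ext i j; simp [cx, Matrix.mul_apply]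

theorem conjTranspose_cx {ι κ : Type} (A : Matrix ι κ ℤ) : (cx A)ᴴ = (cx A)ᵀ := by
  ext i j; simp [cx]

section Symplectic

variable {n : ℕ} {γ : Matrix (Fin n ⊕ Fin n) (Fin n ⊕ Fin n) ℤ}

theorem symplectic_relations_int
    (hγ : γ ∈ Matrix.symplecticGroup (Fin n) ℤ) :
    γ.toBlocks₁₁ᵀ * γ.toBlocks₂₁ = γ.toBlocks₂₁ᵀ * γ.toBlocks₁₁ ∧
    γ.toBlocks₁₂ᵀ * γ.toBlocks₂₂ = γ.toBlocks₂₂ᵀ * γ.toBlocks₁₂ ∧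
    γ.toBlocks₁₁ᵀ * γ.toBlocks₂₂ - γ.toBlocks₂₁ᵀ * γ.toBlocks₁₂ = 1 := by
  rw [← Matrix.fromBlocks_toBlocks γ] at hγ
  simpa using SymplecticGroup.fromBlocks_mem_iff.1 hγ

theorem symplectic_relations
    (hγ : γ ∈ Matrix.symplecticGroup (Fin n) ℤ) :
    (cx γ.toBlocks₁₁)ᵀ * cx γ.toBlocks₂₁ = (cx γ.toBlocks₂₁)ᵀ * cx γ.toBlocks₁₁ ∧
    (cx γ.toBlocks₁₂)ᵀ * cx γ.toBlocks₂₂ = (cx γ.toBlocks₂₂)ᵀ * cx γ.toBlocks₁₂ ∧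
    (cx γ.toBlocks₁₁)ᵀ * cx γ.toBlocks₂₂ - (cx γ.toBlocks₂₁)ᵀ * cx γ.toBlocks₁₂ = 1 := by
  obtain ⟨h1, h2, h3⟩ := symplectic_relations_int hγ
  have ht : ∀ A : Matrix (Fin n) (Fin n) ℤ, (cx A)ᵀ = cx Aᵀ := fun _ => rfl
  simp only [ht, ← cx_mul]
  refine ⟨by rw [h1], by rw [h2], ?_⟩
  have := congrArg cx h3
  ext i j
  have := congrFun (congrFun this i) j
  simpa [cx, Matrix.one_apply] using this

theorem symplectic_relation'
    (hγ : γ ∈ Matrix.symplecticGroup (Fin n) ℤ) :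
    (cx γ.toBlocks₂₂)ᵀ * cx γ.toBlocks₁₁ - (cx γ.toBlocks₁₂)ᵀ * cx γ.toBlocks₂₁ = 1 := by
  have := congrArg Matrix.transpose (symplectic_relations hγ).2.2
  simpa [Matrix.transpose_mul] using this

end Symplectic

/-- `a τ + b` for `γ = (a b; c d)`. -/
def numer {n : ℕ} (γ : Matrix (Fin n ⊕ Fin n) (Fin n ⊕ Fin n) ℤ)
    (τ : Matrix (Fin n) (Fin n) ℂ) : Matrix (Fin n) (Fin n) ℂ :=
  cx γ.toBlocks₁₁ * τ + cx γ.toBlocks₁₂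

theorem denom_eq {n : ℕ} (γ : Matrix (Fin n ⊕ Fin n) (Fin n ⊕ Fin n) ℤ)
    (τ : Matrix (Fin n) (Fin n) ℂ) : denom γ τ = cx γ.toBlocks₂₁ * τ + cx γ.toBlocks₂₂ := rfl

theorem moebius_eq {n : ℕ} (γ : Matrix (Fin n ⊕ Fin n) (Fin n ⊕ Fin n) ℤ)
    (τ : Matrix (Fin n) (Fin n) ℂ) : moebius γ τ = numer γ τ * (denom γ τ)⁻¹ := rfl

/-- The imaginary part as a complex matrix. -/
def imC {n : ℕ} (τ : Matrix (Fin n) (Fin n) ℂ) : Matrix (Fin n) (Fin n) ℂ :=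
  (τ.map Complex.im).map (fun x : ℝ => (x : ℂ))

theorem sub_conjTranspose {n : ℕ} {τ : Matrix (Fin n) (Fin n) ℂ} (hτ : τ.IsSymm) :
    τ - τᴴ = (2 * Complex.I) • imC τ := by
  ext i j
  rw [Matrix.sub_apply, Matrix.conjTranspose_apply, hτ.apply i j]
  simp only [imC, Matrix.smul_apply, Matrix.map_apply, smul_eq_mul]
  apply Complex.ext <;> simp; ring

theorem star_dotProduct_ofReal_mulVec {ι : Type} [Fintype ι] {y : Matrix ι ι ℝ} (hy : y.IsSymm)
    (v : ι → ℂ) : star v ⬝ᵥ (y.map (fun x : ℝ => (x : ℂ)) *ᵥ v) =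
      ((quad y (fun i => (v i).re) + quad y (fun i => (v i).im) : ℝ) : ℂ) := by
  have hsum : ∀ p q : ι → ℝ, p ⬝ᵥ (y *ᵥ q) = q ⬝ᵥ (y *ᵥ p) := by
    intro p q
    rw [Matrix.dotProduct_mulVec, ← Matrix.mulVec_transpose, hy.eq, dotProduct_comm]
  apply Complex.ext
  · simp only [dotProduct, Matrix.mulVec, Matrix.map_apply, quad, Complex.ofReal_re,
      Complex.re_sum, Complex.mul_re, Pi.star_apply, Complex.im_sum, Complex.mul_im,
      Complex.ofReal_im, zero_mul, sub_zero, add_zero, RCLike.star_def, Complex.conj_re,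
      Complex.conj_im]
    rw [← Finset.sum_add_distrib]
    exact Finset.sum_congr rfl fun i _ => by ring
  · have := hsum (fun i => (v i).re) (fun i => (v i).im)
    simp only [dotProduct, Matrix.mulVec] at this
    simp only [dotProduct, Matrix.mulVec, Matrix.map_apply, Complex.ofReal_im,
      Complex.re_sum, Complex.mul_re, Pi.star_apply, Complex.im_sum, Complex.mul_im,
      Complex.ofReal_re, Complex.ofReal_im, zero_mul, sub_zero, add_zero, RCLike.star_def,
      Complex.conj_re, Complex.conj_im, neg_mul, Finset.sum_add_distrib, Finset.sum_neg_distrib]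
    rw [this]; ring

theorem isSymm_of_posDef {ι : Type} {y : Matrix ι ι ℝ} (hy : y.PosDef) : y.IsSymm := by
  have := hy.isHermitian
  rwa [Matrix.IsHermitian, Matrix.conjTranspose_eq_transpose_of_trivial] at this

section Moebius

variable {n : ℕ} {γ : Matrix (Fin n ⊕ Fin n) (Fin n ⊕ Fin n) ℤ} {τ : Matrix (Fin n) (Fin n) ℂ}

theorem denom_transpose_mul_numer
    (hγ : γ ∈ Matrix.symplecticGroup (Fin n) ℤ) (hτ : τ.IsSymm) :
    (denom γ τ)ᵀ * numer γ τ = (numer γ τ)ᵀ * denom γ τ := by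
  obtain ⟨h1, h2, h3⟩ := symplectic_relations hγ
  have h4 := symplectic_relation' hγ
  rw [denom_eq, numer]
  simp only [Matrix.transpose_add, Matrix.transpose_mul, hτ.eq]
  set A := cx γ.toBlocks₁₁
  set B := cx γ.toBlocks₁₂
  set C := cx γ.toBlocks₂₁
  set D := cx γ.toBlocks₂₂
  have e : (τ * Cᵀ + Dᵀ) * (A * τ + B) - (τ * Aᵀ + Bᵀ) * (C * τ + D) =
      τ * (Cᵀ * A - Aᵀ * C) * τ - τ * (Aᵀ * D - Cᵀ * B) + (Dᵀ * A - Bᵀ * C) * τ +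
        (Dᵀ * B - Bᵀ * D) := by noncomm_ring
  rw [← sub_eq_zero, e, h1, h2, h3, h4]
  simp

/-- After expansion the quadratic and constant terms cancel by the symplectic relations and the
linear ones survive. This identity yields both the invertibility of cτ + d and the transformation
law of Im τ. -/
theorem denom_conjTranspose_mul_numer
    (hγ : γ ∈ Matrix.symplecticGroup (Fin n) ℤ) (τ : Matrix (Fin n) (Fin n) ℂ) :
    (denom γ τ)ᴴ * numer γ τ - (numer γ τ)ᴴ * denom γ τ = τ - τᴴ := by
  obtain ⟨h1, h2, h3⟩ := symplectic_relations hγ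
  have h4 := symplectic_relation' hγ
  rw [denom_eq, numer]
  simp only [Matrix.conjTranspose_add, Matrix.conjTranspose_mul, conjTranspose_cx]
  set A := cx γ.toBlocks₁₁
  set B := cx γ.toBlocks₁₂
  set C := cx γ.toBlocks₂₁
  set D := cx γ.toBlocks₂₂
  have e : (τᴴ * Cᵀ + Dᵀ) * (A * τ + B) - (τᴴ * Aᵀ + Bᵀ) * (C * τ + D) =
      τᴴ * (Cᵀ * A - Aᵀ * C) * τ - τᴴ * (Aᵀ * D - Cᵀ * B) + (Dᵀ * A - Bᵀ * C) * τ +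
        (Dᵀ * B - Bᵀ * D) := by noncomm_ring
  rw [e, h1, h2, h3, h4]
  simp only [sub_self, mul_zero, zero_mul, mul_one, one_mul, zero_sub, add_zero]
  abel

/-- If (cτ + d)v = 0, the preceding identity gives v*(Im τ)v = 0, hence v = 0. -/
theorem det_denom_ne_zero
    (hγ : γ ∈ Matrix.symplecticGroup (Fin n) ℤ) (hτ : τ ∈ siegelUpperHalfSpace n) : (denom γ τ).det ≠ 0 := by
  intro h
  obtain ⟨v, hv, hv0⟩ := Matrix.exists_mulVec_eq_zero_iff.2 h
  have h1 := denom_conjTranspose_mul_numer hγ τ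
  rw [sub_conjTranspose hτ.1] at h1
  have h2 : star v ⬝ᵥ (((denom γ τ)ᴴ * numer γ τ - (numer γ τ)ᴴ * denom γ τ) *ᵥ v) = 0 := by
    rw [Matrix.sub_mulVec, ← Matrix.mulVec_mulVec, ← Matrix.mulVec_mulVec, hv0,
      Matrix.mulVec_zero, sub_zero, Matrix.dotProduct_mulVec, ← Matrix.star_mulVec, hv0]
    simp
  rw [h1, Matrix.smul_mulVec, dotProduct_smul, imC,
    star_dotProduct_ofReal_mulVec (isSymm_of_posDef hτ.2), smul_eq_mul, mul_eq_zero] at h2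
  have h3 : quad (τ.map Complex.im) (fun i => (v i).re) +
      quad (τ.map Complex.im) (fun i => (v i).im) = 0 := by
    rcases h2 with h2 | h2
    · simp at h2
    · exact_mod_cast h2
  have hre := quad_nonneg hτ.2.posSemidef (fun i => (v i).re)
  have him := quad_nonneg hτ.2.posSemidef (fun i => (v i).im)
  apply hv
  have a1 : (fun i => (v i).re) = 0 := by
    by_contra hne
    have := quad_pos hτ.2 hne
    linarith
  have a2 : (fun i => (v i).im) = 0 := by
    by_contra hne
    have := quad_pos hτ.2 hne
    linarith
  ext i
  exact Complex.ext (congrFun a1 i) (congrFun a2 i)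

theorem isUnit_denom
    (hγ : γ ∈ Matrix.symplecticGroup (Fin n) ℤ) (hτ : τ ∈ siegelUpperHalfSpace n) : IsUnit (denom γ τ).det :=
  isUnit_iff_ne_zero.2 (det_denom_ne_zero hγ hτ)

theorem moebius_mul_denom
    (hγ : γ ∈ Matrix.symplecticGroup (Fin n) ℤ) (hτ : τ ∈ siegelUpperHalfSpace n) :
    moebius γ τ * denom γ τ = numer γ τ := by
  rw [moebius_eq, Matrix.mul_assoc, Matrix.nonsing_inv_mul _ (isUnit_denom hγ hτ), mul_one]

theorem moebius_isSymm
    (hγ : γ ∈ Matrix.symplecticGroup (Fin n) ℤ) (hτ : τ ∈ siegelUpperHalfSpace n) : (moebius γ τ).IsSymm := by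
  have hu := isUnit_denom hγ hτ
  have h := denom_transpose_mul_numer hγ hτ.1
  have hu' : IsUnit (denom γ τ)ᵀ.det := by rwa [Matrix.det_transpose]
  rw [← moebius_mul_denom hγ hτ, Matrix.transpose_mul, ← Matrix.mul_assoc] at h
  have h2 := congrArg (fun X => X * (denom γ τ)⁻¹) h
  simp only [Matrix.mul_assoc, Matrix.mul_nonsing_inv _ hu, mul_one] at h2
  have h3 := congrArg (fun X => (denom γ τ)ᵀ⁻¹ * X) h2
  simp only [← Matrix.mul_assoc, Matrix.nonsing_inv_mul _ hu', one_mul] at h3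
  exact h3.symm

theorem denom_transpose_mul_moebius
    (hγ : γ ∈ Matrix.symplecticGroup (Fin n) ℤ) (hτ : τ ∈ siegelUpperHalfSpace n) :
    (denom γ τ)ᵀ * moebius γ τ = (numer γ τ)ᵀ := by
  rw [← moebius_mul_denom hγ hτ, Matrix.transpose_mul, (moebius_isSymm hγ hτ).eq]

theorem imC_moebius
    (hγ : γ ∈ Matrix.symplecticGroup (Fin n) ℤ) (hτ : τ ∈ siegelUpperHalfSpace n) :
    (denom γ τ)ᴴ * imC (moebius γ τ) * denom γ τ = imC τ := by
  have h1 := denom_conjTranspose_mul_numer hγ τ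
  rw [sub_conjTranspose hτ.1, ← moebius_mul_denom hγ hτ, Matrix.conjTranspose_mul] at h1
  have e : (denom γ τ)ᴴ * (moebius γ τ * denom γ τ) -
      (denom γ τ)ᴴ * (moebius γ τ)ᴴ * denom γ τ =
      (denom γ τ)ᴴ * (moebius γ τ - (moebius γ τ)ᴴ) * denom γ τ := by noncomm_ring
  rw [e, sub_conjTranspose (moebius_isSymm hγ hτ), Matrix.mul_smul, Matrix.smul_mul] at h1
  exact smul_right_injective _ (by simp : (2 * Complex.I) ≠ 0) h1

theorem moebius_mem
    (hγ : γ ∈ Matrix.symplecticGroup (Fin n) ℤ) (hτ : τ ∈ siegelUpperHalfSpace n) : moebius γ τ ∈ siegelUpperHalfSpace n := by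
  have hs := moebius_isSymm hγ hτ
  have hs' : ((moebius γ τ).map Complex.im).IsSymm := by
    ext i j
    simp [hs.apply i j]
  refine ⟨hs, Matrix.PosDef.of_dotProduct_mulVec_pos ?_ fun x hx => ?_⟩
  · rwa [Matrix.IsHermitian, Matrix.conjTranspose_eq_transpose_of_trivial]
  set v : Fin n → ℂ := (denom γ τ)⁻¹ *ᵥ (fun i => (x i : ℂ)) with hv
  have hQv : denom γ τ *ᵥ v = fun i => (x i : ℂ) := by
    rw [hv, Matrix.mulVec_mulVec, Matrix.mul_nonsing_inv _ (isUnit_denom hγ hτ), Matrix.one_mulVec]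
  have h1 := star_dotProduct_ofReal_mulVec hs' (fun i => (x i : ℂ))
  have h2 := star_dotProduct_ofReal_mulVec (isSymm_of_posDef hτ.2) v
  have h3 : star v ⬝ᵥ (imC τ *ᵥ v) =
      star (fun i => (x i : ℂ)) ⬝ᵥ (imC (moebius γ τ) *ᵥ (fun i => (x i : ℂ))) := by
    rw [← imC_moebius hγ hτ, ← Matrix.mulVec_mulVec, ← Matrix.mulVec_mulVec, hQv,
      Matrix.dotProduct_mulVec, ← Matrix.star_mulVec, hQv]
  simp only [imC] at h3
  rw [h3, h1] at h2
  have h4 : quad ((moebius γ τ).map Complex.im) x =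
      quad (τ.map Complex.im) (fun i => (v i).re) + quad (τ.map Complex.im) (fun i => (v i).im) := by
    have h5 : quad ((moebius γ τ).map Complex.im) x + quad ((moebius γ τ).map Complex.im) 0 =
      quad (τ.map Complex.im) (fun i => (v i).re) + quad (τ.map Complex.im) (fun i => (v i).im) := by
      exact_mod_cast h2
    simpa [quad] using h5
  have hv0 : v ≠ 0 := by
    intro h
    apply hx
    rw [h, Matrix.mulVec_zero] at hQv
    ext i
    have := congrFun hQv i
    simpa using this.symm
  have hpos : 0 < quad ((moebius γ τ).map Complex.im) x := by
    rw [h4]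
    have hre := quad_nonneg hτ.2.posSemidef (fun i => (v i).re)
    have him := quad_nonneg hτ.2.posSemidef (fun i => (v i).im)
    by_cases hvre : (fun i => (v i).re) = 0
    · have hvim : (fun i => (v i).im) ≠ 0 := by
        intro hvim
        exact hv0 (funext fun i => Complex.ext (congrFun hvre i) (congrFun hvim i))
      have := quad_pos hτ.2 hvim
      linarith
    · have := quad_pos hτ.2 hvre
      linarith
  simpa [quad] using hpos

theorem det_im_moebius
    (hγ : γ ∈ Matrix.symplecticGroup (Fin n) ℤ) (hτ : τ ∈ siegelUpperHalfSpace n) :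
    ‖(denom γ τ).det‖ ^ 2 * ((moebius γ τ).map Complex.im).det = (τ.map Complex.im).det := by
  have h := congrArg Matrix.det (imC_moebius hγ hτ)
  have hd : ∀ σ : Matrix (Fin n) (Fin n) ℂ, (imC σ).det = (((σ.map Complex.im).det : ℝ) : ℂ) := by
    intro σ
    exact (RingHom.map_det Complex.ofRealHom _).symm
  rw [Matrix.det_mul, Matrix.det_mul, Matrix.det_conjTranspose, hd, hd, RCLike.star_def] at h
  have e : (starRingEnd ℂ) (denom γ τ).det * (((moebius γ τ).map Complex.im).det : ℂ) *
      (denom γ τ).det = ((‖(denom γ τ).det‖ ^ 2 * ((moebius γ τ).map Complex.im).det : ℝ) : ℂ) := by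
    rw [mul_right_comm, mul_comm ((starRingEnd ℂ) _), Complex.mul_conj, Complex.normSq_eq_norm_sq]
    push_cast; ring
  rw [e] at h
  exact_mod_cast h

/-- `(c τ + d)ᵗ (γτ p + q) = τ p' + q'` with `p' = aᵗ p + cᵗ q` and `q' = bᵗ p + dᵗ q`. -/
theorem denom_transpose_mulVec
    (hγ : γ ∈ Matrix.symplecticGroup (Fin n) ℤ) (hτ : τ ∈ siegelUpperHalfSpace n) (p q : Fin n → ℂ) :
    (denom γ τ)ᵀ *ᵥ (moebius γ τ *ᵥ p + q) =
      τ *ᵥ ((cx γ.toBlocks₁₁)ᵀ *ᵥ p + (cx γ.toBlocks₂₁)ᵀ *ᵥ q) +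
        ((cx γ.toBlocks₁₂)ᵀ *ᵥ p + (cx γ.toBlocks₂₂)ᵀ *ᵥ q) := by
  rw [Matrix.mulVec_add, Matrix.mulVec_mulVec, denom_transpose_mul_moebius hγ hτ, numer, denom_eq]
  simp only [Matrix.transpose_add, Matrix.transpose_mul, hτ.1.eq, Matrix.add_mulVec,
    Matrix.mulVec_add, Matrix.mulVec_mulVec]
  abel

end Moebius

section Generators

variable {n : ℕ}

/-- The translation `τ ↦ τ + b` by an integral symmetric matrix. -/
theorem exists_mp_translation (b : Matrix (Fin n) (Fin n) ℤ) (hb : b.IsSymm) :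
    ∃ g : Mp n, ∀ τ, moebius g.γ τ = τ + cx b := by
  have hden : ∀ τ, denom (Matrix.fromBlocks 1 b 0 1) τ = 1 := by
    intro τ
    rw [denom_eq]
    simp [cx]
  refine ⟨⟨Matrix.fromBlocks 1 b 0 1, ?_, fun _ => 1, differentiableOn_const _, ?_⟩, ?_⟩
  · rw [SymplecticGroup.fromBlocks_mem_iff]
    simp [hb.eq]
  · intro τ _
    rw [hden]; simp
  · intro τ
    rw [moebius_eq, hden, numer]
    simp [cx]

/-- The transformation `τ ↦ uᵗ τ u` for `u ∈ GL_n(ℤ)`. -/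
theorem exists_mp_GL (u : GL (Fin n) ℤ) :
    ∃ g : Mp n, ∀ τ, moebius g.γ τ = (cx u.val)ᵀ * τ * cx u.val := by
  have hden : ∀ τ, denom (Matrix.fromBlocks u.valᵀ 0 0 u⁻¹.val) τ = cx u⁻¹.val := by
    intro τ
    rw [denom_eq]
    simp [cx]
  have hinv : cx u⁻¹.val * cx u.val = 1 := by
    rw [← cx_mul, ← Units.val_mul, inv_mul_cancel]
    simp [cx]
  obtain ⟨s, hs⟩ := IsAlgClosed.exists_pow_nat_eq (cx u⁻¹.val).det two_pos
  refine ⟨⟨Matrix.fromBlocks u.valᵀ 0 0 u⁻¹.val, ?_, fun _ => s,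
    differentiableOn_const _, ?_⟩, ?_⟩
  · rw [SymplecticGroup.fromBlocks_mem_iff]
    simp
  · intro τ _
    rw [hden, hs]
  · intro τ
    rw [moebius_eq, hden, numer, Matrix.inv_eq_right_inv hinv]
    simp [cx, Matrix.transpose_map]

/-- The partial inversion in the `i`-th coordinate, with `det (c τ + d) = τ_{ii}`. -/
theorem exists_mp_inversion (i : Fin n) : ∃ g : Mp n, ∀ τ, (denom g.γ τ).det = τ i i := by
  set E : Matrix (Fin n) (Fin n) ℤ := Matrix.single i i 1 with hE
  have hEE : E * E = E := by simp [hE]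
  have hEt : Eᵀ = E := by simp [hE]
  have hden : ∀ τ, (denom (Matrix.fromBlocks (1 - E) (-E) E (1 - E)) τ).det = τ i i := by
    intro τ
    -- Only the i-th row differs from the identity: a rank-one perturbation, whose determinant is
    -- explicit.
    have h1 : denom (Matrix.fromBlocks (1 - E) (-E) E (1 - E)) τ =
        1 + Matrix.replicateCol Unit (Pi.single i 1 : Fin n → ℂ) *
          Matrix.replicateRow Unit (τ i - Pi.single i 1) := by
      rw [denom_eq]
      ext a b
      simp only [Matrix.toBlocks_fromBlocks₂₁, Matrix.toBlocks_fromBlocks₂₂, Matrix.add_apply,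
        Matrix.mul_apply, cx, Matrix.map_apply, hE, Matrix.single_apply, Matrix.sub_apply,
        Matrix.one_apply, Finset.univ_unique, Finset.sum_singleton, Matrix.replicateCol_apply,
        Matrix.replicateRow_apply, Pi.single_apply, Pi.sub_apply]
      by_cases ha : i = a
      · subst ha
        by_cases hb : i = b
        · subst hb; simp
        · simp [hb, Ne.symm hb]
      · simp [ha, Ne.symm ha]
    rw [h1, Matrix.det_one_add_replicateCol_mul_replicateRow]
    simp
  refine ⟨⟨Matrix.fromBlocks (1 - E) (-E) E (1 - E), ?_, fun τ => (τ i i) ^ (1 / 2 : ℂ), ?_, ?_⟩,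
    hden⟩
  · rw [SymplecticGroup.fromBlocks_mem_iff]
    simp only [Matrix.transpose_sub, Matrix.transpose_one, Matrix.transpose_neg, hEt]
    refine ⟨?_, ?_, ?_⟩ <;> noncomm_ring
    simp [hEE]
  -- The diagonal entry lies in the upper half plane, away from the cut of the principal square
  -- root.
  · have h : ∀ s : Set (Fin n → Fin n → ℂ), (∀ τ ∈ s, 0 < (τ i i).im) →
        DifferentiableOn ℂ (fun τ : Fin n → Fin n → ℂ => (τ i i) ^ (1 / 2 : ℂ)) s := by
      intro s hs τ hτ
      refine DifferentiableWithinAt.cpow (by fun_prop) (differentiableWithinAt_const _) ?_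
      exact Or.inr (hs τ hτ).ne'
    exact h _ fun τ hτ => hτ.2.diag_pos (i := i)
  · intro τ _
    rw [hden, ← Complex.cpow_nat_mul]
    simp

end Generators

/-! ### Hermite's inequality and reduction theory for the symplectic group -/

theorem quad_inv_mulVec {ι : Type} [Fintype ι] [DecidableEq ι] {y : Matrix ι ι ℝ} (hy : y.PosDef)
    (p : ι → ℝ) : quad y⁻¹ (y *ᵥ p) = quad y p := by
  rw [quad, Matrix.mulVec_mulVec, Matrix.nonsing_inv_mul _ ((Matrix.isUnit_iff_isUnit_det _).1 hy.isUnit),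
    Matrix.one_mulVec, quad, dotProduct_comm]

theorem abs_apply_le_of_posSemidef {ι : Type} [Fintype ι] [DecidableEq ι] {P : Matrix ι ι ℝ}
    (hP : P.PosSemidef) (i j : ι) : |P i j| ≤ (P i i + P j j) / 2 := by
  have hs : P j i = P i j := by
    have := congrFun (congrFun hP.isHermitian i) j
    simpa using this
  have h1 := quad_nonneg hP (Pi.single i 1 + Pi.single j 1)
  have h2 := quad_nonneg hP (Pi.single i 1 - Pi.single j 1)
  simp only [quad, Matrix.mulVec_add, Matrix.mulVec_sub, add_dotProduct, sub_dotProduct,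
    dotProduct_add, dotProduct_sub, Matrix.mulVec_single_one, single_one_dotProduct, Matrix.col_apply] at h1 h2
  rw [abs_le]
  constructor <;> linarith

/-- The hypothesis bounds every entry of y⁻¹ by 1/a, and the Leibniz expansion of det y⁻¹ has n!
terms. -/
theorem det_ge_of_quad_ge {n : ℕ} {y : Matrix (Fin n) (Fin n) ℝ} (hy : y.PosDef) {a : ℝ}
    (ha : 0 < a) (h : ∀ x, a * ∑ i, x i ^ 2 ≤ quad y x) : a ^ n / n.factorial ≤ y.det := by
  have hdiag : ∀ i, y⁻¹ i i ≤ 1 / a := by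
    intro i
    have h1 := h (y⁻¹ *ᵥ Pi.single i 1)
    have hyy : y *ᵥ (y⁻¹ *ᵥ Pi.single i 1) = Pi.single i 1 := by
      rw [Matrix.mulVec_mulVec, Matrix.mul_nonsing_inv _ ((Matrix.isUnit_iff_isUnit_det _).1 hy.isUnit),
        Matrix.one_mulVec]
    rw [quad, hyy] at h1
    simp only [dotProduct_single_one, Matrix.mulVec_single_one, Matrix.col_apply] at h1
    have h2 : y⁻¹ i i ^ 2 ≤ ∑ j, y⁻¹ j i ^ 2 :=
      Finset.single_le_sum (f := fun j => y⁻¹ j i ^ 2) (fun j _ => sq_nonneg _) (Finset.mem_univ i)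
    have h3 := hy.inv.diag_pos (i := i)
    rw [le_div_iff₀ ha]
    by_contra hcon
    nlinarith
  have hent : ∀ i j, AbsoluteValue.abs (y⁻¹ i j) ≤ 1 / a := by
    intro i j
    have := abs_apply_le_of_posSemidef hy.inv.posSemidef i j
    have h1 := hdiag i
    have h2 := hdiag j
    calc |y⁻¹ i j| ≤ _ := this
      _ ≤ 1 / a := by linarith
  have hd := Matrix.det_le hent
  have hdy : 0 < y.det := hy.det_pos
  rw [Matrix.det_nonsing_inv, Ring.inverse_eq_inv'] at hd
  simp only [AbsoluteValue.abs_apply, Fintype.card_fin, nsmul_eq_mul, abs_of_pos (inv_pos.2 hdy)] at hd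
  rw [div_le_iff₀ (by positivity)]
  rw [inv_le_iff_one_le_mul₀ hdy, div_pow, one_pow] at hd
  have hap : 0 < a ^ n := by positivity
  have := mul_le_mul_of_nonneg_left hd hap.le
  calc a ^ n = a ^ n * 1 := by ring
    _ ≤ _ := this
    _ = _ := by field_simp

/-- The positive definite form `(p, q) ↦ y⁻¹[x p + q] + y[p]` attached to `τ = x + i y`. -/
noncomputable def siegelForm {n : ℕ} (τ : Matrix (Fin n) (Fin n) ℂ) (p q : Fin n → ℝ) : ℝ :=
  quad (τ.map Complex.im)⁻¹ (τ.map Complex.re *ᵥ p + q) + quad (τ.map Complex.im) p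

/-- With ξ = τp + q and y = Im τ, the form is the Hermitian norm ξ* y⁻¹ ξ, since y⁻¹[yp] = y[p].
Supplying ζ with yζ = ξ hides the inverse and makes the change of variables under γ easy. -/
theorem siegelForm_eq {n : ℕ} {τ : Matrix (Fin n) (Fin n) ℂ} (hτ : τ ∈ siegelUpperHalfSpace n)
    (p q : Fin n → ℝ) (ζ : Fin n → ℂ)
    (hζ : imC τ *ᵥ ζ = τ *ᵥ (fun i => (p i : ℂ)) + fun i => (q i : ℂ)) :
    star (τ *ᵥ (fun i => (p i : ℂ)) + fun i => (q i : ℂ)) ⬝ᵥ ζ = (siegelForm τ p q : ℂ) := by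
  have hu := (Matrix.isUnit_iff_isUnit_det _).1 hτ.2.isUnit
  have hinv : ((τ.map Complex.im)⁻¹.map (fun x : ℝ => (x : ℂ))) * imC τ = 1 := by
    have := congrArg (fun X : Matrix (Fin n) (Fin n) ℝ => X.map Complex.ofRealHom)
      (Matrix.nonsing_inv_mul _ hu)
    simp only [Matrix.map_mul] at this
    rw [Matrix.map_one _ (map_zero _) (map_one _)] at this
    exact this
  have hζ' : ζ = (τ.map Complex.im)⁻¹.map (fun x : ℝ => (x : ℂ)) *ᵥ
      (τ *ᵥ (fun i => (p i : ℂ)) + fun i => (q i : ℂ)) := by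
    rw [← hζ, Matrix.mulVec_mulVec, hinv, Matrix.one_mulVec]
  rw [hζ', star_dotProduct_ofReal_mulVec (isSymm_of_posDef hτ.2.inv), siegelForm,
    ← quad_inv_mulVec hτ.2 p]
  congr 3
  · ext i; simp [Matrix.mulVec, dotProduct]
  · ext i; simp [Matrix.mulVec, dotProduct]

theorem cx_mulVec_intCast {ι κ : Type} [Fintype κ] (A : Matrix ι κ ℤ) (p : κ → ℤ) :
    cx A *ᵥ (fun i => (p i : ℂ)) = fun i => ((A *ᵥ p) i : ℂ) := by
  ext i; simp [cx, Matrix.mulVec, dotProduct]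

/-- The transpose of cτ + d carries γτ p + q to τp' + q', and Im γτ changes by the same matrix, so
the Hermitian norm is unchanged. -/
theorem siegelForm_moebius {n : ℕ} {γ : Matrix (Fin n ⊕ Fin n) (Fin n ⊕ Fin n) ℤ}
    (hγ : γ ∈ Matrix.symplecticGroup (Fin n) ℤ) {τ : Matrix (Fin n) (Fin n) ℂ}
    (hτ : τ ∈ siegelUpperHalfSpace n) (p q : Fin n → ℤ) :
    siegelForm (moebius γ τ) (fun i => (p i : ℝ)) (fun i => (q i : ℝ)) =
      siegelForm τ (fun i => ((γ.toBlocks₁₁ᵀ *ᵥ p + γ.toBlocks₂₁ᵀ *ᵥ q) i : ℤ))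
        (fun i => ((γ.toBlocks₁₂ᵀ *ᵥ p + γ.toBlocks₂₂ᵀ *ᵥ q) i : ℤ)) := by
  set p' := γ.toBlocks₁₁ᵀ *ᵥ p + γ.toBlocks₂₁ᵀ *ᵥ q with hp'
  set q' := γ.toBlocks₁₂ᵀ *ᵥ p + γ.toBlocks₂₂ᵀ *ᵥ q with hq'
  set Q := denom γ τ with hQ
  have hQu : IsUnit Q.det := isUnit_denom hγ hτ
  set ξ' := moebius γ τ *ᵥ (fun i => (p i : ℂ)) + fun i => (q i : ℂ) with hξ'
  set ξ := τ *ᵥ (fun i => (p' i : ℂ)) + fun i => (q' i : ℂ) with hξ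
  have hξξ : Qᵀ *ᵥ ξ' = ξ := by
    have ht : ∀ A : Matrix (Fin n) (Fin n) ℤ, (cx A)ᵀ = cx Aᵀ := fun _ => rfl
    rw [hξ', hQ, denom_transpose_mulVec hγ hτ]
    simp only [ht, cx_mulVec_intCast, hξ, hp', hq']
    congr 1
    · congr 1
      ext i; simp
    · ext i; simp
  have hsY : ∀ {σ : Matrix (Fin n) (Fin n) ℂ}, σ ∈ siegelUpperHalfSpace n → (imC σ)ᵀ = imC σ := by
    intro σ hσ
    ext i j
    simp [imC, hσ.1.apply i j]
  have hconj : Qᵀ * imC (moebius γ τ) * (Qᵀ)ᴴ = imC τ := by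
    have := congrArg Matrix.transpose (imC_moebius hγ hτ)
    rw [Matrix.transpose_mul, Matrix.transpose_mul, hsY hτ, hsY (moebius_mem hγ hτ)] at this
    rw [← this, Matrix.mul_assoc]
    rfl
  have hYu : IsUnit (imC τ).det := by
    have : (imC τ).det = (((τ.map Complex.im).det : ℝ) : ℂ) :=
      (RingHom.map_det Complex.ofRealHom _).symm
    rw [this, isUnit_iff_ne_zero]
    exact_mod_cast hτ.2.det_pos.ne'
  set ζ := (imC τ)⁻¹ *ᵥ ξ with hζ
  have hζ1 : imC τ *ᵥ ζ = ξ := by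
    rw [hζ, Matrix.mulVec_mulVec, Matrix.mul_nonsing_inv _ hYu, Matrix.one_mulVec]
  have hQt : IsUnit Qᵀ := by
    rw [Matrix.isUnit_iff_isUnit_det, Matrix.det_transpose]; exact hQu
  have hζ2 : imC (moebius γ τ) *ᵥ ((Qᵀ)ᴴ *ᵥ ζ) = ξ' := by
    apply Matrix.mulVec_injective_iff_isUnit.2 hQt
    show Qᵀ *ᵥ _ = Qᵀ *ᵥ _
    rw [hξξ, Matrix.mulVec_mulVec, Matrix.mulVec_mulVec, hconj, hζ1]
  have e1 := siegelForm_eq (moebius_mem hγ hτ) (fun i => (p i : ℝ)) (fun i => (q i : ℝ))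
    ((Qᵀ)ᴴ *ᵥ ζ) (by simpa only [Complex.ofReal_intCast] using hζ2)
  have e2 := siegelForm_eq hτ (fun i => (p' i : ℝ)) (fun i => (q' i : ℝ)) ζ (by simpa only [Complex.ofReal_intCast] using hζ1)
  have e3 : star ξ' ⬝ᵥ ((Qᵀ)ᴴ *ᵥ ζ) = star ξ ⬝ᵥ ζ := by
    rw [Matrix.dotProduct_mulVec, ← Matrix.star_mulVec, hξξ]
  have e4 : (siegelForm (moebius γ τ) (fun i => (p i : ℝ)) (fun i => (q i : ℝ)) : ℂ) =
      (siegelForm τ (fun i => (p' i : ℝ)) (fun i => (q' i : ℝ)) : ℂ) := by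
    rw [← e1, ← e2]
    simpa only [Complex.ofReal_intCast] using e3
  exact_mod_cast e4

/-- The form attached to `τ` is at least `ε` on all nonzero integral vectors. -/
def MinAtLeast {n : ℕ} (ε : ℝ) (τ : Matrix (Fin n) (Fin n) ℂ) : Prop :=
  ∀ p q : Fin n → ℤ, ¬ (p = 0 ∧ q = 0) →
    ε ≤ siegelForm τ (fun i => (p i : ℝ)) (fun i => (q i : ℝ))

/-- The minimum is an orbit invariant, since γᵗ is injective on integral vectors. This makes
Hermite's bound uniform along an orbit. -/
theorem minAtLeast_moebius {n : ℕ} {ε : ℝ} {γ : Matrix (Fin n ⊕ Fin n) (Fin n ⊕ Fin n) ℤ}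
    (hγ : γ ∈ Matrix.symplecticGroup (Fin n) ℤ) {τ : Matrix (Fin n) (Fin n) ℂ}
    (hτ : τ ∈ siegelUpperHalfSpace n) (h : MinAtLeast ε τ) :
    MinAtLeast ε (moebius γ τ) := by
  intro p q hpq
  rw [siegelForm_moebius hγ hτ]
  refine h _ _ fun h12 => hpq ?_
  have hu : IsUnit γᵀ := by
    rw [Matrix.isUnit_iff_isUnit_det, Matrix.det_transpose]
    exact SymplecticGroup.symplectic_det hγ
  have h3 : γᵀ *ᵥ Sum.elim p q = γᵀ *ᵥ 0 := by
    conv_lhs => rw [← Matrix.fromBlocks_toBlocks γ, Matrix.fromBlocks_transpose,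
      Matrix.fromBlocks_mulVec, Sum.elim_comp_inl, Sum.elim_comp_inr, h12.1, h12.2]
    rw [Matrix.mulVec_zero, Sum.elim_zero_zero]
  have h4 : Sum.elim p q = 0 := Matrix.mulVec_injective_of_isUnit hu h3
  rw [← Sum.elim_zero_zero, Sum.elim_eq_iff] at h4
  exact h4

theorem one_le_sum_sq {ι : Type} [Fintype ι] {p : ι → ℤ} (hp : p ≠ 0) :
    (1 : ℝ) ≤ ∑ i, (p i : ℝ) ^ 2 := by
  obtain ⟨i, hi⟩ := Function.ne_iff.mp hp
  have h1 : (1 : ℤ) ≤ p i ^ 2 := by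
    have := sq_nonneg (p i)
    have : p i ^ 2 ≠ 0 := pow_ne_zero 2 hi
    omega
  calc (1 : ℝ) ≤ (p i : ℝ) ^ 2 := by exact_mod_cast h1
    _ ≤ _ := Finset.single_le_sum (f := fun i => (p i : ℝ) ^ 2) (fun i _ => sq_nonneg _)
      (Finset.mem_univ i)

theorem exists_minAtLeast {n : ℕ} {τ : Matrix (Fin n) (Fin n) ℂ} (hτ : τ ∈ siegelUpperHalfSpace n) :
    ∃ ε > 0, MinAtLeast ε τ := by
  obtain ⟨a, ha, h1⟩ := exists_quad_ge hτ.2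
  obtain ⟨b, hb, h2⟩ := exists_quad_ge hτ.2.inv
  refine ⟨min a b, lt_min ha hb, fun p q hpq => ?_⟩
  by_cases hp : p = 0
  · have hq : q ≠ 0 := fun hq => hpq ⟨hp, hq⟩
    have := h2 (fun i => (q i : ℝ))
    have h3 := one_le_sum_sq hq
    have h4 : siegelForm τ (fun i => (p i : ℝ)) (fun i => (q i : ℝ)) =
        quad (τ.map Complex.im)⁻¹ (fun i => (q i : ℝ)) := by
      have : (fun i => (p i : ℝ)) = 0 := by ext i; simp [hp]
      rw [siegelForm, this]
      simp [quad]
    rw [h4]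
    refine (min_le_right _ _).trans ?_
    nlinarith
  · have := h1 (fun i => (p i : ℝ))
    have h3 := one_le_sum_sq hp
    have h4 := quad_nonneg hτ.2.inv.posSemidef
      (τ.map Complex.re *ᵥ (fun i => (p i : ℝ)) + fun i => (q i : ℝ))
    refine (min_le_left _ _).trans ?_
    rw [siegelForm]
    nlinarith

theorem intCast_single {ι : Type} [DecidableEq ι] (i : ι) :
    (fun j => ((Pi.single i 1 : ι → ℤ) j : ℝ)) = Pi.single i 1 := by
  ext j
  simp [Pi.single_apply]

theorem one_le_sq_of_ne_zero {d : ℤ} (hd : d ≠ 0) : (1 : ℝ) ≤ (d : ℝ) ^ 2 := by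
  have : (1 : ℤ) ≤ d ^ 2 := by
    have := sq_nonneg d
    have : d ^ 2 ≠ 0 := pow_ne_zero 2 hd
    omega
  exact_mod_cast this

theorem det_realGL_sq {ι : Type} [Fintype ι] [DecidableEq ι] (u : GL ι ℤ) :
    (realGL u).det ^ 2 = 1 := by
  have h1 : (realGL u).det = ((u.val.det : ℤ) : ℝ) :=
    (RingHom.map_det (Int.castRingHom ℝ) u.val).symm
  have h2 : IsUnit u.val.det := (Matrix.isUnit_iff_isUnit_det _).1 u.isUnit
  rw [h1, ← Int.cast_pow]
  rcases Int.isUnit_iff.1 h2 with h | h <;> simp [h]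

theorem det_realGL_conj {ι : Type} [Fintype ι] [DecidableEq ι] (y : Matrix ι ι ℝ) (u : GL ι ℤ) :
    ((realGL u)ᵀ * y * realGL u).det = y.det := by
  rw [Matrix.det_mul, Matrix.det_mul, Matrix.det_transpose]
  have := det_realGL_sq u
  linear_combination y.det * this

/-- Hermite's inequality, with an unspecified constant. -/
theorem det_le_of_minAtLeast {n : ℕ} {c : ℝ} (hc : 0 < c)
    (hred : ∀ y : Matrix (Fin n) (Fin n) ℝ, y.PosDef → ∃ u : GL (Fin n) ℤ, ∀ x : Fin n → ℝ,
      c * ∑ i, quad y (realGL u *ᵥ Pi.single i 1) * x i ^ 2 ≤ quad y (realGL u *ᵥ x))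
    {ε : ℝ} (hε : 0 < ε) {τ : Matrix (Fin n) (Fin n) ℂ} (hτ : τ ∈ siegelUpperHalfSpace n)
    (h : MinAtLeast ε τ) : (τ.map Complex.im).det ≤ n.factorial / (c * ε) ^ n := by
  set w := (τ.map Complex.im)⁻¹ with hw
  have hwpos : w.PosDef := hτ.2.inv
  obtain ⟨u, hu⟩ := hred w hwpos
  -- At p = 0 the Siegel form is y⁻¹[q]. Hence a reduced form of y⁻¹ dominates cε Σ xᵢ², which
  -- bounds det y⁻¹ from below.
  have hmin : ∀ q : Fin n → ℤ, q ≠ 0 → ε ≤ quad w (fun i => (q i : ℝ)) := by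
    intro q hq
    have := h 0 q (fun hpq => hq hpq.2)
    have h0 : (fun i => (((0 : Fin n → ℤ) i : ℤ) : ℝ)) = 0 := by ext i; simp
    rw [siegelForm, h0] at this
    simpa [quad] using this
  have hge : ∀ x, (c * ε) * ∑ i, x i ^ 2 ≤ quad ((realGL u)ᵀ * w * realGL u) x := by
    intro x
    rw [quad_conj]
    refine le_trans ?_ (hu x)
    rw [mul_assoc, Finset.mul_sum]
    refine mul_le_mul_of_nonneg_left (Finset.sum_le_sum fun i _ => ?_) hc.le
    refine mul_le_mul_of_nonneg_right ?_ (sq_nonneg _)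
    have hne : (Pi.single i 1 : Fin n → ℤ) ≠ 0 := by simp
    have := hmin _ (intCast_mulVec_ne_zero u hne)
    rwa [← realGL_mulVec_intCast, intCast_single] at this
  have hd := det_ge_of_quad_ge (posDef_realGL_conj hwpos u) (mul_pos hc hε) hge
  rw [det_realGL_conj, hw, Matrix.det_nonsing_inv, Ring.inverse_eq_inv'] at hd
  have hdy : 0 < (τ.map Complex.im).det := hτ.2.det_pos
  have hpos : 0 < (c * ε) ^ n / (n.factorial : ℝ) := by positivity
  rw [le_inv_comm₀ hpos hdy, inv_div] at hd
  exact hd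

theorem im_conj_cx {n : ℕ} (u : GL (Fin n) ℤ) (τ : Matrix (Fin n) (Fin n) ℂ) :
    ((cx u.val)ᵀ * τ * cx u.val).map Complex.im =
      (realGL u)ᵀ * τ.map Complex.im * realGL u := by
  ext i j
  simp [Matrix.mul_apply, cx, realGL]

/-- If `τ` represents a small value, some modular transformation at least doubles
`det (Im τ)`. -/
theorem exists_moebius_det_ge {n : ℕ} {τ : Matrix (Fin n) (Fin n) ℂ}
    (hτ : τ ∈ siegelUpperHalfSpace n) {v : Fin n → ℤ} (hv : v ≠ 0)
    (hsmall : quad (τ.map Complex.im) (fun i => (v i : ℝ)) < 1 / 2) :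
    ∃ g₁ g₂ g₃ : Mp n, 2 * (τ.map Complex.im).det ≤
      ((moebius g₃.γ (moebius g₂.γ (moebius g₁.γ τ))).map Complex.im).det := by
  obtain ⟨i₀, -⟩ := Function.ne_iff.mp hv
  obtain ⟨u, d, hd⟩ := exists_GL_col v hv i₀
  obtain ⟨g₁, hg₁⟩ := exists_mp_GL u
  set τ₁ := moebius g₁.γ τ with hτ₁
  have hτ₁m : τ₁ ∈ siegelUpperHalfSpace n := moebius_mem g₁.mem hτ
  have him₁ : τ₁.map Complex.im = (realGL u)ᵀ * τ.map Complex.im * realGL u := by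
    rw [hτ₁, hg₁, im_conj_cx]
  have hd0 : d ≠ 0 := by
    rintro rfl
    exact hv (funext fun j => by simpa using hd j)
  have h1 : (τ₁ i₀ i₀).im < 1 / 2 := by
    have e1 : (fun i => (v i : ℝ)) = (d : ℝ) • (realGL u *ᵥ Pi.single i₀ 1) := by
      rw [realGL_mulVec_single]
      ext j
      simp [hd j]
    have e2 : (τ₁ i₀ i₀).im = quad (τ.map Complex.im) (realGL u *ᵥ Pi.single i₀ 1) := by
      rw [← quad_conj, quad_single, ← him₁]; rfl
    rw [e1, quad_smul, ← e2] at hsmall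
    have h0 : 0 < (τ₁ i₀ i₀).im := hτ₁m.2.diag_pos (i := i₀)
    have := one_le_sq_of_ne_zero hd0
    nlinarith
  -- After this translation both coordinates of the entry are at most 1/2 in absolute value, so its
  -- squared modulus is at most 1/2; the partial inversion divides det(Im τ) by that number.
  set k := round (τ₁ i₀ i₀).re with hk
  obtain ⟨g₂, hg₂⟩ := exists_mp_translation (Matrix.single i₀ i₀ (-k))
    (by rw [Matrix.IsSymm, Matrix.transpose_single])
  set τ₂ := moebius g₂.γ τ₁ with hτ₂
  have hτ₂m : τ₂ ∈ siegelUpperHalfSpace n := moebius_mem g₂.mem hτ₁m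
  have him₂ : τ₂.map Complex.im = τ₁.map Complex.im := by
    rw [hτ₂, hg₂]
    ext i j
    simp [cx]
  obtain ⟨g₃, hg₃⟩ := exists_mp_inversion i₀
  have h3 := det_im_moebius g₃.mem hτ₂m
  rw [hg₃, him₂, him₁, det_realGL_conj] at h3
  have h2 : ‖τ₂ i₀ i₀‖ ^ 2 ≤ 1 / 2 := by
    have e : τ₂ i₀ i₀ = τ₁ i₀ i₀ - k := by
      rw [hτ₂, hg₂]
      simp [cx, sub_eq_add_neg]
    have hre := abs_sub_round (τ₁ i₀ i₀).re
    have h0 : 0 < (τ₁ i₀ i₀).im := hτ₁m.2.diag_pos (i := i₀)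
    rw [← Complex.normSq_eq_norm_sq, e, Complex.normSq_apply]
    simp only [Complex.sub_re, Complex.intCast_re, Complex.sub_im, Complex.intCast_im, sub_zero]
    rw [← hk] at hre
    have := abs_le.1 hre
    nlinarith
  refine ⟨g₁, g₂, g₃, ?_⟩
  have hpos : 0 < ((moebius g₃.γ τ₂).map Complex.im).det := (moebius_mem g₃.mem hτ₂m).2.det_pos
  nlinarith

/-- Reduction theory for `Sp_{2n}(ℤ)` as an induction principle: a property that can be pulled back
along modular transformations holds on the Siegel upper half space as soon as it holds for the
`τ = x + i y` for which `y` dominates its diagonal part, whose entries are at least `1/2`. -/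
theorem siegel_induction (n : ℕ) : ∃ c : ℝ, 0 < c ∧
    ∀ P : Matrix (Fin n) (Fin n) ℂ → Prop,
      (∀ g : Mp n, ∀ τ ∈ siegelUpperHalfSpace n, P (moebius g.γ τ) → P τ) →
      (∀ τ ∈ siegelUpperHalfSpace n, (∀ i, 1 / 2 ≤ (τ i i).im) →
        (∀ x : Fin n → ℝ, c * ∑ i, (τ i i).im * x i ^ 2 ≤ quad (τ.map Complex.im) x) → P τ) →
      ∀ τ ∈ siegelUpperHalfSpace n, P τ := by
  obtain ⟨c, hc, hred⟩ := exists_reduced_basis n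
  refine ⟨c, hc, fun P hmove hbase τ hτ => ?_⟩
  obtain ⟨ε, hε, hmin⟩ := exists_minAtLeast hτ
  set D : ℝ := n.factorial / (c * ε) ^ n with hD
  -- D is the ceiling that Hermite's inequality puts on det(Im τ) along the orbit. K counts the
  -- doublings still possible: at K = 0 the determinant would exceed the ceiling.
  have key : ∀ K : ℕ, ∀ τ ∈ siegelUpperHalfSpace n, MinAtLeast ε τ →
      D < 2 ^ K * (τ.map Complex.im).det → P τ := by
    intro K
    induction K with
    | zero =>
      intro τ hτ hmin hK
      have := det_le_of_minAtLeast hc hred hε hτ hmin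
      rw [pow_zero, one_mul] at hK
      exact absurd hK (not_lt.2 this)
    | succ K ih =>
      intro τ hτ hmin hK
      -- Without a short vector, GL_n-reduction alone reaches the base case, since the new diagonal
      -- entries are values at nonzero integral vectors. With one, the determinant doubles.
      by_cases hv : ∀ v : Fin n → ℤ, v ≠ 0 →
          1 / 2 ≤ quad (τ.map Complex.im) (fun i => (v i : ℝ))
      · obtain ⟨u, hu⟩ := hred _ hτ.2
        obtain ⟨g, hg⟩ := exists_mp_GL u
        refine hmove g τ hτ (hbase _ (moebius_mem g.mem hτ) ?_ ?_)
        all_goals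
          have him : (moebius g.γ τ).map Complex.im =
              (realGL u)ᵀ * τ.map Complex.im * realGL u := by rw [hg, im_conj_cx]
          have hdiag : ∀ i, (moebius g.γ τ i i).im =
              quad (τ.map Complex.im) (realGL u *ᵥ Pi.single i 1) := by
            intro i
            rw [← quad_conj, quad_single, ← him]; rfl
        · intro i
          have hne : (Pi.single i 1 : Fin n → ℤ) ≠ 0 := by simp
          have := hv _ (intCast_mulVec_ne_zero u hne)
          rwa [hdiag, ← intCast_single, realGL_mulVec_intCast]
        · intro x
          simp only [hdiag]
          rw [him, quad_conj]
          exact hu x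
      · push Not at hv
        obtain ⟨v, hv0, hv⟩ := hv
        obtain ⟨g₁, g₂, g₃, hdet⟩ := exists_moebius_det_ge hτ hv0 hv
        have m1 := moebius_mem g₁.mem hτ
        have m2 := moebius_mem g₂.mem m1
        have m3 := moebius_mem g₃.mem m2
        refine hmove g₁ τ hτ (hmove g₂ _ m1 (hmove g₃ _ m2 (ih _ m3 ?_ ?_)))
        · exact minAtLeast_moebius g₃.mem m2 (minAtLeast_moebius g₂.mem m1
            (minAtLeast_moebius g₁.mem hτ hmin))
        · have h2K : (0 : ℝ) < 2 ^ K := by positivity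
          calc D < 2 ^ (K + 1) * (τ.map Complex.im).det := hK
            _ = 2 ^ K * (2 * (τ.map Complex.im).det) := by ring
            _ ≤ _ := by gcongr
  have hpos : 0 < (τ.map Complex.im).det := hτ.2.det_pos
  obtain ⟨K, hK⟩ := pow_unbounded_of_one_lt (D / (τ.map Complex.im).det) (one_lt_two (α := ℝ))
  exact key K τ hτ hmin (by rwa [div_lt_iff₀ hpos] at hK)

/-! ### Specializations of Jacobi forms and their transformation law -/

theorem e_add (x y : ℂ) : e (x + y) = e x * e y := by
  rw [e, e, e, ← Complex.exp_add]; ring_nf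

theorem e_zero : e 0 = 1 := by simp [e]

theorem e_int (k : ℤ) : e k = 1 := by
  rw [e, mul_comm]
  exact Complex.exp_int_mul_two_pi_mul_I k

theorem norm_e (x : ℂ) : ‖e x‖ = Real.exp (-(2 * Real.pi * x.im)) := by
  rw [e, Complex.norm_exp]
  congr 1
  simp

theorem norm_e_ofReal (x : ℝ) : ‖e x‖ = 1 := by simp [norm_e]

/-- The specialization `e(m lᵗ τ l) φ(τ, τ l + u)` of `φ` at `z = τ l + u`. -/
noncomputable def eta {n : ℕ} (m : ℕ) (φ : Matrix (Fin n) (Fin n) ℂ → (Fin n → ℂ) → ℂ)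
    (l u : Fin n → ℂ) (τ : Matrix (Fin n) (Fin n) ℂ) : ℂ :=
  e (m * (l ⬝ᵥ (τ *ᵥ l))) * φ τ (τ *ᵥ l + u)

section Transformation

variable {n : ℕ} {κ : ℤ} {m : ℕ} {φ : Matrix (Fin n) (Fin n) ℂ → (Fin n → ℂ) → ℂ}

/-- The Gaussian exponent at γτ and the Jacobi automorphy exponent add up to the Gaussian exponent
for (l', u') at τ, with a constant left over. For real parameters this constant is real and gives a
phase. -/
theorem eta_phase {γ : Matrix (Fin n ⊕ Fin n) (Fin n ⊕ Fin n) ℤ}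
    (hγ : γ ∈ Matrix.symplecticGroup (Fin n) ℤ) {τ : Matrix (Fin n) (Fin n) ℂ}
    (hτ : τ ∈ siegelUpperHalfSpace n) (l u l' u' : Fin n → ℂ)
    (hl' : l' = (cx γ.toBlocks₁₁)ᵀ *ᵥ l + (cx γ.toBlocks₂₁)ᵀ *ᵥ u)
    (hu' : u' = (cx γ.toBlocks₁₂)ᵀ *ᵥ l + (cx γ.toBlocks₂₂)ᵀ *ᵥ u) :
    l ⬝ᵥ (moebius γ τ *ᵥ l) +
      (τ *ᵥ l' + u') ⬝ᵥ (((denom γ τ)⁻¹ * cx γ.toBlocks₂₁) *ᵥ (τ *ᵥ l' + u')) =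
      (l' ⬝ᵥ u' - l ⬝ᵥ u) + l' ⬝ᵥ (τ *ᵥ l') := by
  obtain ⟨h1, h2, h3⟩ := symplectic_relations hγ
  have hQ := isUnit_denom hγ hτ
  have hz := denom_transpose_mulVec hγ hτ l u
  rw [← hl', ← hu'] at hz
  set z := τ *ᵥ l' + u' with hzdef
  set w := moebius γ τ *ᵥ l + u with hw
  have hQT : IsUnit (denom γ τ)ᵀ.det := by rwa [Matrix.det_transpose]
  -- In other words cᵗ γτ − aᵗ = −(cτ + d)⁻¹, which removes the inverse from the exponent.
  have hX : ((cx γ.toBlocks₂₁)ᵀ * moebius γ τ - (cx γ.toBlocks₁₁)ᵀ) * denom γ τ = -1 := by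
    rw [Matrix.sub_mul, Matrix.mul_assoc, moebius_mul_denom hγ hτ, numer, denom_eq,
      Matrix.mul_add, Matrix.mul_add, ← Matrix.mul_assoc, ← Matrix.mul_assoc, h1, ← h3]
    abel
  have hX' : denom γ τ * ((cx γ.toBlocks₂₁)ᵀ * moebius γ τ - (cx γ.toBlocks₁₁)ᵀ) = -1 := by
    have hh : (-((cx γ.toBlocks₂₁)ᵀ * moebius γ τ - (cx γ.toBlocks₁₁)ᵀ)) * denom γ τ = 1 := by
      rw [Matrix.neg_mul, hX, neg_neg]
    have := mul_eq_one_comm.1 hh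
    rw [Matrix.mul_neg] at this
    rw [← this, neg_neg]
  have e1 : z ⬝ᵥ (((denom γ τ)⁻¹ * cx γ.toBlocks₂₁) *ᵥ z) = ((cx γ.toBlocks₂₁)ᵀ *ᵥ w) ⬝ᵥ z := by
    rw [← Matrix.mulVec_mulVec, Matrix.dotProduct_mulVec, ← Matrix.mulVec_transpose,
      Matrix.transpose_nonsing_inv]
    conv_lhs => rw [← hz, Matrix.mulVec_mulVec, Matrix.nonsing_inv_mul _ hQT, Matrix.one_mulVec]
    rw [hz, Matrix.dotProduct_mulVec, ← Matrix.mulVec_transpose]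
  have e2 : (cx γ.toBlocks₂₁)ᵀ *ᵥ w =
      l' + ((cx γ.toBlocks₂₁)ᵀ * moebius γ τ - (cx γ.toBlocks₁₁)ᵀ) *ᵥ l := by
    rw [hw, hl', Matrix.mulVec_add, Matrix.mulVec_mulVec, Matrix.sub_mulVec]
    abel
  have e3 : (((cx γ.toBlocks₂₁)ᵀ * moebius γ τ - (cx γ.toBlocks₁₁)ᵀ) *ᵥ l) ⬝ᵥ z = -(l ⬝ᵥ w) := by
    rw [← hz, Matrix.dotProduct_mulVec, Matrix.vecMul_transpose, Matrix.mulVec_mulVec, hX',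
      Matrix.neg_mulVec, Matrix.one_mulVec, neg_dotProduct]
  rw [e1, e2, add_dotProduct, e3, hzdef, hw, dotProduct_add, dotProduct_add]
  ring

theorem eta_moebius (hφ : IsJacobiForm n κ m φ) (g : Mp n) {τ : Matrix (Fin n) (Fin n) ℂ}
    (hτ : τ ∈ siegelUpperHalfSpace n) (l u l' u' : Fin n → ℂ)
    (hl' : l' = (cx g.γ.toBlocks₁₁)ᵀ *ᵥ l + (cx g.γ.toBlocks₂₁)ᵀ *ᵥ u)
    (hu' : u' = (cx g.γ.toBlocks₁₂)ᵀ *ᵥ l + (cx g.γ.toBlocks₂₂)ᵀ *ᵥ u) :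
    eta m φ l u (moebius g.γ τ) =
      g.ω τ ^ κ * e (m * (l' ⬝ᵥ u' - l ⬝ᵥ u)) * eta m φ l' u' τ := by
  have hQ := isUnit_denom g.mem hτ
  have hQT : IsUnit (denom g.γ τ)ᵀ.det := by rwa [Matrix.det_transpose]
  have hz := denom_transpose_mulVec g.mem hτ l u
  rw [← hl', ← hu'] at hz
  have hw : ((denom g.γ τ)⁻¹)ᵀ *ᵥ (τ *ᵥ l' + u') = moebius g.γ τ *ᵥ l + u := by
    rw [← hz, Matrix.transpose_nonsing_inv, Matrix.mulVec_mulVec, Matrix.nonsing_inv_mul _ hQT,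
      Matrix.one_mulVec]
  have hmod := hφ.modular g τ hτ (τ *ᵥ l' + u')
  rw [hw] at hmod
  rw [eta, eta, hmod]
  have hph := eta_phase g.mem hτ l u l' u' hl' hu'
  have : e (m * (l ⬝ᵥ (moebius g.γ τ *ᵥ l))) * e (m * ((τ *ᵥ l' + u') ⬝ᵥ
      (((denom g.γ τ)⁻¹ * cx g.γ.toBlocks₂₁) *ᵥ (τ *ᵥ l' + u')))) =
      e (m * (l' ⬝ᵥ u' - l ⬝ᵥ u)) * e (m * (l' ⬝ᵥ (τ *ᵥ l'))) := by
    rw [← e_add, ← e_add, ← mul_add, ← mul_add, hph]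
  linear_combination (g.ω τ ^ κ * φ τ (τ *ᵥ l' + u')) * this

theorem eta_add_int (hφ : IsJacobiForm n κ m φ) {τ : Matrix (Fin n) (Fin n) ℂ}
    (hτ : τ ∈ siegelUpperHalfSpace n) (l u : Fin n → ℂ) (a b : Fin n → ℤ) :
    eta m φ (l + fun i => (a i : ℂ)) (u + fun i => (b i : ℂ)) τ =
      e (-(2 * m * ((fun i => (a i : ℂ)) ⬝ᵥ u))) * eta m φ l u τ := by
  have h := hφ.elliptic a b τ hτ (τ *ᵥ l + u)
  set a' : Fin n → ℂ := fun i => (a i : ℂ)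
  set b' : Fin n → ℂ := fun i => (b i : ℂ)
  have harg : τ *ᵥ (l + a') + (u + b') = τ *ᵥ l + u + τ *ᵥ a' + b' := by
    rw [Matrix.mulVec_add]; abel
  have hsym : l ⬝ᵥ (τ *ᵥ a') = a' ⬝ᵥ (τ *ᵥ l) := by
    rw [Matrix.dotProduct_mulVec, ← Matrix.mulVec_transpose, hτ.1.eq, dotProduct_comm]
  rw [eta, eta, harg, h, ← mul_assoc, ← mul_assoc, ← e_add, ← e_add]
  congr 2
  simp only [Matrix.mulVec_add, add_dotProduct, dotProduct_add, hsym]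
  ring

theorem omega_ne_zero (g : Mp n) {τ : Matrix (Fin n) (Fin n) ℂ}
    (hτ : τ ∈ siegelUpperHalfSpace n) : g.ω τ ≠ 0 := by
  intro h
  have := g.sq τ hτ
  rw [h] at this
  exact det_denom_ne_zero g.mem hτ (by rw [← this]; simp)

/-- The complex vector underlying a real vector. -/
abbrev vecC {ι : Type} (x : ι → ℝ) : ι → ℂ := fun i => (x i : ℂ)

/-- All specializations of `φ` at parameters with entries in `A` are bounded by `B` at `τ`. -/
def BoundedAt (κ : ℤ) (m : ℕ) (φ : Matrix (Fin n) (Fin n) ℂ → (Fin n → ℂ) → ℂ)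
    (A : AddSubgroup ℝ) (B : ℝ) (τ : Matrix (Fin n) (Fin n) ℂ) : Prop :=
  ∀ l u : Fin n → ℝ, (∀ i, l i ∈ A) → (∀ i, u i ∈ A) →
    ‖eta m φ (vecC l) (vecC u) τ‖ * (τ.map Complex.im).det ^ ((κ : ℝ) / 4) ≤ B

theorem intMatrix_mulVec_mem {A : AddSubgroup ℝ} (M : Matrix (Fin n) (Fin n) ℤ) {l : Fin n → ℝ}
    (hl : ∀ i, l i ∈ A) (i : Fin n) : (M.map (fun x : ℤ => (x : ℝ)) *ᵥ l) i ∈ A := by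
  simp only [Matrix.mulVec, dotProduct, Matrix.map_apply]
  refine sum_mem fun j _ => ?_
  simpa using A.zsmul_mem (hl j) (M i j)

theorem cx_mulVec_vecC (M : Matrix (Fin n) (Fin n) ℤ) (l : Fin n → ℝ) :
    cx M *ᵥ vecC l = vecC (M.map (fun x : ℤ => (x : ℝ)) *ᵥ l) := by
  ext i; simp [vecC, Matrix.mulVec, dotProduct]

theorem vecC_dotProduct {ι : Type} [Fintype ι] (l u : ι → ℝ) :
    vecC l ⬝ᵥ vecC u = ((l ⬝ᵥ u : ℝ) : ℂ) := by
  simp [vecC, dotProduct]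

/-- Integral matrices preserve tuples from the subgroup A, the phase has modulus one, and the powers
of |ω| cancel against the change of det(Im τ). Quantifying over all parameters in A is what makes
the bound invariant under the full modular group. -/
theorem BoundedAt.of_moebius (hφ : IsJacobiForm n κ m φ) {A : AddSubgroup ℝ} {B : ℝ} (g : Mp n)
    {τ : Matrix (Fin n) (Fin n) ℂ} (hτ : τ ∈ siegelUpperHalfSpace n)
    (h : BoundedAt κ m φ A B (moebius g.γ τ)) : BoundedAt κ m φ A B τ := by
  intro l u hl hu
  obtain ⟨h1, h2, h3⟩ := symplectic_relations g.mem
  have h4 := symplectic_relation' g.mem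
  let R : Matrix (Fin n) (Fin n) ℤ → Matrix (Fin n) (Fin n) ℝ :=
    fun M => M.map (fun x : ℤ => (x : ℝ))
  -- (l₀, u₀) is the preimage of (l, u) under the action of γ on parameters, read off from the
  -- inverse of a symplectic matrix.
  set l₀ : Fin n → ℝ := R g.γ.toBlocks₂₂ *ᵥ l - R g.γ.toBlocks₂₁ *ᵥ u with hl₀
  set u₀ : Fin n → ℝ := R g.γ.toBlocks₁₁ *ᵥ u - R g.γ.toBlocks₁₂ *ᵥ l with hu₀
  have hl₀c : vecC l₀ = cx g.γ.toBlocks₂₂ *ᵥ vecC l - cx g.γ.toBlocks₂₁ *ᵥ vecC u := by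
    rw [cx_mulVec_vecC, cx_mulVec_vecC]; ext i; simp [vecC, hl₀, R]
  have hu₀c : vecC u₀ = cx g.γ.toBlocks₁₁ *ᵥ vecC u - cx g.γ.toBlocks₁₂ *ᵥ vecC l := by
    rw [cx_mulVec_vecC, cx_mulVec_vecC]; ext i; simp [vecC, hu₀, R]
  have hl' : vecC l = (cx g.γ.toBlocks₁₁)ᵀ *ᵥ vecC l₀ + (cx g.γ.toBlocks₂₁)ᵀ *ᵥ vecC u₀ := by
    rw [hl₀c, hu₀c]
    simp only [Matrix.mulVec_sub, Matrix.mulVec_mulVec]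
    rw [h1]
    have := congrArg (fun X => X *ᵥ vecC l) h3
    simp only [Matrix.sub_mulVec, Matrix.one_mulVec] at this
    refine this.symm.trans ?_
    abel
  have hu' : vecC u = (cx g.γ.toBlocks₁₂)ᵀ *ᵥ vecC l₀ + (cx g.γ.toBlocks₂₂)ᵀ *ᵥ vecC u₀ := by
    rw [hl₀c, hu₀c]
    simp only [Matrix.mulVec_sub, Matrix.mulVec_mulVec]
    rw [h2]
    have := congrArg (fun X => X *ᵥ vecC u) h4
    simp only [Matrix.sub_mulVec, Matrix.one_mulVec] at this
    refine this.symm.trans ?_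
    abel
  have hb := h l₀ u₀
    (fun i => A.sub_mem (intMatrix_mulVec_mem _ hl i) (intMatrix_mulVec_mem _ hu i))
    (fun i => A.sub_mem (intMatrix_mulVec_mem _ hu i) (intMatrix_mulVec_mem _ hl i))
  rw [eta_moebius hφ g hτ _ _ _ _ hl' hu', vecC_dotProduct, vecC_dotProduct] at hb
  have hph : ‖e (m * (((l ⬝ᵥ u : ℝ) : ℂ) - ((l₀ ⬝ᵥ u₀ : ℝ) : ℂ)))‖ = 1 := by
    have : (m * (((l ⬝ᵥ u : ℝ) : ℂ) - ((l₀ ⬝ᵥ u₀ : ℝ) : ℂ))) =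
      ((m * (l ⬝ᵥ u - l₀ ⬝ᵥ u₀) : ℝ) : ℂ) := by push_cast; ring
    rw [this, norm_e_ofReal]
  rw [norm_mul, norm_mul, hph, mul_one, norm_zpow] at hb
  have hω : 0 < ‖g.ω τ‖ := norm_pos_iff.2 (omega_ne_zero g hτ)
  have hdet := det_im_moebius g.mem hτ
  rw [← g.sq τ hτ, norm_pow] at hdet
  have hpos : 0 < ((moebius g.γ τ).map Complex.im).det := (moebius_mem g.mem hτ).2.det_pos
  rw [← hdet, Real.mul_rpow (by positivity) hpos.le]
  have hpow : ((‖g.ω τ‖ ^ 2) ^ 2) ^ ((κ : ℝ) / 4) = ‖g.ω τ‖ ^ κ := by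
    rw [← pow_mul, ← Real.rpow_natCast, ← Real.rpow_mul hω.le, ← Real.rpow_intCast]
    congr 1
    push_cast; ring
  rw [hpow]
  linarith [hb]

end Transformation

/-! ### Fourier coefficients bounded by suprema -/

open UnitAddTorus in
/-- Fourier coefficients of an absolutely convergent multiple Fourier series are bounded by its
supremum. -/
theorem norm_coeff_le_of_hasSum {A J : Type} [Fintype J] (ℓ : A → J → ℤ)
    (hℓ : Function.Injective ℓ) (a : A → ℂ) (f : (J → ℝ) → ℂ) {B : ℝ}
    (hf : ∀ θ : J → ℝ, HasSum (fun α => a α * e (∑ j, (ℓ α j : ℂ) * θ j)) (f θ))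
    (hB : ∀ θ, ‖f θ‖ ≤ B) (α₀ : A) : ‖a α₀‖ ≤ B := by
  have hB0 : 0 ≤ B := (norm_nonneg _).trans (hB 0)
  have hsum : Summable fun α => ‖a α‖ := by
    have := (hf 0).summable.norm
    simpa [e_zero] using this
  have hS : Summable fun α => a α • mFourier (ℓ α) := by
    refine Summable.of_norm ?_
    simpa [norm_smul, mFourier_norm] using hsum
  set G : C(UnitAddTorus J, ℂ) := ∑' α, a α • mFourier (ℓ α) with hG
  have hGsum : HasSum (fun α => a α • mFourier (ℓ α)) G := hS.hasSum
  have hval : ∀ θ : J → ℝ, G (fun j => (θ j : UnitAddCircle)) = f θ := by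
    intro θ
    have h1 := (ContinuousMap.evalCLM ℂ (fun j => (θ j : UnitAddCircle)) :
      C(UnitAddTorus J, ℂ) →L[ℂ] ℂ).hasSum hGsum
    refine h1.unique ?_
    convert hf θ using 2 with α
    simp only [ContinuousMap.evalCLM_apply, ContinuousMap.smul_apply, smul_eq_mul, mFourier,
      ContinuousMap.coe_mk, fourier_coe_apply]
    rw [e, ← Complex.exp_sum, Finset.mul_sum]
    congr 2
    exact Finset.sum_congr rfl fun j _ => by simp; ring
  have hbound : ∀ x, ‖G x‖ ≤ B := by
    intro x
    choose θ hθ using fun j => QuotientAddGroup.mk_surjective (x j)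
    have : x = fun j => (θ j : UnitAddCircle) := funext fun j => (hθ j).symm
    rw [this, hval]
    exact hB θ
  -- Normalized Haar measure: characters have L²-norm one and the L²-norm is at most the supremum,
  -- so Cauchy–Schwarz bounds a coefficient, written as an inner product.
  let _ : MeasureTheory.MeasureSpace UnitAddCircle := ⟨AddCircle.haarAddCircle⟩
  have _ : MeasureTheory.IsProbabilityMeasure
      (MeasureTheory.volume : MeasureTheory.Measure UnitAddCircle) :=
    inferInstanceAs (MeasureTheory.IsProbabilityMeasure AddCircle.haarAddCircle)
  have horth := orthonormal_mFourier (d := J)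
  set L := (innerSL ℂ (mFourierLp (d := J) 2 (ℓ α₀))).comp (ContinuousMap.toLp (E := ℂ) 2 _ ℂ)
    with hL
  have hLF : ∀ k, L (mFourier k) = inner ℂ (mFourierLp (d := J) 2 (ℓ α₀)) (mFourierLp 2 k) :=
    fun k => rfl
  have hcoef : a α₀ = L G := by
    refine HasSum.unique ?_ (hGsum.mapL L)
    have hone : ∀ α, α ≠ α₀ → L (a α • mFourier (ℓ α)) = 0 := by
      intro α hα
      rw [map_smul, hLF, horth.2 (fun h => hα (hℓ h).symm : ℓ α₀ ≠ ℓ α), smul_zero]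
    have := hasSum_single α₀ hone
    rwa [map_smul, hLF, inner_self_eq_norm_sq_to_K, horth.1, RCLike.ofReal_one, one_pow,
      smul_eq_mul, mul_one] at this
  rw [hcoef, hL, ContinuousLinearMap.comp_apply, innerSL_apply_apply]
  refine (norm_inner_le_norm _ _).trans ?_
  rw [horth.1, one_mul]
  refine (MeasureTheory.Lp.norm_le_of_ae_bound hB0 (C := B) ?_).trans ?_
  · filter_upwards [ContinuousMap.coeFn_toLp (p := 2) (𝕜 := ℂ) _ G] with x hx
    rw [hx]; exact hbound x
  · simp [MeasureTheory.measureUnivNNReal]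

/-- The point `x + i y`. -/
noncomputable def mkTau {n : ℕ} (x y : Matrix (Fin n) (Fin n) ℝ) : Matrix (Fin n) (Fin n) ℂ :=
  Matrix.of fun i j => (x i j : ℂ) + Complex.I * (y i j : ℂ)

theorem im_mkTau {n : ℕ} (x y : Matrix (Fin n) (Fin n) ℝ) : (mkTau x y).map Complex.im = y := by
  ext i j; simp [mkTau]

theorem mkTau_mem {n : ℕ} {x y : Matrix (Fin n) (Fin n) ℝ} (hx : x.IsSymm) (hy : y.PosDef) :
    mkTau x y ∈ siegelUpperHalfSpace n := by
  refine ⟨?_, by rwa [im_mkTau]⟩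
  ext i j
  simp [mkTau, hx.apply i j, (isSymm_of_posDef hy).apply i j]

/-- The real matrix underlying a rational matrix. -/
abbrev ratR {ι : Type} (t : Matrix ι ι ℚ) : Matrix ι ι ℝ := t.map (fun x : ℚ => (x : ℝ))

theorem traceMul_mkTau {n : ℕ} (t : Matrix (Fin n) (Fin n) ℚ) (x y : Matrix (Fin n) (Fin n) ℝ) :
    traceMul t (mkTau x y) = (((ratR t * x).trace : ℝ) : ℂ) +
      Complex.I * (((ratR t * y).trace : ℝ) : ℂ) := by
  simp only [traceMul, mkTau, Matrix.trace, Matrix.mul_apply, Matrix.diag_apply, Matrix.map_apply,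
    Matrix.of_apply]
  push_cast
  simp only [Finset.mul_sum, ← Finset.sum_add_distrib]
  refine Finset.sum_congr rfl fun i _ => Finset.sum_congr rfl fun j _ => ?_
  ring

/-- The integers `2 T_{ij}` attached to a half-integral matrix. -/
def freq {n : ℕ} (T : HalfInt n) (p : Fin n × Fin n) : ℤ := (2 * T.1 p.1 p.2).num

theorem freq_cast {n : ℕ} (T : HalfInt n) (p : Fin n × Fin n) :
    (freq T p : ℚ) = 2 * T.1 p.1 p.2 := by
  obtain ⟨a, ha⟩ := T.2.2.2 p.1 p.2
  rw [freq, ha, Rat.num_intCast]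

theorem freq_injective {n : ℕ} : Function.Injective (freq (n := n)) := by
  intro S T h
  apply Subtype.ext
  ext i j
  have h1 := freq_cast S (i, j)
  have h2 := freq_cast T (i, j)
  rw [h, h2] at h1
  linarith

/-- Symmetrizing a free real matrix θ turns the Siegel expansion into a Fourier series on the
n²-dimensional torus with frequencies 2T_ij, which determine T. -/
theorem trace_mul_add_transpose {n : ℕ} (T : HalfInt n) (θ : Fin n × Fin n → ℝ) (M : ℝ) :
    (ratR T.1 * Matrix.of fun i j => M * (θ (i, j) + θ (j, i))).trace =
      M * ∑ p, (freq T p : ℝ) * θ p := by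
  have hf : ∀ p, (freq T p : ℝ) = 2 * ((T.1 p.1 p.2 : ℚ) : ℝ) := by
    intro p
    have := freq_cast T p
    exact_mod_cast congrArg (fun q : ℚ => (q : ℝ)) this
  simp only [Matrix.trace, Matrix.mul_apply, Matrix.diag_apply, Matrix.of_apply, hf, ratR,
    Matrix.map_apply, Fintype.sum_prod_type]
  have h1 : ∀ i j, ((T.1 i j : ℚ) : ℝ) * (M * (θ (j, i) + θ (i, j))) =
      M * (((T.1 i j : ℚ) : ℝ) * θ (j, i)) + M * (((T.1 i j : ℚ) : ℝ) * θ (i, j)) :=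
    fun i j => by ring
  simp only [h1, Finset.sum_add_distrib, ← Finset.mul_sum]
  have h2 : ∑ i, ∑ j, ((T.1 i j : ℚ) : ℝ) * θ (j, i) = ∑ i, ∑ j, ((T.1 i j : ℚ) : ℝ) * θ (i, j) := by
    rw [Finset.sum_comm]
    refine Finset.sum_congr rfl fun i _ => Finset.sum_congr rfl fun j _ => ?_
    rw [T.2.1.apply i j]
  rw [h2]
  simp only [mul_assoc, ← Finset.mul_sum]
  ring

theorem isSymm_add_transpose {n : ℕ} (θ : Fin n × Fin n → ℝ) (M : ℝ) :
    (Matrix.of fun i j => M * (θ (i, j) + θ (j, i)) : Matrix (Fin n) (Fin n) ℝ).IsSymm := by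
  ext i j
  simp [add_comm]

/-- A Fourier coefficient of a Siegel modular form is bounded by the values at a given imaginary
part. -/
theorem siegel_coeff_le {n M : ℕ} (hM : 0 < M) {c : HalfInt n → ℂ}
    {h : Matrix (Fin n) (Fin n) ℂ → ℂ}
    (hc : ∀ τ ∈ siegelUpperHalfSpace n,
      HasSum (fun t : HalfInt n => c t * e (traceMul t.1 τ / M)) (h τ))
    {y : Matrix (Fin n) (Fin n) ℝ} (hy : y.PosDef) {B : ℝ}
    (hB : ∀ x : Matrix (Fin n) (Fin n) ℝ, x.IsSymm → ‖h (mkTau x y)‖ ≤ B) (t : HalfInt n) :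
    ‖c t‖ ≤ B * Real.exp (2 * Real.pi * ((ratR t.1 * y).trace / M)) := by
  have hM0 : (M : ℂ) ≠ 0 := by exact_mod_cast hM.ne'
  have key := norm_coeff_le_of_hasSum (A := HalfInt n) freq freq_injective
    (fun t => c t * e (Complex.I * (((ratR t.1 * y).trace / M : ℝ) : ℂ)))
    (fun θ => h (mkTau (Matrix.of fun i j => (M : ℝ) * (θ (i, j) + θ (j, i))) y)) (B := B) ?_ ?_ t
  · rw [norm_mul, norm_e] at key
    simp only [Complex.mul_im, Complex.I_re, Complex.ofReal_im, mul_zero, Complex.I_im,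
      Complex.ofReal_re, one_mul, zero_add] at key
    rwa [Real.exp_neg, ← div_eq_mul_inv, div_le_iff₀ (Real.exp_pos _)] at key
  · intro θ
    convert hc _ (mkTau_mem (isSymm_add_transpose θ M) hy) using 2 with t
    rw [mul_assoc, ← e_add, traceMul_mkTau, trace_mul_add_transpose]
    congr 2
    push_cast
    field_simp
    ring
  · intro θ
    exact hB _ (isSymm_add_transpose θ M)

/-- A Fourier coefficient of a Jacobi form is bounded by the values at given imaginary parts. -/
theorem jacobi_coeff_le {n m : ℕ} {c : Matrix (Fin n) (Fin n) ℚ → (Fin n → ℤ) → ℂ}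
    {φ : Matrix (Fin n) (Fin n) ℂ → (Fin n → ℂ) → ℂ} (hc : HasJacobiFourierExpansion m φ c)
    {y : Matrix (Fin n) (Fin n) ℝ} (hy : y.PosDef) (v : Fin n → ℝ) {B : ℝ}
    (hB : ∀ x : Matrix (Fin n) (Fin n) ℝ, x.IsSymm → ∀ w : Fin n → ℝ,
      ‖φ (mkTau x y) (fun i => (w i : ℂ) + Complex.I * v i)‖ ≤ B) (T : HalfInt n) (r : Fin n → ℤ) :
    ‖c T.1 r‖ ≤ B * Real.exp (2 * Real.pi *
      ((ratR T.1 * y).trace + (fun i => (r i : ℝ)) ⬝ᵥ v)) := by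
  have key := norm_coeff_le_of_hasSum (A := HalfInt n × (Fin n → ℤ))
    (J := (Fin n × Fin n) ⊕ Fin n) (fun p => Sum.elim (freq p.1) p.2) ?_
    (fun p => c p.1.1 p.2 * e (Complex.I *
      (((ratR p.1.1 * y).trace + (fun i => (p.2 i : ℝ)) ⬝ᵥ v : ℝ) : ℂ)))
    (fun θ => φ (mkTau (Matrix.of fun i j => (1 : ℝ) * (θ (.inl (i, j)) + θ (.inl (j, i)))) y)
      (fun i => (θ (.inr i) : ℂ) + Complex.I * v i)) (B := B) ?_ ?_ (T, r)
  · rw [norm_mul, norm_e] at key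
    simp only [Complex.mul_im, Complex.I_re, Complex.ofReal_im, mul_zero, Complex.I_im,
      Complex.ofReal_re, one_mul, zero_add] at key
    rwa [Real.exp_neg, ← div_eq_mul_inv, div_le_iff₀ (Real.exp_pos _)] at key
  · rintro ⟨S, r⟩ ⟨T, s⟩ h
    simp only [Sum.elim_eq_iff] at h
    exact Prod.ext (freq_injective h.1) h.2
  · intro θ
    convert hc.2 _ (mkTau_mem (isSymm_add_transpose (fun p => θ (.inl p)) 1) hy)
      (fun i => (θ (.inr i) : ℂ) + Complex.I * v i) using 2 with p
    have ht : (ratR p.1.1 * Matrix.of fun i j =>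
        (1 : ℝ) * (θ (.inl (i, j)) + θ (.inl (j, i)))).trace =
          1 * ∑ q, (freq p.1 q : ℝ) * θ (.inl q) :=
      trace_mul_add_transpose p.1 (fun q => θ (.inl q)) 1
    rw [mul_assoc, ← e_add, traceMul_mkTau, ht]
    congr 2
    have h1 : (fun i => (p.2 i : ℂ)) ⬝ᵥ (fun i => (θ (.inr i) : ℂ) + Complex.I * v i) =
        ∑ i, (p.2 i : ℂ) * θ (.inr i) + Complex.I * ∑ i, (p.2 i : ℂ) * v i := by
      simp only [dotProduct, mul_add, Finset.sum_add_distrib, Finset.mul_sum]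
      congr 1
      exact Finset.sum_congr rfl fun i _ => by ring
    rw [h1]
    simp only [Fintype.sum_sum_type, Sum.elim_inl, Sum.elim_inr, dotProduct]
    push_cast
    ring
  · intro θ
    exact hB _ (isSymm_add_transpose (fun p => θ (.inl p)) 1) _

/-! ### Half-integral matrices and the unimodular symmetry of the coefficients -/

theorem halfIntegral_of_int {ι : Type} {t : Matrix ι ι ℚ} {A : Matrix ι ι ℤ}
    (h : (2 : ℚ) • t = A.map (fun x : ℤ => (x : ℚ)) + (A.map (fun x : ℤ => (x : ℚ)))ᵀ) :
    HalfIntegral t := by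
  have h' : ∀ i j, 2 * t i j = A i j + A j i := fun i j => by
    simpa using congrFun (congrFun h i) j
  refine ⟨?_, fun i => ⟨A i i, ?_⟩, fun i j => ⟨A i j + A j i, ?_⟩⟩
  · ext i j
    have h1 := h' i j
    have h2 := h' j i
    simp only [Matrix.transpose_apply]
    linarith
  · have := h' i i
    linarith
  · rw [h']; push_cast; ring

section HalfIntegral

variable {ι : Type} [Fintype ι] [DecidableEq ι]

theorem HalfIntegral.exists_int {t : Matrix ι ι ℚ} (ht : HalfIntegral t) :
    ∃ A : Matrix ι ι ℤ, (2 : ℚ) • t = A.map (fun x : ℤ => (x : ℚ)) +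
      (A.map (fun x : ℤ => (x : ℚ)))ᵀ := by
  obtain ⟨hs, hd, ho⟩ := ht
  choose d hd using hd
  choose o ho using ho
  let f := Fintype.equivFin ι
  refine ⟨Matrix.of fun i j => if i = j then d i else if f i < f j then o i j else 0, ?_⟩
  ext i j
  simp only [Matrix.smul_apply, Matrix.add_apply, Matrix.map_apply, Matrix.transpose_apply,
    Matrix.of_apply, smul_eq_mul]
  by_cases hij : i = j
  · subst hij
    simp [hd]; ring
  · have hij' : j ≠ i := Ne.symm hij
    have hne : f i ≠ f j := fun h => hij (f.injective h)
    rcases lt_or_gt_of_ne hne with h | h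
    · simp [hij, hij', h, not_lt.2 h.le, ho]
    · simp only [hij, hij', h, not_lt.2 h.le, if_false, if_true]
      rw [← ho, hs.apply]; simp

/-- The rational matrix underlying a unimodular matrix. -/
abbrev ratGL (u : GL ι ℤ) : Matrix ι ι ℚ := u.val.map (fun x : ℤ => (x : ℚ))

theorem HalfIntegral.conj {t : Matrix ι ι ℚ} (ht : HalfIntegral t) (u : GL ι ℤ) :
    HalfIntegral ((ratGL u)ᵀ * t * ratGL u) := by
  obtain ⟨A, hA⟩ := ht.exists_int
  refine halfIntegral_of_int (A := u.valᵀ * A * u.val) ?_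
  have hm : (u.valᵀ * A * u.val).map (fun x : ℤ => (x : ℚ)) =
      (ratGL u)ᵀ * A.map (fun x : ℤ => (x : ℚ)) * ratGL u := by
    ext i j; simp [Matrix.mul_apply]
  rw [hm, ← Matrix.smul_mul, ← Matrix.mul_smul, hA, Matrix.transpose_mul, Matrix.transpose_mul,
    Matrix.transpose_transpose, Matrix.mul_add, Matrix.add_mul, Matrix.mul_assoc (ratGL u)ᵀ (_)ᵀ]

theorem ratR_conj (t : Matrix ι ι ℚ) (u : GL ι ℤ) :
    ratR ((ratGL u)ᵀ * t * ratGL u) = (realGL u)ᵀ * ratR t * realGL u := by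
  ext i j; simp [ratR, realGL, Matrix.mul_apply]

theorem posSemidef_realGL_conj {y : Matrix ι ι ℝ} (hy : y.PosSemidef) (u : GL ι ℤ) :
    ((realGL u)ᵀ * y * realGL u).PosSemidef := by
  simpa using hy.conjTranspose_mul_mul_same (realGL u)

/-- A degenerate t makes the integral matrix 2t singular, so its kernel contains a nonzero integral
vector. -/
theorem HalfIntegral.exists_ker {t : Matrix ι ι ℚ} (ht : HalfIntegral t)
    (hpsd : (ratR t).PosSemidef) (hpd : ¬ (ratR t).PosDef) :
    ∃ v : ι → ℤ, v ≠ 0 ∧ quad (ratR t) (fun i => (v i : ℝ)) = 0 := by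
  obtain ⟨A, hA⟩ := ht.exists_int
  have hdet : (ratR t).det = 0 := by
    by_contra h
    exact hpd (hpsd.posDef_iff_isUnit.2 ((Matrix.isUnit_iff_isUnit_det _).2 (isUnit_iff_ne_zero.2 h)))
  have hA' : (A + Aᵀ).map (fun x : ℤ => (x : ℝ)) = (2 : ℝ) • ratR t := by
    ext i j
    have := congrFun (congrFun hA i) j
    simp only [Matrix.smul_apply, Matrix.add_apply, Matrix.map_apply, Matrix.transpose_apply,
      smul_eq_mul] at this ⊢
    have h2 := congrArg (fun q : ℚ => (q : ℝ)) this
    push_cast at h2 ⊢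
    exact h2.symm
  have hdet' : (A + Aᵀ).det = 0 := by
    have h1 : (((A + Aᵀ).det : ℤ) : ℝ) = ((A + Aᵀ).map (fun x : ℤ => (x : ℝ))).det :=
      RingHom.map_det (Int.castRingHom ℝ) _
    rw [hA', Matrix.det_smul, hdet, mul_zero] at h1
    exact_mod_cast h1
  obtain ⟨v, hv, hv0⟩ := Matrix.exists_mulVec_eq_zero_iff.2 hdet'
  refine ⟨v, hv, ?_⟩
  have h1 : (2 : ℝ) • (ratR t *ᵥ (fun i => (v i : ℝ))) = 0 := by
    rw [← Matrix.smul_mulVec, ← hA']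
    ext i
    have := congrFun hv0 i
    have h2 := congrArg (fun q : ℤ => (q : ℝ)) this
    simpa [Matrix.mulVec, dotProduct] using h2
  have h2 : ratR t *ᵥ (fun i => (v i : ℝ)) = 0 := by
    simpa using h1
  rw [quad, h2, dotProduct_zero]

end HalfIntegral

section Block

variable {n : ℕ}

theorem halfIntegral_blockMatrix (T : HalfInt n) (r : Fin n → ℤ) (m : ℕ) :
    HalfIntegral (blockMatrix T.1 r m) := by
  obtain ⟨hs, hd, ho⟩ := T.2
  refine ⟨?_, ?_, ?_⟩
  · rw [Matrix.IsSymm, blockMatrix, Matrix.fromBlocks_transpose, hs.eq]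
    rfl
  · rintro (i | i)
    · exact hd i
    · exact ⟨m, by simp [blockMatrix]⟩
  · rintro (i | i) (j | j)
    · exact ho i j
    · exact ⟨r i, by simp [blockMatrix]; ring⟩
    · exact ⟨r j, by simp [blockMatrix]; ring⟩
    · exact ⟨2 * m, by simp [blockMatrix]⟩

theorem exists_blockMatrix {t : Matrix (Fin n ⊕ Unit) (Fin n ⊕ Unit) ℚ} (ht : HalfIntegral t)
    (h0 : 0 ≤ t (.inr ()) (.inr ())) :
    ∃ (T : HalfInt n) (r : Fin n → ℤ) (m : ℕ), t = blockMatrix T.1 r m ∧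
      (m : ℚ) = t (.inr ()) (.inr ()) := by
  obtain ⟨hs, hd, ho⟩ := ht
  choose r hr using fun i : Fin n => ho (.inl i) (.inr ())
  obtain ⟨a, ha⟩ := hd (.inr ())
  have ha0 : 0 ≤ a := by rw [ha] at h0; exact_mod_cast h0
  lift a to ℕ using ha0
  refine ⟨⟨t.toBlocks₁₁, ?_, fun i => hd (.inl i), fun i j => ho (.inl i) (.inl j)⟩, r, a, ?_,
    by rw [ha]; simp⟩
  · ext i j
    exact hs.apply (.inl i) (.inl j)
  · ext (i | i) (j | j)
    · rfl
    · simp only [blockMatrix, Matrix.fromBlocks_apply₁₂, Matrix.of_apply]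
      have := hr i
      linarith
    · simp only [blockMatrix, Matrix.fromBlocks_apply₂₁, Matrix.of_apply]
      have := hr j
      rw [← hs.apply]
      linarith
    · simp only [blockMatrix, Matrix.fromBlocks_apply₂₂, Matrix.of_apply]
      simpa using ha

theorem quad_blockMatrix (T : Matrix (Fin n) (Fin n) ℚ) (r : Fin n → ℤ) (m : ℕ) (x : Fin n → ℝ)
    (s : ℝ) : quad (ratR (blockMatrix T r m)) (Sum.elim x fun _ => s) =
      quad (ratR T) x + s * ((fun i => (r i : ℝ)) ⬝ᵥ x) + m * s ^ 2 := by
  simp only [quad, dotProduct, Matrix.mulVec, Fintype.sum_sum_type, Sum.elim_inl, Sum.elim_inr,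
    blockMatrix, ratR, Matrix.map_apply, Matrix.fromBlocks_apply₁₁, Matrix.fromBlocks_apply₁₂,
    Matrix.fromBlocks_apply₂₁, Matrix.fromBlocks_apply₂₂, Matrix.of_apply, Finset.univ_unique,
    Finset.sum_singleton, mul_add, Finset.sum_add_distrib, Finset.mul_sum]
  push_cast
  have h1 : ∑ i, x i * ((r i : ℝ) / 2 * s) = ∑ i, s * ((r i : ℝ) / 2 * x i) :=
    Finset.sum_congr rfl fun i _ => by ring
  have h2 : ∑ i, s * ((r i : ℝ) * x i) = ∑ i, s * ((r i : ℝ) / 2 * x i) +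
      ∑ i, s * ((r i : ℝ) / 2 * x i) := by
    rw [← Finset.sum_add_distrib]
    exact Finset.sum_congr rfl fun i _ => by ring
  rw [h1, h2]
  ring

end Block

/-- The Fourier coefficients of a symmetric formal Fourier-Jacobi series. -/
structure FJCoeff (n : ℕ) (κ : ℤ) (φ : ℕ → Matrix (Fin n) (Fin n) ℂ → (Fin n → ℂ) → ℂ)
    (c : Matrix (Fin n ⊕ Unit) (Fin n ⊕ Unit) ℚ → ℂ) : Prop where
  expansion : ∀ m, HasJacobiFourierExpansion m (φ m) (fun T r => c (blockMatrix T r m))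
  symmetric : ∀ (u : GL (Fin n ⊕ Unit) ℤ) (t : Matrix (Fin n ⊕ Unit) (Fin n ⊕ Unit) ℚ),
      HalfIntegral t → (ratR t).PosSemidef →
      ∀ s : ℂ, s ^ 2 = (u.val.det : ℂ) → c ((ratGL u)ᵀ * t * ratGL u) = s ^ κ * c t

theorem FJCoeff.norm_conj {n : ℕ} {κ : ℤ} {φ : ℕ → Matrix (Fin n) (Fin n) ℂ → (Fin n → ℂ) → ℂ}
    {c : Matrix (Fin n ⊕ Unit) (Fin n ⊕ Unit) ℚ → ℂ} (hc : FJCoeff n κ φ c)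
    (u : GL (Fin n ⊕ Unit) ℤ) {t : Matrix (Fin n ⊕ Unit) (Fin n ⊕ Unit) ℚ} (ht : HalfIntegral t)
    (hpsd : (ratR t).PosSemidef) : ‖c ((ratGL u)ᵀ * t * ratGL u)‖ = ‖c t‖ := by
  obtain ⟨s, hs⟩ := IsAlgClosed.exists_pow_nat_eq ((u.val.det : ℤ) : ℂ) two_pos
  have hs1 : ‖s‖ = 1 := by
    have h2 : IsUnit u.val.det := (Matrix.isUnit_iff_isUnit_det _).1 u.isUnit
    have h3 : ‖s‖ ^ 2 = 1 := by
      rw [← norm_pow, hs]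
      rcases Int.isUnit_iff.1 h2 with h | h <;> simp [h]
    exact (pow_eq_one_iff_of_nonneg (norm_nonneg s) two_ne_zero).1 h3
  rw [hc.symmetric u t ht hpsd s hs, norm_mul, norm_zpow, hs1, one_zpow, one_mul]

/-- For a nonzero integral vector `v`, the coefficient at `t` is, up to a constant of absolute value
one, a coefficient of the Jacobi form of some index `m' ≤ t[v]`. -/
theorem FJCoeff.exists_equiv {n : ℕ} {κ : ℤ}
    {φ : ℕ → Matrix (Fin n) (Fin n) ℂ → (Fin n → ℂ) → ℂ}
    {c : Matrix (Fin n ⊕ Unit) (Fin n ⊕ Unit) ℚ → ℂ} (hc : FJCoeff n κ φ c)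
    {t : Matrix (Fin n ⊕ Unit) (Fin n ⊕ Unit) ℚ} (ht : HalfIntegral t)
    (hpsd : (ratR t).PosSemidef) {v : Fin n ⊕ Unit → ℤ} (hv : v ≠ 0) :
    ∃ (T : HalfInt n) (r : Fin n → ℤ) (m : ℕ), ‖c t‖ = ‖c (blockMatrix T.1 r m)‖ ∧
      (m : ℝ) ≤ quad (ratR t) (fun i => (v i : ℝ)) ∧
      (ratR (blockMatrix T.1 r m)).det = (ratR t).det ∧
      ((ratR t).PosDef → (ratR (blockMatrix T.1 r m)).PosDef) := by
  -- The last column of u is a divisor of v, so conjugation by u puts t[v]/d² in the corner, which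
  -- is the new index.
  obtain ⟨u, d, hd⟩ := exists_GL_col v hv (Sum.inr ())
  have hd0 : d ≠ 0 := by
    rintro rfl
    exact hv (funext fun j => by simpa using hd j)
  have hR := ratR_conj t u
  have hpsd' : (ratR ((ratGL u)ᵀ * t * ratGL u)).PosSemidef := by
    rw [hR]; exact posSemidef_realGL_conj hpsd u
  have h0R : 0 ≤ (ratR ((ratGL u)ᵀ * t * ratGL u)) (.inr ()) (.inr ()) := hpsd'.diag_nonneg
  have h0 : 0 ≤ ((ratGL u)ᵀ * t * ratGL u) (.inr ()) (.inr ()) := by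
    simpa only [ratR, Matrix.map_apply, Rat.cast_nonneg] using h0R
  obtain ⟨T, r, m, htm, hm⟩ := exists_blockMatrix (ht.conj u) h0
  refine ⟨T, r, m, ?_, ?_, ?_, ?_⟩
  · rw [← htm, hc.norm_conj u ht hpsd]
  · have hmR : (m : ℝ) = (ratR ((ratGL u)ᵀ * t * ratGL u)) (.inr ()) (.inr ()) := by
      have := congrArg (fun q : ℚ => (q : ℝ)) hm
      simpa only [ratR, Matrix.map_apply, Rat.cast_natCast] using this
    have e1 : (fun i => (v i : ℝ)) = (d : ℝ) • (realGL u *ᵥ Pi.single (.inr ()) 1) := by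
      rw [realGL_mulVec_single]
      ext j
      simp [hd j]
    rw [e1, quad_smul, ← quad_conj, quad_single, ← hR, ← hmR]
    have := one_le_sq_of_ne_zero hd0
    have hm0 : (0 : ℝ) ≤ m := Nat.cast_nonneg m
    nlinarith
  · rw [← htm, hR, det_realGL_conj]
  · intro hpd
    rw [← htm, hR]
    exact posDef_realGL_conj hpd u

/-- The coefficients of a cuspidal series are supported on positive definite matrices. -/
theorem FJCoeff.posDef {n : ℕ} {κ : ℤ}
    {φ : ℕ → Matrix (Fin n) (Fin n) ℂ → (Fin n → ℂ) → ℂ}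
    {c : Matrix (Fin n ⊕ Unit) (Fin n ⊕ Unit) ℚ → ℂ} (hc : FJCoeff n κ φ c) (hcusp : IsCuspidal φ)
    {t : Matrix (Fin n ⊕ Unit) (Fin n ⊕ Unit) ℚ} (ht : HalfIntegral t)
    (hpsd : (ratR t).PosSemidef) (h : c t ≠ 0) : (ratR t).PosDef := by
  by_contra hpd
  obtain ⟨v, hv, hv0⟩ := ht.exists_ker hpsd hpd
  obtain ⟨T, r, m, h1, h2, -, -⟩ := hc.exists_equiv ht hpsd hv
  rw [hv0] at h2
  have hm : m = 0 := by
    have : m ≤ 0 := by exact_mod_cast h2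
    omega
  subst hm
  -- A kernel vector moves t to index 0, where the Jacobi form vanishes and hence all its
  -- coefficients do.
  have h3 := jacobi_coeff_le (hc.expansion 0) (y := 1) Matrix.PosDef.one 0 (B := 0)
    (fun x hx w => by
      rw [hcusp _ (mkTau_mem hx Matrix.PosDef.one)]; simp) T r
  rw [zero_mul] at h3
  rw [← h1] at h3
  exact h (norm_le_zero_iff.1 h3)

/-! ### Fourier expansion of a specialization -/

section Expansion

variable {n : ℕ}

/-- The matrix `T + (r lᵗ + l rᵗ)/2 + m l lᵗ`. -/
def shift {K : Type} [Field K] (T : Matrix (Fin n) (Fin n) K) (r l : Fin n → K) (m : K) :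
    Matrix (Fin n) (Fin n) K :=
  Matrix.of fun i j => T i j + (r i * l j + l i * r j) / 2 + m * (l i * l j)

/-- The real vector underlying an integral vector. -/
abbrev vecR {ι : Type} (r : ι → ℤ) : ι → ℝ := fun i => (r i : ℝ)

/-- The shifted matrix is the block form pulled back along x ↦ (x, l·x). Hence it inherits positive
definiteness. -/
theorem quad_shift (T : Matrix (Fin n) (Fin n) ℚ) (r : Fin n → ℤ) (l : Fin n → ℝ) (m : ℕ)
    (x : Fin n → ℝ) : quad (shift (ratR T) (vecR r) l m) x =
      quad (ratR (blockMatrix T r m)) (Sum.elim x fun _ => l ⬝ᵥ x) := by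
  rw [quad_blockMatrix]
  have h : ∀ i, (shift (ratR T) (vecR r) l m *ᵥ x) i =
      (ratR T *ᵥ x) i + (r i * (l ⬝ᵥ x) + l i * (vecR r ⬝ᵥ x)) / 2 + m * (l i * (l ⬝ᵥ x)) := by
    intro i
    simp only [Matrix.mulVec, dotProduct, shift, Matrix.of_apply, Finset.mul_sum,
      ← Finset.sum_add_distrib, Finset.sum_div]
    exact Finset.sum_congr rfl fun j _ => by ring
  have h2 : quad (shift (ratR T) (vecR r) l m) x = quad (ratR T) x +
      ((vecR r ⬝ᵥ x) * (l ⬝ᵥ x) + (l ⬝ᵥ x) * (vecR r ⬝ᵥ x)) / 2 +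
        m * ((l ⬝ᵥ x) * (l ⬝ᵥ x)) := by
    simp only [quad]
    rw [show (x ⬝ᵥ (shift (ratR T) (vecR r) l m *ᵥ x)) =
      ∑ i, x i * (shift (ratR T) (vecR r) l m *ᵥ x) i from rfl]
    simp only [h]
    have e1 : ∀ a : Fin n → ℝ, ∀ b : ℝ, ∑ i, x i * (a i * b) = (a ⬝ᵥ x) * b := by
      intro a b
      rw [dotProduct, Finset.sum_mul]
      exact Finset.sum_congr rfl fun i _ => by ring
    rw [← e1 (vecR r), ← e1 l (vecR r ⬝ᵥ x), ← e1 l (l ⬝ᵥ x),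
      show x ⬝ᵥ (ratR T *ᵥ x) = ∑ i, x i * (ratR T *ᵥ x) i from rfl,
      ← Finset.sum_add_distrib, Finset.sum_div, Finset.mul_sum, ← Finset.sum_add_distrib,
      ← Finset.sum_add_distrib]
    exact Finset.sum_congr rfl fun i _ => by ring
  rw [h2]
  ring

theorem shift_isSymm {K : Type} [Field K] {T : Matrix (Fin n) (Fin n) K} (hT : T.IsSymm)
    (r l : Fin n → K) (m : K) : (shift T r l m).IsSymm := by
  ext i j
  simp only [shift, Matrix.transpose_apply, Matrix.of_apply, hT.apply i j]
  ring

theorem ratR_isSymm {t : Matrix (Fin n) (Fin n) ℚ} (ht : t.IsSymm) : (ratR t).IsSymm := by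
  ext i j
  simp [ratR, ht.apply i j]

theorem shift_posDef (T : HalfInt n) (r : Fin n → ℤ) (l : Fin n → ℝ) (m : ℕ)
    (h : (ratR (blockMatrix T.1 r m)).PosDef) :
    (shift (ratR T.1) (vecR r) l m).PosDef := by
  refine Matrix.PosDef.of_dotProduct_mulVec_pos ?_ fun x hx => ?_
  · rw [Matrix.IsHermitian, Matrix.conjTranspose_eq_transpose_of_trivial]
    exact shift_isSymm (ratR_isSymm T.2.1) _ _ _
  · have hne : (Sum.elim x fun _ => l ⬝ᵥ x : Fin n ⊕ Unit → ℝ) ≠ 0 := by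
      intro h0
      exact hx (funext fun i => congrFun h0 (Sum.inl i))
    have := quad_pos h hne
    rw [← quad_shift] at this
    simpa [quad] using this

/-- `tr(A τ)` for a real matrix `A`. -/
def traceC (A : Matrix (Fin n) (Fin n) ℝ) (τ : Matrix (Fin n) (Fin n) ℂ) : ℂ :=
  (A.map (fun x : ℝ => (x : ℂ)) * τ).trace

theorem traceC_im (A : Matrix (Fin n) (Fin n) ℝ) (τ : Matrix (Fin n) (Fin n) ℂ) :
    (traceC A τ).im = (A * τ.map Complex.im).trace := by
  simp [traceC, Matrix.trace, Matrix.mul_apply]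

theorem norm_e_traceC (A : Matrix (Fin n) (Fin n) ℝ) (τ : Matrix (Fin n) (Fin n) ℂ) :
    ‖e (traceC A τ)‖ = Real.exp (-(2 * Real.pi * (A * τ.map Complex.im).trace)) := by
  rw [norm_e, traceC_im]

theorem traceC_shift (T : Matrix (Fin n) (Fin n) ℚ) (r : Fin n → ℤ) (l u : Fin n → ℝ) (m : ℕ)
    {τ : Matrix (Fin n) (Fin n) ℂ} (hτ : τ.IsSymm) :
    m * (vecC l ⬝ᵥ (τ *ᵥ vecC l)) +
      (traceMul T τ + (fun i => (r i : ℂ)) ⬝ᵥ (τ *ᵥ vecC l + vecC u)) =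
      (fun i => (r i : ℂ)) ⬝ᵥ vecC u + traceC (shift (ratR T) (vecR r) l m) τ := by
  have h1 : traceC (shift (ratR T) (vecR r) l m) τ = traceMul T τ +
      ((fun i => (r i : ℂ)) ⬝ᵥ (τ *ᵥ vecC l) + vecC l ⬝ᵥ (τ *ᵥ fun i => (r i : ℂ))) / 2 +
        m * (vecC l ⬝ᵥ (τ *ᵥ vecC l)) := by
    simp only [traceC, traceMul, Matrix.trace, Matrix.diag_apply, Matrix.mul_apply, dotProduct,
      Matrix.mulVec, shift, Matrix.map_apply, Matrix.of_apply, Finset.mul_sum,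
      ← Finset.sum_add_distrib, Finset.sum_div]
    refine Finset.sum_congr rfl fun i _ => Finset.sum_congr rfl fun j _ => ?_
    rw [hτ.apply i j]
    simp only [vecC, vecR]
    push_cast
    ring
  have h2 : vecC l ⬝ᵥ (τ *ᵥ fun i => (r i : ℂ)) = (fun i => (r i : ℂ)) ⬝ᵥ (τ *ᵥ vecC l) := by
    rw [Matrix.dotProduct_mulVec, ← Matrix.mulVec_transpose, hτ.eq, dotProduct_comm]
  rw [h1, h2, dotProduct_add]
  ring

theorem hasSum_of_eq {P : Type} {f g : P → ℂ} {S : ℂ} (h : HasSum f S) (hfg : ∀ p, f p = g p) :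
    HasSum g S := by
  rwa [← funext hfg]

/-- The Fourier expansion of a specialization of a Jacobi form. -/
theorem eta_hasSum {m : ℕ} {φ : Matrix (Fin n) (Fin n) ℂ → (Fin n → ℂ) → ℂ}
    {c : Matrix (Fin n) (Fin n) ℚ → (Fin n → ℤ) → ℂ} (hc : HasJacobiFourierExpansion m φ c)
    {τ : Matrix (Fin n) (Fin n) ℂ} (hτ : τ ∈ siegelUpperHalfSpace n) (l u : Fin n → ℝ) :
    HasSum (fun p : HalfInt n × (Fin n → ℤ) =>
      (c p.1.1 p.2 * e ((fun i => (p.2 i : ℂ)) ⬝ᵥ vecC u)) *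
        e (traceC (shift (ratR p.1.1) (vecR p.2) l m) τ))
      (eta m φ (vecC l) (vecC u) τ) := by
  have h := (hc.2 τ hτ (τ *ᵥ vecC l + vecC u)).mul_left (e (m * (vecC l ⬝ᵥ (τ *ᵥ vecC l))))
  rw [eta]
  refine hasSum_of_eq h fun p => ?_
  rw [mul_assoc (c p.1.1 p.2), ← e_add, ← traceC_shift _ _ _ _ _ hτ.1, e_add (m * _)]
  ring

theorem hasSum_fiber {P Q : Type} (Φ : P → Q) (f : P → ℂ) (g : Q → ℂ) {S : ℂ}
    (h : HasSum (fun p => f p * g (Φ p)) S) :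
    HasSum (fun q => (∑' p : {p // Φ p = q}, f p) * g q) S := by
  have h1 := (Equiv.sigmaFiberEquiv Φ).hasSum_iff.2 h
  have h2 : ∀ q, HasSum (fun p : {p // Φ p = q} => f p * g (Φ p))
      ((∑' p : {p // Φ p = q}, f p) * g q) := by
    intro q
    have hs : Summable (fun p : {p // Φ p = q} => f p * g q) := by
      have := h1.summable.sigma_factor q
      refine this.congr fun p => ?_
      simp [Equiv.sigmaFiberEquiv, p.2]
    have : (fun p : {p // Φ p = q} => f p * g (Φ p)) = fun p : {p // Φ p = q} => f p * g q := by
      ext p; rw [p.2]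
    rw [this, ← tsum_mul_right]
    exact hs.hasSum
  exact h1.sigma h2

end Expansion

/-! ### Torsion points: level, cusps and holomorphy -/

section Torsion

variable {n : ℕ}

/-- The torsion vector `A / N`. -/
def divVec (N : ℕ) (A : Fin n → ℤ) : Fin n → ℚ := fun i => (A i : ℚ) / N

theorem InTorsionLattice.exists_eq {N : ℕ} (hN : 0 < N) {v : Fin n → ℚ} (h : InTorsionLattice N v) :
    ∃ A : Fin n → ℤ, v = divVec N A := by
  choose A hA using h
  refine ⟨A, funext fun i => ?_⟩
  have : (N : ℚ) ≠ 0 := by exact_mod_cast hN.ne'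
  rw [divVec, ← hA]
  field_simp

/-- The exponent `N² (T + (r lᵗ + l rᵗ)/2 + m l lᵗ)`, for `l = A / N`. -/
def exponent (N : ℕ) (A : Fin n → ℤ) (m : ℕ) (p : HalfInt n × (Fin n → ℤ)) :
    Matrix (Fin n) (Fin n) ℚ :=
  Matrix.of fun i j => (N : ℚ) ^ 2 * p.1.1 i j + N * ((p.2 i * A j + A i * p.2 j : ℤ) : ℚ) / 2 +
    m * ((A i * A j : ℤ) : ℚ)

theorem exponent_halfIntegral (N : ℕ) (A : Fin n → ℤ) (m : ℕ) (p : HalfInt n × (Fin n → ℤ)) :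
    HalfIntegral (exponent N A m p) := by
  obtain ⟨hs, hd, ho⟩ := p.1.2
  refine ⟨?_, fun i => ?_, fun i j => ?_⟩
  · ext i j
    simp only [exponent, Matrix.transpose_apply, Matrix.of_apply, hs.apply i j]
    push_cast; ring
  · obtain ⟨a, ha⟩ := hd i
    refine ⟨N ^ 2 * a + N * (p.2 i * A i) + m * (A i * A i), ?_⟩
    simp only [exponent, Matrix.of_apply, ha]
    push_cast; ring
  · obtain ⟨a, ha⟩ := ho i j
    refine ⟨N ^ 2 * a + N * (p.2 i * A j + A i * p.2 j) + 2 * (m * (A i * A j)), ?_⟩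
    simp only [exponent, Matrix.of_apply]
    push_cast
    linear_combination (N : ℚ) ^ 2 * ha

/-- The exponent as a half-integral matrix. -/
def exponentH (N : ℕ) (A : Fin n → ℤ) (m : ℕ) (p : HalfInt n × (Fin n → ℤ)) : HalfInt n :=
  ⟨exponent N A m p, exponent_halfIntegral N A m p⟩

/-- The real torsion vector `A / N`. -/
noncomputable def divVecR (N : ℕ) (A : Fin n → ℤ) : Fin n → ℝ := fun i => (A i : ℝ) / N

theorem ratR_exponent {N : ℕ} (hN : 0 < N) (A : Fin n → ℤ) (m : ℕ) (p : HalfInt n × (Fin n → ℤ)) :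
    ratR (exponent N A m p) =
      ((N : ℝ) ^ 2) • shift (ratR p.1.1) (vecR p.2) (divVecR N A) m := by
  have : (N : ℝ) ≠ 0 := by exact_mod_cast hN.ne'
  ext i j
  simp only [exponent, shift, divVecR, Matrix.map_apply, Matrix.of_apply, Matrix.smul_apply,
    smul_eq_mul]
  push_cast
  field_simp

/-- The Fourier coefficients of the specialization at `(A / N, U / N)`. -/
noncomputable def torsionCoeff (N : ℕ) (c : Matrix (Fin n) (Fin n) ℚ → (Fin n → ℤ) → ℂ)
    (A U : Fin n → ℤ) (m : ℕ) (t : HalfInt n) : ℂ :=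
  ∑' p : {p : HalfInt n × (Fin n → ℤ) // exponentH N A m p = t},
    c p.1.1.1 p.1.2 * e ((fun i => (p.1.2 i : ℂ)) ⬝ᵥ vecC (divVecR N U))

theorem traceMul_eq_traceC (t : Matrix (Fin n) (Fin n) ℚ) (τ : Matrix (Fin n) (Fin n) ℂ) :
    traceMul t τ = traceC (ratR t) τ := by
  simp [traceMul, traceC, Matrix.trace, Matrix.mul_apply]

theorem traceC_smul (a : ℝ) (A : Matrix (Fin n) (Fin n) ℝ) (τ : Matrix (Fin n) (Fin n) ℂ) :
    traceC (a • A) τ = a * traceC A τ := by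
  simp [traceC, Matrix.trace, Matrix.mul_apply, Finset.mul_sum, mul_assoc]

theorem torsion_hasSum {N : ℕ} (hN : 0 < N) {m : ℕ}
    {φ : Matrix (Fin n) (Fin n) ℂ → (Fin n → ℂ) → ℂ}
    {c : Matrix (Fin n) (Fin n) ℚ → (Fin n → ℤ) → ℂ} (hc : HasJacobiFourierExpansion m φ c)
    {τ : Matrix (Fin n) (Fin n) ℂ} (hτ : τ ∈ siegelUpperHalfSpace n) (A U : Fin n → ℤ) :
    HasSum (fun t : HalfInt n => torsionCoeff N c A U m t * e (traceMul t.1 τ / (N ^ 2 : ℕ)))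
      (eta m φ (vecC (divVecR N A)) (vecC (divVecR N U)) τ) := by
  refine hasSum_fiber (exponentH N A m)
    (fun p : HalfInt n × (Fin n → ℤ) =>
      c p.1.1 p.2 * e ((fun i => (p.2 i : ℂ)) ⬝ᵥ vecC (divVecR N U)))
    (fun t : HalfInt n => e (traceMul t.1 τ / (N ^ 2 : ℕ))) ?_
  refine hasSum_of_eq (eta_hasSum hc hτ (divVecR N A) (divVecR N U)) fun p => ?_
  have hN' : (N : ℂ) ≠ 0 := by exact_mod_cast hN.ne'
  congr 2
  rw [exponentH, traceMul_eq_traceC, ratR_exponent hN, traceC_smul]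
  push_cast
  field_simp

theorem exponent_posDef {N : ℕ} (hN : 0 < N) (A : Fin n → ℤ) (m : ℕ)
    (p : HalfInt n × (Fin n → ℤ)) (h : (ratR (blockMatrix p.1.1 p.2 m)).PosDef) :
    (ratR (exponentH N A m p).1).PosDef := by
  rw [exponentH, ratR_exponent hN]
  exact (shift_posDef p.1 p.2 _ m h).smul (by positivity)

theorem torsionCoeff_posDef {κ : ℤ} {φ : ℕ → Matrix (Fin n) (Fin n) ℂ → (Fin n → ℂ) → ℂ}
    {c : Matrix (Fin n ⊕ Unit) (Fin n ⊕ Unit) ℚ → ℂ} (hc : FJCoeff n κ φ c) (hcusp : IsCuspidal φ)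
    {N : ℕ} (hN : 0 < N) (A U : Fin n → ℤ) (m : ℕ) (t : HalfInt n)
    (h : torsionCoeff N (fun T r => c (blockMatrix T r m)) A U m t ≠ 0) : (ratR t.1).PosDef := by
  rw [torsionCoeff] at h
  have : ∃ p : {p : HalfInt n × (Fin n → ℤ) // exponentH N A m p = t},
      c (blockMatrix p.1.1.1 p.1.2 m) ≠ 0 := by
    by_contra hcon
    push Not at hcon
    apply h
    simp [hcon]
  obtain ⟨⟨p, rfl⟩, hp⟩ := this
  exact exponent_posDef hN A m p (hc.posDef hcusp (halfIntegral_blockMatrix p.1 p.2 m)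
    ((hc.expansion m).1 p.1 p.2 hp) hp)

theorem torsionSpecialization_eq (φ : ℕ → Matrix (Fin n) (Fin n) ℂ → (Fin n → ℂ) → ℂ)
    (N m : ℕ) (A U : Fin n → ℤ) (τ : Matrix (Fin n) (Fin n) ℂ) :
    torsionSpecialization φ (divVec N A) (divVec N U) m τ =
      eta m (φ m) (vecC (divVecR N A)) (vecC (divVecR N U)) τ := by
  have h : ∀ B : Fin n → ℤ, (fun i => ((divVec N B i : ℚ) : ℂ)) = vecC (divVecR N B) := by
    intro B; ext i; simp [divVec, divVecR, vecC]
  rw [torsionSpecialization, eta, h, h]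

theorem cx_mulVec_divVecR (N : ℕ) (M : Matrix (Fin n) (Fin n) ℤ) (A : Fin n → ℤ) :
    cx M *ᵥ vecC (divVecR N A) = vecC (divVecR N (M *ᵥ A)) := by
  ext i
  simp only [vecC, divVecR, Matrix.mulVec, dotProduct, Matrix.map_apply]
  push_cast
  rw [Finset.sum_div]
  exact Finset.sum_congr rfl fun j _ => by ring

theorem vecC_divVecR_add (N : ℕ) (A B : Fin n → ℤ) :
    vecC (divVecR N (A + B)) = vecC (divVecR N A) + vecC (divVecR N B) := by
  ext i; simp [vecC, divVecR, add_div]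

variable {κ : ℤ} {m : ℕ} {φ : Matrix (Fin n) (Fin n) ℂ → (Fin n → ℂ) → ℂ}

theorem slash_eta (hφ : IsJacobiForm n κ m φ) (N : ℕ) (A U : Fin n → ℤ) (g : Mp n)
    {τ : Matrix (Fin n) (Fin n) ℂ} (hτ : τ ∈ siegelUpperHalfSpace n) :
    slash κ (eta m φ (vecC (divVecR N A)) (vecC (divVecR N U))) g τ =
      e (m * (vecC (divVecR N (g.γ.toBlocks₁₁ᵀ *ᵥ A + g.γ.toBlocks₂₁ᵀ *ᵥ U)) ⬝ᵥ
        vecC (divVecR N (g.γ.toBlocks₁₂ᵀ *ᵥ A + g.γ.toBlocks₂₂ᵀ *ᵥ U)) -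
          vecC (divVecR N A) ⬝ᵥ vecC (divVecR N U))) *
      eta m φ (vecC (divVecR N (g.γ.toBlocks₁₁ᵀ *ᵥ A + g.γ.toBlocks₂₁ᵀ *ᵥ U)))
        (vecC (divVecR N (g.γ.toBlocks₁₂ᵀ *ᵥ A + g.γ.toBlocks₂₂ᵀ *ᵥ U))) τ := by
  have ht : ∀ A : Matrix (Fin n) (Fin n) ℤ, (cx A)ᵀ = cx Aᵀ := fun _ => rfl
  rw [slash, eta_moebius hφ g hτ (vecC (divVecR N A)) (vecC (divVecR N U)) _ _
    (by rw [ht, ht, cx_mulVec_divVecR, cx_mulVec_divVecR, ← vecC_divVecR_add])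
    (by rw [ht, ht, cx_mulVec_divVecR, cx_mulVec_divVecR, ← vecC_divVecR_add])]
  rw [mul_assoc (g.ω τ ^ κ), ← mul_assoc, ← zpow_add₀ (omega_ne_zero g hτ)]
  simp

theorem exists_congr {M : ℕ} {g : Mp n} (hg : g ∈ principalCongruence n M) (A U : Fin n → ℤ) :
    (∃ B : Fin n → ℤ, g.γ.toBlocks₁₁ᵀ *ᵥ A + g.γ.toBlocks₂₁ᵀ *ᵥ U = A + (M : ℤ) • B) ∧
      ∃ B : Fin n → ℤ, g.γ.toBlocks₁₂ᵀ *ᵥ A + g.γ.toBlocks₂₂ᵀ *ᵥ U = U + (M : ℤ) • B := by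
  have hent : ∀ i j, ((g.γ i j : ℤ) : ZMod M) = (1 : Matrix _ _ (ZMod M)) i j :=
    fun i j => congrFun (congrFun hg i) j
  have key : ∀ V W : Fin n → ℤ, (∀ i, ((V i : ℤ) : ZMod M) = W i) →
      ∃ B : Fin n → ℤ, V = W + (M : ℤ) • B := by
    intro V W h
    have : ∀ i, ∃ b : ℤ, V i - W i = M * b := fun i =>
      (ZMod.intCast_eq_intCast_iff_dvd_sub _ _ _).1 (h i).symm
    choose B hB using this
    refine ⟨B, funext fun i => ?_⟩
    have := hB i
    simp only [Pi.add_apply, Pi.smul_apply, smul_eq_mul]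
    linarith
  constructor
  · refine key _ _ fun i => ?_
    simp [Matrix.mulVec, dotProduct, Matrix.toBlocks₁₁, Matrix.toBlocks₂₁, hent, Matrix.one_apply]
  · refine key _ _ fun i => ?_
    simp [Matrix.mulVec, dotProduct, Matrix.toBlocks₁₂, Matrix.toBlocks₂₂, hent, Matrix.one_apply]

/-- Modulo N², γ shifts A/N and U/N by N times integral vectors; the extra N clears the denominators
in the pairings with A/N and U/N, so every phase is e of an integer. -/
theorem slash_eta_congruence (hφ : IsJacobiForm n κ m φ) {N : ℕ} (hN : 0 < N) (A U : Fin n → ℤ)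
    {g : Mp n} (hg : g ∈ principalCongruence n (N ^ 2))
    {τ : Matrix (Fin n) (Fin n) ℂ} (hτ : τ ∈ siegelUpperHalfSpace n) :
    slash κ (eta m φ (vecC (divVecR N A)) (vecC (divVecR N U))) g τ =
      eta m φ (vecC (divVecR N A)) (vecC (divVecR N U)) τ := by
  obtain ⟨⟨B, hB⟩, ⟨V, hV⟩⟩ := exists_congr hg A U
  have hN' : (N : ℂ) ≠ 0 := by exact_mod_cast hN.ne'
  rw [slash_eta hφ N A U g hτ, hB, hV]
  have hsh : ∀ A B : Fin n → ℤ, vecC (divVecR N (A + ((N ^ 2 : ℕ) : ℤ) • B)) =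
      vecC (divVecR N A) + fun i => (((N * B i : ℤ)) : ℂ) := by
    intro A B
    ext i
    simp only [vecC, divVecR, Pi.add_apply, Pi.smul_apply, smul_eq_mul]
    push_cast
    field_simp
  rw [hsh, hsh, eta_add_int hφ hτ, ← mul_assoc, ← e_add]
  have hdot : ∀ C D : Fin n → ℤ, (fun i => ((N * C i : ℤ) : ℂ)) ⬝ᵥ vecC (divVecR N D) =
      ((C ⬝ᵥ D : ℤ) : ℂ) := by
    intro C D
    simp only [dotProduct, vecC, divVecR]
    push_cast
    exact Finset.sum_congr rfl fun i _ => by field_simp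
  have hphase : (m : ℂ) * ((vecC (divVecR N A) + fun i => (((N * B i : ℤ)) : ℂ)) ⬝ᵥ
      (vecC (divVecR N U) + fun i => (((N * V i : ℤ)) : ℂ)) -
        vecC (divVecR N A) ⬝ᵥ vecC (divVecR N U)) +
      -(2 * m * ((fun i => ((N * B i : ℤ) : ℂ)) ⬝ᵥ vecC (divVecR N U))) =
      ((m * (B ⬝ᵥ U + V ⬝ᵥ A + (fun i => N * B i) ⬝ᵥ (fun i => N * V i)) - 2 * m * (B ⬝ᵥ U) : ℤ) :
        ℂ) := by
    have h1 : (fun i => (((N * B i : ℤ)) : ℂ)) ⬝ᵥ (fun i => (((N * V i : ℤ)) : ℂ)) =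
        (((fun i => N * B i) ⬝ᵥ (fun i => N * V i) : ℤ) : ℂ) := by
      simp [dotProduct]
    simp only [add_dotProduct, dotProduct_add, h1, hdot]
    rw [dotProduct_comm (vecC (divVecR N A)) (fun i => (((N * V i : ℤ)) : ℂ)), hdot]
    push_cast
    ring
  rw [hphase, e_int, one_mul]

theorem eta_differentiableOn (hφ : IsJacobiForm n κ m φ) (l u : Fin n → ℂ) :
    DifferentiableOn ℂ (eta m φ l u) (siegelUpperHalfSpace n) := by
  have key : ∀ (S : Set (Fin n → Fin n → ℂ)) (ψ : (Fin n → Fin n → ℂ) → (Fin n → ℂ) → ℂ),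
      DifferentiableOn ℂ (fun p : (Fin n → Fin n → ℂ) × (Fin n → ℂ) => ψ p.1 p.2)
        (S ×ˢ Set.univ) →
      DifferentiableOn ℂ (fun τ : Fin n → Fin n → ℂ =>
        e (m * ∑ i, l i * ∑ j, τ i j * l j) * ψ τ (fun i => (∑ j, τ i j * l j) + u i)) S := by
    intro S ψ hψ
    refine DifferentiableOn.mul ?_ ?_
    · unfold e
      fun_prop
    · have hin : DifferentiableOn ℂ (fun τ : Fin n → Fin n → ℂ =>
          (τ, fun i => (∑ j, τ i j * l j) + u i)) S := by fun_prop
      exact hψ.comp hin fun τ hτ => ⟨hτ, Set.mem_univ _⟩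
  exact key _ φ hφ.holo

end Torsion

/-- Slashing by any metaplectic element gives a constant times the specialization at another torsion
point with the same denominator, so the expansion at each cusp is already known. -/
theorem isSiegelCuspForm_torsionSpecialization {n : ℕ} {κ : ℤ}
    {φ : ℕ → Matrix (Fin n) (Fin n) ℂ → (Fin n → ℂ) → ℂ}
    {c : Matrix (Fin n ⊕ Unit) (Fin n ⊕ Unit) ℚ → ℂ} (hj : ∀ m, IsJacobiForm n κ m (φ m))
    (hc : FJCoeff n κ φ c) (hcusp : IsCuspidal φ) {N : ℕ} (hN : 0 < N) (A U : Fin n → ℤ) (m : ℕ) :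
    IsSiegelCuspForm n κ (N ^ 2) (torsionSpecialization φ (divVec N A) (divVec N U) m) := by
  rw [show torsionSpecialization φ (divVec N A) (divVec N U) m =
    eta m (φ m) (vecC (divVecR N A)) (vecC (divVecR N U)) from
      funext fun τ => torsionSpecialization_eq φ N m A U τ]
  refine ⟨eta_differentiableOn (hj m) _ _, fun g hg τ hτ =>
    slash_eta_congruence (hj m) hN A U hg hτ, fun g => ?_⟩
  set A' := g.γ.toBlocks₁₁ᵀ *ᵥ A + g.γ.toBlocks₂₁ᵀ *ᵥ U with hA'
  set U' := g.γ.toBlocks₁₂ᵀ *ᵥ A + g.γ.toBlocks₂₂ᵀ *ᵥ U with hU'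
  refine ⟨fun t => e (m * (vecC (divVecR N A') ⬝ᵥ vecC (divVecR N U') -
    vecC (divVecR N A) ⬝ᵥ vecC (divVecR N U))) *
      torsionCoeff N (fun T r => c (blockMatrix T r m)) A' U' m t, fun t ht => ?_, fun τ hτ => ?_⟩
  · exact torsionCoeff_posDef hc hcusp hN A' U' m t (right_ne_zero_of_mul ht)
  · rw [slash_eta (hj m) N A U g hτ]
    refine hasSum_of_eq ((torsion_hasSum hN (hc.expansion m) hτ A' U').mul_left _) fun t => ?_
    ring

/-! ### Traces and determinants on a Siegel set -/

section Growth

variable {n : ℕ}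

theorem trace_mul_nonneg {P Q : Matrix (Fin n) (Fin n) ℝ} (hP : P.PosSemidef)
    (hQ : ∀ x, 0 ≤ quad Q x) : 0 ≤ (P * Q).trace := by
  obtain ⟨k, a, rfl⟩ := Matrix.posSemidef_iff_eq_sum_vecMulVec.1 hP
  rw [Matrix.sum_mul, Matrix.trace_sum]
  refine Finset.sum_nonneg fun i _ => ?_
  rw [Matrix.trace_mul_comm, Matrix.mul_vecMulVec, Matrix.trace_vecMulVec, dotProduct_comm]
  simpa [quad] using hQ (a i)

theorem quad_sub_diagonal (y : Matrix (Fin n) (Fin n) ℝ) (d x : Fin n → ℝ) :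
    quad (y - Matrix.diagonal d) x = quad y x - ∑ i, d i * x i ^ 2 := by
  simp only [quad, Matrix.sub_mulVec, dotProduct_sub]
  congr 1
  simp only [dotProduct, Matrix.mulVec_diagonal]
  exact Finset.sum_congr rfl fun i _ => by ring

/-- The matrix y minus c times its diagonal is still nonnegative, and its product with P has
nonnegative trace. This reduces the decay of exp(−2π tr(Py)) to diagonal entries. -/
theorem trace_mul_ge {P y : Matrix (Fin n) (Fin n) ℝ} (hP : P.PosSemidef) {c : ℝ}
    (hy : ∀ x : Fin n → ℝ, c * ∑ i, y i i * x i ^ 2 ≤ quad y x) :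
    c * ∑ i, P i i * y i i ≤ (P * y).trace := by
  have h := trace_mul_nonneg hP (Q := y - Matrix.diagonal fun i => c * y i i) fun x => by
    rw [quad_sub_diagonal]
    have := hy x
    simp only [mul_assoc, ← Finset.mul_sum]
    linarith
  rw [Matrix.mul_sub, Matrix.trace_sub] at h
  have h2 : (P * Matrix.diagonal fun i => c * y i i).trace = c * ∑ i, P i i * y i i := by
    simp only [Matrix.trace, Matrix.diag_apply, Matrix.mul_diagonal, Finset.mul_sum]
    exact Finset.sum_congr rfl fun i _ => by ring
  linarith

theorem det_le_trace_pow {P : Matrix (Fin n) (Fin n) ℝ} (hP : P.PosSemidef) :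
    P.det ≤ n.factorial * P.trace ^ n := by
  have hle : ∀ i, P i i ≤ P.trace := fun i =>
    Finset.single_le_sum (f := fun i => P i i) (fun j _ => hP.diag_nonneg) (Finset.mem_univ i)
  have hent : ∀ i j, (AbsoluteValue.abs : AbsoluteValue ℝ ℝ) (P i j) ≤ P.trace := by
    intro i j
    have := abs_apply_le_of_posSemidef hP i j
    have h1 := hle i
    have h2 := hle j
    calc |P i j| ≤ _ := this
      _ ≤ _ := by linarith
  have := Matrix.det_le hent
  simp only [Fintype.card_fin, nsmul_eq_mul] at this
  exact (le_abs_self _).trans this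

theorem exists_pow_le_exp {a : ℝ} (ha : 0 < a) (q : ℕ) :
    ∃ K : ℝ, 0 < K ∧ ∀ x : ℝ, 0 ≤ x → (1 + x) ^ q ≤ K * Real.exp (a * x) := by
  refine ⟨q.factorial / a ^ q * Real.exp a, by positivity, fun x hx => ?_⟩
  have h := Real.pow_div_factorial_le_exp (a * (1 + x)) (by positivity) q
  rw [mul_pow, div_le_iff₀ (by positivity), mul_add, mul_one, Real.exp_add] at h
  rw [div_mul_eq_mul_div, div_mul_eq_mul_div, le_div_iff₀ (by positivity)]
  linarith

/-- On a Siegel set any power of the determinant is dominated by an exponential of the trace. -/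
theorem exists_det_rpow_le (s : ℝ) {a c : ℝ} (ha : 0 < a) (hc : 0 < c) :
    ∃ K : ℝ, 0 < K ∧ ∀ y : Matrix (Fin n) (Fin n) ℝ, y.PosDef → (∀ i, 1 / 2 ≤ y i i) →
      (∀ x : Fin n → ℝ, c * ∑ i, y i i * x i ^ 2 ≤ quad y x) →
      y.det ^ s ≤ K * Real.exp (a * y.trace) := by
  -- For s ≥ 0 the determinant is polynomially bounded in the trace; for s ≤ 0 it is bounded below
  -- because the diagonal entries are at least 1/2.
  rcases le_total 0 s with hs | hs
  · obtain ⟨p, hp⟩ := exists_nat_ge s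
    obtain ⟨K, hK, hKx⟩ := exists_pow_le_exp ha (n * p)
    refine ⟨((n.factorial : ℝ) + 1) ^ p * K, by positivity, fun y hy _ _ => ?_⟩
    have htr : 0 ≤ y.trace := hy.posSemidef.trace_nonneg
    have h1 : 1 + y.det ≤ ((n.factorial : ℝ) + 1) * (1 + y.trace) ^ n := by
      have h2 := det_le_trace_pow hy.posSemidef
      have h3 : y.trace ^ n ≤ (1 + y.trace) ^ n := by gcongr; linarith
      have h4 : 1 ≤ (1 + y.trace) ^ n := one_le_pow₀ (by linarith)
      have h5 : (n.factorial : ℝ) * y.trace ^ n ≤ n.factorial * (1 + y.trace) ^ n := by gcongr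
      linarith
    calc y.det ^ s ≤ (1 + y.det) ^ s :=
          Real.rpow_le_rpow hy.det_pos.le (by linarith) hs
      _ ≤ (1 + y.det) ^ (p : ℝ) :=
          Real.rpow_le_rpow_of_exponent_le (by linarith [hy.det_pos]) hp
      _ = (1 + y.det) ^ p := Real.rpow_natCast _ _
      _ ≤ (((n.factorial : ℝ) + 1) * (1 + y.trace) ^ n) ^ p := by
          gcongr
          linarith [hy.det_pos]
      _ = ((n.factorial : ℝ) + 1) ^ p * (1 + y.trace) ^ (n * p) := by rw [mul_pow, ← pow_mul]
      _ ≤ ((n.factorial : ℝ) + 1) ^ p * (K * Real.exp (a * y.trace)) := by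
          gcongr
          exact hKx _ htr
      _ = _ := by ring
  · refine ⟨((c / 2) ^ n / n.factorial) ^ s, by positivity, fun y hy hd hq => ?_⟩
    have htr : 0 ≤ y.trace := hy.posSemidef.trace_nonneg
    have h1 : (c / 2) ^ n / n.factorial ≤ y.det := by
      refine det_ge_of_quad_ge hy (by positivity) fun x => le_trans ?_ (hq x)
      rw [div_eq_mul_one_div, mul_assoc, Finset.mul_sum]
      gcongr with i
      exact hd i
    calc y.det ^ s ≤ ((c / 2) ^ n / n.factorial) ^ s :=
          Real.rpow_le_rpow_of_nonpos (by positivity) h1 hs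
      _ ≤ _ := le_mul_of_one_le_right (by positivity) (Real.one_le_exp (by positivity))

end Growth

/-! ### Bounds at a fixed index -/

section Jacobi

variable {n : ℕ}

theorem shift_apply_self (T : Matrix (Fin n) (Fin n) ℝ) (r l : Fin n → ℝ) (m : ℝ) (i : Fin n) :
    shift T r l m i i = T i i + r i * l i + m * l i ^ 2 := by
  simp only [shift, Matrix.of_apply]; ring

theorem quad_blockMatrix_single (T : Matrix (Fin n) (Fin n) ℚ) (r : Fin n → ℤ) (m : ℕ) (i : Fin n)
    (a s : ℝ) : quad (ratR (blockMatrix T r m)) (Sum.elim (Pi.single i a) fun _ => s) =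
      a ^ 2 * T i i + a * s * r i + m * s ^ 2 := by
  rw [quad_blockMatrix]
  simp [quad, Matrix.mulVec_single]
  ring

/-- 4m times the entry is (4mT_ii − r_i²) + (r_i + 2m l_i)², and the first term is a positive
integer. The resulting bound does not depend on l. -/
theorem shift_apply_self_ge (T : HalfInt n) (r : Fin n → ℤ) (l : Fin n → ℝ) {m : ℕ} (hm : 0 < m)
    (h : (ratR (blockMatrix T.1 r m)).PosDef) (i : Fin n) :
    1 / (4 * m) ≤ shift (ratR T.1) (vecR r) l m i i := by
  have hm' : (0 : ℝ) < m := by exact_mod_cast hm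
  have hne : (Sum.elim (Pi.single i (2 * m : ℝ)) fun _ => -(r i : ℝ) : Fin n ⊕ Unit → ℝ) ≠ 0 := by
    intro h0
    have := congrFun h0 (Sum.inl i)
    simp [hm.ne'] at this
  have h1 := quad_pos h hne
  rw [quad_blockMatrix_single] at h1
  obtain ⟨a, ha⟩ := T.2.2.1 i
  have haR : ((T.1 i i : ℚ) : ℝ) = a := by rw [ha]; simp
  rw [haR] at h1
  have h2 : (0 : ℝ) < 4 * m * a - r i ^ 2 := by
    have : (0 : ℝ) < m * (4 * m * a - r i ^ 2) := by linarith
    exact pos_of_mul_pos_right this hm'.le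
  have h3 : (1 : ℝ) ≤ 4 * m * a - r i ^ 2 := by
    have : (0 : ℤ) < 4 * m * a - r i ^ 2 := by exact_mod_cast h2
    have : (1 : ℤ) ≤ 4 * m * a - r i ^ 2 := this
    exact_mod_cast this
  rw [shift_apply_self, show ratR T.1 i i = a from haR, div_le_iff₀ (by positivity)]
  nlinarith [sq_nonneg ((r i : ℝ) + 2 * m * l i)]

/-- Testing the block form on (e_i, ±2) gives |r_i| ≤ T_ii/2 + 2m. The resulting growth in T makes
the sum over (T, r) converge uniformly in l. -/
theorem shift_apply_self_ge_half (T : HalfInt n) (r : Fin n → ℤ) {l : Fin n → ℝ} {m : ℕ}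
    (h : (ratR (blockMatrix T.1 r m)).PosSemidef) (i : Fin n) (hl : |l i| ≤ 1) :
    (ratR T.1) i i / 2 - 2 * m ≤ shift (ratR T.1) (vecR r) l m i i := by
  have h1 := quad_nonneg h (Sum.elim (Pi.single i 1) fun _ => 2)
  have h2 := quad_nonneg h (Sum.elim (Pi.single i 1) fun _ => -2)
  rw [quad_blockMatrix_single] at h1 h2
  have hr : |(r i : ℝ)| ≤ (ratR T.1) i i / 2 + 2 * m := by
    rw [abs_le, show ratR T.1 i i = T.1 i i from rfl]
    constructor <;> linarith
  have h3 : |(r i : ℝ) * l i| ≤ (ratR T.1) i i / 2 + 2 * m := by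
    rw [abs_mul]
    exact (mul_le_of_le_one_right (abs_nonneg _) hl).trans hr
  have h4 := (abs_le.1 h3).1
  rw [shift_apply_self]
  have : (0 : ℝ) ≤ m * l i ^ 2 := by positivity
  simp only [vecR] at *
  linarith

end Jacobi

section FixedIndex

variable {n : ℕ}

theorem norm_eta_fract {κ : ℤ} {m : ℕ} {φ : Matrix (Fin n) (Fin n) ℂ → (Fin n → ℂ) → ℂ}
    (hφ : IsJacobiForm n κ m φ) {τ : Matrix (Fin n) (Fin n) ℂ}
    (hτ : τ ∈ siegelUpperHalfSpace n) (l u : Fin n → ℝ) :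
    ‖eta m φ (vecC l) (vecC u) τ‖ = ‖eta m φ (vecC fun i => Int.fract (l i)) (vecC u) τ‖ := by
  have h := eta_add_int hφ hτ (vecC fun i => Int.fract (l i)) (vecC u) (fun i => ⌊l i⌋) 0
  have h1 : (vecC fun i => Int.fract (l i)) + (fun i => ((⌊l i⌋ : ℤ) : ℂ)) = vecC l := by
    ext i
    simp only [Pi.add_apply, vecC]
    rw [← Complex.ofReal_intCast, ← Complex.ofReal_add, Int.fract_add_floor]
  have h2 : vecC u + (fun i => (((0 : Fin n → ℤ) i : ℤ) : ℂ)) = vecC u := by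
    ext i; simp
  rw [h1, h2] at h
  rw [h, norm_mul, show (-(2 * (m : ℂ) * ((fun i => ((⌊l i⌋ : ℤ) : ℂ)) ⬝ᵥ vecC u))) =
    ((-(2 * m * ((fun i => (⌊l i⌋ : ℝ)) ⬝ᵥ u)) : ℝ) : ℂ) by simp [dotProduct, vecC],
    norm_e_ofReal, one_mul]

theorem norm_e_intCast_dotProduct (r : Fin n → ℤ) (u : Fin n → ℝ) :
    ‖e ((fun i => (r i : ℂ)) ⬝ᵥ vecC u)‖ = 1 := by
  rw [show (fun i => (r i : ℂ)) ⬝ᵥ vecC u = ((vecR r ⬝ᵥ u : ℝ) : ℂ) by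
    simp [dotProduct, vecC, vecR], norm_e_ofReal]

theorem smul_one_posDef {a : ℝ} (ha : 0 < a) : (a • (1 : Matrix (Fin n) (Fin n) ℝ)).PosDef :=
  Matrix.PosDef.one.smul ha

theorem shift_zero (T : Matrix (Fin n) (Fin n) ℝ) (r : Fin n → ℝ) (m : ℝ) :
    shift T r 0 m = T := by
  ext i j; simp [shift]

theorem summable_norm_coeff {m : ℕ} {φ : Matrix (Fin n) (Fin n) ℂ → (Fin n → ℂ) → ℂ}
    {c : Matrix (Fin n) (Fin n) ℚ → (Fin n → ℤ) → ℂ} (hc : HasJacobiFourierExpansion m φ c)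
    {a : ℝ} (ha : 0 < a) : Summable fun p : HalfInt n × (Fin n → ℤ) =>
      ‖c p.1.1 p.2‖ * Real.exp (-(2 * Real.pi * (a * (ratR p.1.1).trace))) := by
  have hτ : mkTau 0 (a • (1 : Matrix (Fin n) (Fin n) ℝ)) ∈ siegelUpperHalfSpace n :=
    mkTau_mem (by simp [Matrix.IsSymm]) (smul_one_posDef ha)
  have h := (eta_hasSum hc hτ 0 0).summable.norm
  refine h.congr fun p => ?_
  rw [shift_zero, norm_mul, norm_e_traceC, im_mkTau, norm_mul, norm_e_intCast_dotProduct]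
  simp

/-- In 2 P_ii y_ii, one copy is bounded through P_ii ≥ 1/(4m), giving decay in y, and the other
through y_ii ≥ 1/2, giving decay in T. -/
theorem norm_term_le {m : ℕ} (hm : 0 < m) {c₀ : ℝ} (hc₀ : 0 < c₀)
    {y : Matrix (Fin n) (Fin n) ℝ} (hd : ∀ i, 1 / 2 ≤ y i i)
    (hq : ∀ x : Fin n → ℝ, c₀ * ∑ i, y i i * x i ^ 2 ≤ quad y x)
    (T : HalfInt n) (r : Fin n → ℤ) {l : Fin n → ℝ} (hl : ∀ i, |l i| ≤ 1)
    (h : (ratR (blockMatrix T.1 r m)).PosDef) :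
    Real.pi * c₀ / (4 * m) * y.trace + 2 * Real.pi * (c₀ / 8 * (ratR T.1).trace) -
      Real.pi * c₀ * m * n ≤
      2 * Real.pi * (shift (ratR T.1) (vecR r) l m * y).trace := by
  have hm' : (0 : ℝ) < m := by exact_mod_cast hm
  have hP := (shift_posDef T r l m h).posSemidef
  have h1 := trace_mul_ge hP hq
  have hpi := Real.pi_pos
  set P := shift (ratR T.1) (vecR r) l m with hPdef
  have hi : ∀ i, 1 / (4 * m) * y i i + ((ratR T.1) i i / 4 - m) ≤ 2 * (P i i * y i i) := by
    intro i
    have e1 := shift_apply_self_ge T r l hm h i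
    have e2 := shift_apply_self_ge_half T r h.posSemidef i (hl i)
    rw [← hPdef] at e1 e2
    have e3 : (0 : ℝ) ≤ 1 / (4 * m) := by positivity
    have e4 := hd i
    nlinarith [mul_le_mul_of_nonneg_right e1 (show (0 : ℝ) ≤ y i i by linarith),
      mul_le_mul_of_nonneg_left e4 (e3.trans e1)]
  have hs := Finset.sum_le_sum fun i (_ : i ∈ Finset.univ) => hi i
  rw [Finset.sum_add_distrib, Finset.sum_sub_distrib, ← Finset.mul_sum, ← Finset.mul_sum,
    ← Finset.sum_div] at hs
  simp only [Finset.sum_const, Finset.card_univ, Fintype.card_fin, nsmul_eq_mul] at hs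
  have e5 : Real.pi * (c₀ * (1 / (4 * m) * y.trace + ((ratR T.1).trace / 4 - n * m))) ≤
      Real.pi * (c₀ * (2 * ∑ i, P i i * y i i)) := by
    gcongr
    exact hs
  have e6 : Real.pi * (c₀ * ∑ i, P i i * y i i) ≤ Real.pi * (P * y).trace := by gcongr
  calc _ = Real.pi * (c₀ * (1 / (4 * m) * y.trace + ((ratR T.1).trace / 4 - n * m))) := by
        field_simp; ring
    _ ≤ _ := by linarith

/-- For a fixed positive index, all specializations are uniformly bounded. -/
theorem exists_boundedAt {κ : ℤ} {φ : ℕ → Matrix (Fin n) (Fin n) ℂ → (Fin n → ℂ) → ℂ}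
    {c : Matrix (Fin n ⊕ Unit) (Fin n ⊕ Unit) ℚ → ℂ} (hj : ∀ m, IsJacobiForm n κ m (φ m))
    (hc : FJCoeff n κ φ c) (hcusp : IsCuspidal φ) {m : ℕ} (hm : 0 < m) (A : AddSubgroup ℝ) :
    ∃ B : ℝ, 0 ≤ B ∧ ∀ τ ∈ siegelUpperHalfSpace n, BoundedAt κ m (φ m) A B τ := by
  obtain ⟨c₀, hc₀, hind⟩ := siegel_induction n
  have hm' : (0 : ℝ) < m := by exact_mod_cast hm
  have hpi := Real.pi_pos
  -- The rate is exactly the decay in tr y provided by `norm_term_le`, so the determinant factor is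
  -- absorbed completely.
  obtain ⟨K, hK, hKy⟩ := exists_det_rpow_le (n := n) ((κ : ℝ) / 4)
    (a := Real.pi * c₀ / (4 * m)) (by positivity) hc₀
  have hsum := summable_norm_coeff (hc.expansion m) (a := c₀ / 8) (by positivity)
  set S := ∑' p : HalfInt n × (Fin n → ℤ), ‖c (blockMatrix p.1.1 p.2 m)‖ *
    Real.exp (-(2 * Real.pi * (c₀ / 8 * (ratR p.1.1).trace))) with hS
  have hS0 : 0 ≤ S := tsum_nonneg fun p => by positivity
  refine ⟨S * Real.exp (Real.pi * c₀ * m * n) * K, by positivity, hind _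
    (fun g τ hτ h => h.of_moebius (hj m) g hτ) fun τ hτ hd hq l u _ _ => ?_⟩
  set y := τ.map Complex.im with hy
  rw [norm_eta_fract (hj m) hτ]
  set l' : Fin n → ℝ := fun i => Int.fract (l i) with hl'
  have hl'1 : ∀ i, |l' i| ≤ 1 := fun i => by
    rw [hl', Int.abs_fract]; exact (Int.fract_lt_one _).le
  have hb : ‖eta m (φ m) (vecC l') (vecC u) τ‖ ≤
      S * (Real.exp (Real.pi * c₀ * m * n) * Real.exp (-(Real.pi * c₀ / (4 * m) * y.trace))) := by
    refine (eta_hasSum (hc.expansion m) hτ l' u).norm_le_of_bounded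
      (hsum.hasSum.mul_right _) fun p => ?_
    rw [norm_mul, norm_mul, norm_e_traceC, ← hy]
    rw [norm_e_intCast_dotProduct, mul_one, mul_assoc ‖c _‖ (Real.exp _), ← Real.exp_add, ← Real.exp_add]
    by_cases h0 : c (blockMatrix p.1.1 p.2 m) = 0
    · simp [h0]
    · have hpd := hc.posDef hcusp (halfIntegral_blockMatrix p.1 p.2 m)
        ((hc.expansion m).1 p.1 p.2 h0) h0
      have := norm_term_le (y := y) hm hc₀ hd hq p.1 p.2 hl'1 hpd
      gcongr
      linarith
  have hy' := hKy y hτ.2 hd hq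
  calc _ ≤ S * (Real.exp (Real.pi * c₀ * m * n) *
        Real.exp (-(Real.pi * c₀ / (4 * m) * y.trace))) *
          (K * Real.exp (Real.pi * c₀ / (4 * m) * y.trace)) := by
        gcongr
        exact Real.rpow_nonneg hτ.2.det_pos.le _
    _ = S * Real.exp (Real.pi * c₀ * m * n) * K *
        (Real.exp (-(Real.pi * c₀ / (4 * m) * y.trace)) *
          Real.exp (Real.pi * c₀ / (4 * m) * y.trace)) := by ring
    _ = _ := by rw [← Real.exp_add]; simp

theorem trace_shift_mul (T : Matrix (Fin n) (Fin n) ℝ) (r l : Fin n → ℝ) (m : ℝ)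
    {y : Matrix (Fin n) (Fin n) ℝ} (hy : y.IsSymm) :
    (shift T r l m * y).trace = (T * y).trace + r ⬝ᵥ (y *ᵥ l) + m * quad y l := by
  have h1 : (shift T r l m * y).trace = (T * y).trace +
      (r ⬝ᵥ (y *ᵥ l) + l ⬝ᵥ (y *ᵥ r)) / 2 + m * quad y l := by
    simp only [Matrix.trace, Matrix.diag_apply, Matrix.mul_apply, dotProduct, quad,
      Matrix.mulVec, shift, Matrix.of_apply, Finset.mul_sum,
      ← Finset.sum_add_distrib, Finset.sum_div]
    refine Finset.sum_congr rfl fun i _ => Finset.sum_congr rfl fun j _ => ?_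
    rw [hy.apply i j]
    ring
  have h2 : l ⬝ᵥ (y *ᵥ r) = r ⬝ᵥ (y *ᵥ l) := by
    rw [Matrix.dotProduct_mulVec, ← Matrix.mulVec_transpose, hy.eq, dotProduct_comm]
  rw [h1, h2]
  ring

/-- Any z with imaginary part yl equals τl + u with u real, so bounds over all real parameters
control φ itself; the exponential is the inverse Gaussian factor. -/
theorem norm_apply_le_of_boundedAt {κ : ℤ} {m : ℕ}
    {φ : Matrix (Fin n) (Fin n) ℂ → (Fin n → ℂ) → ℂ} {B : ℝ}
    {x y : Matrix (Fin n) (Fin n) ℝ} (hy : y.PosDef)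
    (hB : BoundedAt κ m φ ⊤ B (mkTau x y)) (l w : Fin n → ℝ) :
    ‖φ (mkTau x y) (fun i => (w i : ℂ) + Complex.I * (y *ᵥ l) i)‖ ≤
      B * y.det ^ (-((κ : ℝ) / 4)) * Real.exp (2 * Real.pi * (m * quad y l)) := by
  have h := hB l (w - x *ᵥ l) (fun _ => trivial) (fun _ => trivial)
  have harg : mkTau x y *ᵥ vecC l + vecC (w - x *ᵥ l) =
      fun i => (w i : ℂ) + Complex.I * (y *ᵥ l) i := by
    ext i
    simp only [mkTau, Pi.add_apply, Matrix.mulVec, dotProduct, Matrix.of_apply, vecC, Pi.sub_apply]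
    push_cast
    simp only [add_mul, Finset.sum_add_distrib, Finset.mul_sum, mul_assoc]
    ring
  have him : (m * (vecC l ⬝ᵥ (mkTau x y *ᵥ vecC l)) : ℂ).im = m * quad y l := by
    simp only [quad, mkTau, Matrix.mulVec, dotProduct, Matrix.of_apply, vecC]
    simp
  rw [eta, harg, norm_mul, norm_e, him, im_mkTau] at h
  have hdet : 0 < y.det ^ ((κ : ℝ) / 4) := Real.rpow_pos_of_pos hy.det_pos _
  rw [Real.rpow_neg hy.det_pos.le]
  rw [Real.exp_neg, mul_assoc, inv_mul_le_iff₀ (Real.exp_pos _), ← le_div_iff₀ hdet] at h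
  calc _ ≤ _ := h
    _ = _ := by rw [div_eq_mul_inv]; ring

theorem coeff_le_of_boundedAt {κ : ℤ} {m : ℕ} {φ : Matrix (Fin n) (Fin n) ℂ → (Fin n → ℂ) → ℂ}
    {c : Matrix (Fin n) (Fin n) ℚ → (Fin n → ℤ) → ℂ} (hc : HasJacobiFourierExpansion m φ c) {B : ℝ}
    (hB : ∀ τ ∈ siegelUpperHalfSpace n, BoundedAt κ m φ ⊤ B τ)
    {y : Matrix (Fin n) (Fin n) ℝ} (hy : y.PosDef) (l : Fin n → ℝ) (T : HalfInt n)
    (r : Fin n → ℤ) :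
    ‖c T.1 r‖ ≤ B * y.det ^ (-((κ : ℝ) / 4)) *
      Real.exp (2 * Real.pi * (shift (ratR T.1) (vecR r) l m * y).trace) := by
  have h := jacobi_coeff_le hc hy (y *ᵥ l) (fun x hx w =>
    norm_apply_le_of_boundedAt hy (hB _ (mkTau_mem hx hy)) l w) T r
  rw [mul_assoc, ← Real.exp_add] at h
  rw [trace_shift_mul _ _ _ _ (isSymm_of_posDef hy)]
  refine h.trans_eq ?_
  congr 2
  ring

/-- The Schur complement `T - r rᵗ / (4 m)` of `m` in `(T, r/2; rᵗ/2, m)`. -/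
noncomputable def schur (T : Matrix (Fin n) (Fin n) ℚ) (r : Fin n → ℤ) (m : ℕ) :
    Matrix (Fin n) (Fin n) ℝ :=
  shift (ratR T) (vecR r) (fun i => -(r i : ℝ) / (2 * m)) m

theorem det_blockMatrix (T : Matrix (Fin n) (Fin n) ℚ) (r : Fin n → ℤ) {m : ℕ} (hm : 0 < m) :
    (ratR (blockMatrix T r m)).det = m * (schur T r m).det := by
  have hm' : (m : ℝ) ≠ 0 := by exact_mod_cast hm.ne'
  have hb : ratR (blockMatrix T r m) = Matrix.fromBlocks (ratR T)
      (Matrix.of fun i _ => (r i : ℝ) / 2) (Matrix.of fun _ j => (r j : ℝ) / 2)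
      (Matrix.of fun _ _ : Unit => (m : ℝ)) := by
    ext (i | i) (j | j) <;> simp [ratR, blockMatrix]
  have hu : IsUnit (Matrix.of fun _ _ : Unit => (m : ℝ)) := by
    rw [Matrix.isUnit_iff_isUnit_det]
    simp [hm']
  have hinv : (Matrix.of fun _ _ : Unit => (m : ℝ))⁻¹ = Matrix.of fun _ _ : Unit => (m : ℝ)⁻¹ := by
    refine Matrix.inv_eq_left_inv ?_
    ext i j
    simp [Matrix.mul_apply, hm']
  let _ := hu.invertible
  rw [hb, Matrix.det_fromBlocks₂₂, Matrix.invOf_eq_nonsing_inv, hinv]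
  have hd1 : (Matrix.of fun _ _ : Unit => (m : ℝ)).det = m := by simp
  rw [hd1]
  congr 2
  ext i j
  simp [schur, shift, Matrix.mul_apply]
  field_simp
  ring

/-- The coefficients are bounded by a power of the discriminant. -/
theorem coeff_le_det {κ : ℤ} {m : ℕ} {φ : Matrix (Fin n) (Fin n) ℂ → (Fin n → ℂ) → ℂ}
    {c : Matrix (Fin n) (Fin n) ℚ → (Fin n → ℤ) → ℂ} (hc : HasJacobiFourierExpansion m φ c) {B : ℝ}
    (hB : ∀ τ ∈ siegelUpperHalfSpace n, BoundedAt κ m φ ⊤ B τ)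
    (T : HalfInt n) (r : Fin n → ℤ) (h : (ratR (blockMatrix T.1 r m)).PosDef) :
    ‖c T.1 r‖ ≤ B * (schur T.1 r m).det ^ ((κ : ℝ) / 4) * Real.exp (2 * Real.pi * n) := by
  have hDp : (schur T.1 r m).PosDef := shift_posDef T r _ m h
  -- This l completes the square, so the shifted matrix is the Schur complement D; then y = D⁻¹
  -- makes the trace equal to n.
  have h1 := coeff_le_of_boundedAt hc hB hDp.inv (fun i => -(r i : ℝ) / (2 * m)) T r
  rw [← schur, Matrix.mul_nonsing_inv _ ((Matrix.isUnit_iff_isUnit_det _).1 hDp.isUnit),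
    Matrix.trace_one, Fintype.card_fin, Matrix.det_nonsing_inv, Ring.inverse_eq_inv',
    Real.inv_rpow hDp.det_pos.le, Real.rpow_neg hDp.det_pos.le, inv_inv] at h1
  exact h1

/-- Let y = a·1 with a → 0: in negative weight the power of det y tends to 0 while the exponential
stays bounded. -/
theorem coeff_eq_zero_of_neg (hn : 1 ≤ n) {κ : ℤ} (hκ : κ < 0) {m : ℕ}
    {φ : Matrix (Fin n) (Fin n) ℂ → (Fin n → ℂ) → ℂ}
    {c : Matrix (Fin n) (Fin n) ℚ → (Fin n → ℤ) → ℂ} (hc : HasJacobiFourierExpansion m φ c) {B : ℝ}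
    (hB : ∀ τ ∈ siegelUpperHalfSpace n, BoundedAt κ m φ ⊤ B τ)
    (T : HalfInt n) (r : Fin n → ℤ) : c T.1 r = 0 := by
  have hκ' : (κ : ℝ) < 0 := by exact_mod_cast hκ
  have hs : 0 < (n : ℝ) * -((κ : ℝ) / 4) := by
    have : (1 : ℝ) ≤ n := by exact_mod_cast hn
    nlinarith
  have h1 : ∀ a : ℝ, 0 < a → ‖c T.1 r‖ ≤ B * a ^ ((n : ℝ) * -((κ : ℝ) / 4)) *
      Real.exp (2 * Real.pi * (a * (ratR T.1).trace)) := by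
    intro a ha
    have h := coeff_le_of_boundedAt hc hB (smul_one_posDef ha) 0 T r
    rw [shift_zero, Matrix.mul_smul, mul_one, Matrix.trace_smul, smul_eq_mul, Matrix.det_smul,
      Matrix.det_one, mul_one, Fintype.card_fin, ← Real.rpow_natCast_mul ha.le] at h
    exact h
  have h2 : Filter.Tendsto (fun a : ℝ => B * a ^ ((n : ℝ) * -((κ : ℝ) / 4)) *
      Real.exp (2 * Real.pi * (a * (ratR T.1).trace))) (nhdsWithin 0 (Set.Ioi 0)) (nhds 0) := by
    have hcont : ContinuousAt (fun a : ℝ => B * a ^ ((n : ℝ) * -((κ : ℝ) / 4)) *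
      Real.exp (2 * Real.pi * (a * (ratR T.1).trace))) 0 := by
      refine ContinuousAt.mul (continuousAt_const.mul ?_) (by fun_prop)
      exact Real.continuousAt_rpow_const _ _ (Or.inr hs.le)
    have := hcont.tendsto
    simp only [Real.zero_rpow hs.ne', mul_zero, zero_mul] at this
    exact this.mono_left nhdsWithin_le_nhds
  have h3 : ‖c T.1 r‖ ≤ 0 := ge_of_tendsto h2
    (Filter.eventually_of_mem self_mem_nhdsWithin fun a ha => h1 a ha)
  simpa using h3

end FixedIndex

/-! ### Summability over half-integral matrices -/

section Summation

theorem summable_prod_pi {J : Type} [Fintype J] [DecidableEq J] {X : Type} {f : X → ℝ}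
    (hf0 : ∀ x, 0 ≤ f x) (hf : Summable f) : Summable fun k : J → X => ∏ j, f (k j) := by
  classical
  refine summable_of_sum_le (c := ∏ _j : J, ∑' x, f x)
    (fun k => Finset.prod_nonneg fun j _ => hf0 _) fun u => ?_
  have hsub : u ⊆ Fintype.piFinset fun j => u.image fun k => k j := fun k hk =>
    Fintype.mem_piFinset.2 fun j => Finset.mem_image_of_mem _ hk
  calc ∑ k ∈ u, ∏ j, f (k j) ≤
      ∑ k ∈ Fintype.piFinset fun j => u.image fun k => k j, ∏ j, f (k j) :=
        Finset.sum_le_sum_of_subset_of_nonneg hsub fun k _ _ => Finset.prod_nonneg fun j _ => hf0 _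
    _ = ∏ j, ∑ x ∈ u.image fun k => k j, f x := (Finset.prod_univ_sum _ _).symm
    _ ≤ _ := Finset.prod_le_prod (fun j _ => Finset.sum_nonneg fun x _ => hf0 x) fun j _ =>
        hf.sum_le_tsum _ fun x _ => hf0 x

theorem summable_exp_neg_abs {a : ℝ} (ha : 0 < a) :
    Summable fun k : ℤ => Real.exp (-(a * |(k : ℝ)|)) := by
  have h : Summable fun k : ℕ => Real.exp (-(a * |((k : ℤ) : ℝ)|)) := by
    refine (Real.summable_exp_nat_mul_iff.2 (neg_lt_zero.2 ha)).congr fun k => ?_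
    congr 1
    rw [Int.cast_natCast, Nat.abs_cast]
    ring
  refine Summable.of_nat_of_neg h ?_
  refine h.congr fun k => ?_
  simp

variable {n : ℕ}

open Classical in
/-- The weight `exp(-b tr t)` on positive definite half-integral matrices. -/
noncomputable def weight (b : ℝ) (t : HalfInt n) : ℝ :=
  if (ratR t.1).PosDef then Real.exp (-(b * (ratR t.1).trace)) else 0

theorem weight_nonneg (b : ℝ) (t : HalfInt n) : 0 ≤ weight b t := by
  rw [weight]; split_ifs <;> positivity

theorem summable_weight {b : ℝ} (hb : 0 < b) : Summable (weight (n := n) b) := by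
  -- Semidefiniteness gives Σ|2t_ij| ≤ 2n tr t, so the weight is below a product of geometric terms;
  -- the added 1 avoids a zero denominator at n = 0.
  set a : ℝ := b / (2 * n + 1) with ha
  have ha0 : 0 < a := by positivity
  have h := (summable_prod_pi (J := Fin n × Fin n) (fun k => (Real.exp_pos _).le)
    (summable_exp_neg_abs ha0)).comp_injective (freq_injective (n := n))
  refine Summable.of_nonneg_of_le (weight_nonneg b) (fun t => ?_) h
  rw [weight]
  split_ifs with ht
  swap
  · exact Finset.prod_nonneg fun j _ => (Real.exp_pos _).le
  simp only [Function.comp]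
  rw [← Real.exp_sum]
  gcongr
  rw [Finset.sum_neg_distrib, neg_le_neg_iff, ← Finset.mul_sum]
  have htr : 0 ≤ (ratR t.1).trace := ht.posSemidef.trace_nonneg
  have hle : ∑ p : Fin n × Fin n, |(freq t p : ℝ)| ≤ 2 * n * (ratR t.1).trace := by
    have h1 : ∀ p : Fin n × Fin n, |(freq t p : ℝ)| ≤ ratR t.1 p.1 p.1 + ratR t.1 p.2 p.2 := by
      intro p
      have h2 : (freq t p : ℝ) = 2 * ratR t.1 p.1 p.2 := by
        have := congrArg (fun q : ℚ => (q : ℝ)) (freq_cast t p)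
        simpa using this
      rw [h2, abs_mul, abs_two]
      linarith [abs_apply_le_of_posSemidef ht.posSemidef p.1 p.2]
    refine (Finset.sum_le_sum fun p _ => h1 p).trans_eq ?_
    rw [Fintype.sum_prod_type]
    simp only [Finset.sum_add_distrib, Finset.sum_const, Finset.card_univ, Fintype.card_fin,
      nsmul_eq_mul, ← Finset.mul_sum]
    rw [Matrix.trace]
    simp only [Matrix.diag_apply]
    ring
  calc a * ∑ p : Fin n × Fin n, |(freq t p : ℝ)| ≤ a * (2 * n * (ratR t.1).trace) := by gcongr
    _ ≤ a * ((2 * n + 1) * (ratR t.1).trace) := by gcongr; linarith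
    _ = _ := by rw [ha]; field_simp

/-- Terms in S are bounded by α and the others by b·w, whose total mass outside S is at most ε. -/
theorem norm_le_of_finite_of_tail {X : Type} {f : X → ℂ} {s : ℂ} (hf : HasSum f s) {w : X → ℝ}
    (hw : Summable w) (S : Finset X) {ε b α : ℝ} (hb0 : 0 ≤ b)
    (hε : ∑' x, w x - ε ≤ ∑ x ∈ S, w x) (hb : ∀ x, ‖f x‖ ≤ b * w x) (hα : ∀ x ∈ S, ‖f x‖ ≤ α) :
    ‖s‖ ≤ b * ε + S.card * α := by
  classical
  have h1 : HasSum (fun x => if x ∈ S then α - b * w x else 0) (∑ x ∈ S, (α - b * w x)) := by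
    rw [← Finset.sum_congr rfl fun x hx => if_pos hx]
    exact hasSum_sum_of_ne_finset_zero fun x hx => if_neg hx
  have h2 := hf.norm_le_of_bounded ((hw.hasSum.mul_left b).add h1) fun x => by
    split_ifs with hx
    · linarith [hα x hx]
    · linarith [hb x]
  refine h2.trans ?_
  rw [Finset.sum_sub_distrib, ← Finset.mul_sum]
  simp only [Finset.sum_const, nsmul_eq_mul]
  nlinarith

theorem exists_finset_tail {X : Type} {w : X → ℝ} (hw : Summable w) {ε : ℝ} (hε : 0 < ε) :
    ∃ S : Finset X, ∑' x, w x - ε ≤ ∑ x ∈ S, w x := by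
  have h : ∀ᶠ S : Finset X in Filter.atTop, ∑' x, w x - ε < ∑ x ∈ S, w x :=
    hw.hasSum.eventually (lt_mem_nhds (by linarith))
  obtain ⟨S, hS⟩ := h.exists
  exact ⟨S, hS.le⟩

end Summation

/-! ### A fixed Fourier coefficient as the index grows -/

section Coefficients

variable {n : ℕ}

theorem schur_apply_self_add (T : Matrix (Fin n) (Fin n) ℚ) (r : Fin n → ℤ) {m : ℕ} (hm : 0 < m)
    (l : Fin n → ℝ) (i : Fin n) :
    schur T r m i i + (r i + 2 * m * l i) ^ 2 / (4 * m) = shift (ratR T) (vecR r) l m i i := by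
  have hm' : (m : ℝ) ≠ 0 := by exact_mod_cast hm.ne'
  rw [schur, shift_apply_self, shift_apply_self]
  simp only [vecR]
  field_simp
  ring

theorem ratR_apply_self_of_exponentH {N : ℕ} (hN : 0 < N) {A : Fin n → ℤ} {m : ℕ}
    {p : HalfInt n × (Fin n → ℤ)} {t : HalfInt n} (h : exponentH N A m p = t) (i : Fin n) :
    ratR t.1 i i = (N : ℝ) ^ 2 * shift (ratR p.1.1) (vecR p.2) (divVecR N A) m i i := by
  rw [← h, exponentH, ratR_exponent hN]
  rfl

theorem schur_apply_self_add_le {N : ℕ} (hN : 0 < N) {A : Fin n → ℤ} {m : ℕ} (hm : 0 < m)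
    {p : HalfInt n × (Fin n → ℤ)} {t : HalfInt n} (h : exponentH N A m p = t)
    (hp : (ratR (blockMatrix p.1.1 p.2 m)).PosDef) (i : Fin n) :
    schur p.1.1 p.2 m i i + (p.2 i + 2 * m * divVecR N A i) ^ 2 / (4 * m) ≤ ratR t.1 i i := by
  rw [schur_apply_self_add _ _ hm, ratR_apply_self_of_exponentH hN h]
  have h0 : 0 ≤ shift (ratR p.1.1) (vecR p.2) (divVecR N A) m i i :=
    (shift_posDef p.1 p.2 _ m hp).posSemidef.diag_nonneg
  have hN1 : (1 : ℝ) ≤ N := by exact_mod_cast hN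
  have : (1 : ℝ) ≤ (N : ℝ) ^ 2 := one_le_pow₀ hN1
  nlinarith

theorem index_pos_of_posDef {T : Matrix (Fin n) (Fin n) ℚ} {r : Fin n → ℤ} {m : ℕ}
    (h : (ratR (blockMatrix T r m)).PosDef) : 0 < m := by
  have := h.diag_pos (i := Sum.inr ())
  simpa [blockMatrix] using this

variable {κ : ℤ} {φ : ℕ → Matrix (Fin n) (Fin n) ℂ → (Fin n → ℂ) → ℂ}
  {c : Matrix (Fin n ⊕ Unit) (Fin n ⊕ Unit) ℚ → ℂ}

/-- The symmetry trades the index m for an index m' bounded in terms of t alone, so finitely many of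
the constants B(m') suffice. The dependence on m enters only through the determinant of the block
matrix, which is m times a Schur determinant bounded by t. -/
theorem exists_coeff_le (hn : 1 ≤ n) (hκ : 0 ≤ κ) (hj : ∀ m, IsJacobiForm n κ m (φ m))
    (hc : FJCoeff n κ φ c) (hcusp : IsCuspidal φ) {N : ℕ} (hN : 0 < N) (t : HalfInt n) :
    ∃ K : ℝ, 0 ≤ K ∧ ∀ m : ℕ, 0 < m → ∀ (A : Fin n → ℤ) (p : HalfInt n × (Fin n → ℤ)),
      exponentH N A m p = t → (ratR (blockMatrix p.1.1 p.2 m)).PosDef →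
        ‖c (blockMatrix p.1.1 p.2 m)‖ ≤ K * (m : ℝ) ^ ((κ : ℝ) / 4) := by
  have hex : ∀ m : ℕ, ∃ B : ℝ, 0 ≤ B ∧ (0 < m → ∀ τ ∈ siegelUpperHalfSpace n,
      BoundedAt κ m (φ m) ⊤ B τ) := by
    intro m
    rcases Nat.eq_zero_or_pos m with h | h
    · exact ⟨0, le_rfl, fun h' => absurd h h'.ne'⟩
    · obtain ⟨B, hB0, hB⟩ := exists_boundedAt hj hc hcusp h ⊤
      exact ⟨B, hB0, fun _ => hB⟩
  choose B hB0 hB using hex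
  set i₀ : Fin n := ⟨0, hn⟩
  set M : ℕ := ⌊ratR t.1 i₀ i₀⌋₊
  have hκ4 : (0 : ℝ) ≤ (κ : ℝ) / 4 := by
    have : (0 : ℝ) ≤ κ := by exact_mod_cast hκ
    positivity
  set X : ℝ := n.factorial * (ratR t.1).trace ^ n with hX
  refine ⟨(∑ k ∈ Finset.range (M + 1), B k) * |X| ^ ((κ : ℝ) / 4) * Real.exp (2 * Real.pi * n),
    ?_, fun m hm A p hp hpd => ?_⟩
  · have := Finset.sum_nonneg fun k (_ : k ∈ Finset.range (M + 1)) => hB0 k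
    positivity
  have hm' : (0 : ℝ) < m := by exact_mod_cast hm
  have hNne : (N : ℝ) ≠ 0 := by exact_mod_cast hN.ne'
  -- N times (e_i, λ_i) with λ = A/N. By the pullback description of the exponent, the block form
  -- takes the value t_ii there.
  set v : Fin n ⊕ Unit → ℤ := Sum.elim (Pi.single i₀ (N : ℤ)) fun _ => A i₀ with hv
  have hv0 : v ≠ 0 := by
    intro h0
    have := congrFun h0 (Sum.inl i₀)
    simp [hv, hN.ne'] at this
  obtain ⟨T, r, m', h1, h2, h3, h4⟩ := hc.exists_equiv (halfIntegral_blockMatrix p.1 p.2 m)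
    hpd.posSemidef hv0
  have hpd' := h4 hpd
  have hm'0 : 0 < m' := index_pos_of_posDef hpd'
  have hm'1 : (1 : ℝ) ≤ m' := by exact_mod_cast hm'0
  have hvR : (fun i => (v i : ℝ)) = Sum.elim (Pi.single i₀ (N : ℝ)) fun _ => (A i₀ : ℝ) := by
    ext (i | i)
    · by_cases hi : i = i₀
      · subst hi; simp [hv]
      · simp [hv, hi]
    · simp [hv]
  have hquad : quad (ratR (blockMatrix p.1.1 p.2 m)) (fun i => (v i : ℝ)) = ratR t.1 i₀ i₀ := by
    rw [hvR, quad_blockMatrix_single, ratR_apply_self_of_exponentH hN hp, shift_apply_self]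
    simp only [divVecR, vecR, Matrix.map_apply]
    field_simp
  rw [hquad] at h2
  have hm'M : m' ∈ Finset.range (M + 1) := by
    rw [Finset.mem_range, Nat.lt_succ_iff]
    exact Nat.le_floor h2
  have hBle : B m' ≤ ∑ k ∈ Finset.range (M + 1), B k :=
    Finset.single_le_sum (f := B) (fun k _ => hB0 k) hm'M
  have hcoeff := coeff_le_det (hc.expansion m') (hB m' hm'0) T r hpd'
  have hS' : (schur T.1 r m').PosDef := shift_posDef T r _ m' hpd'
  have hS : (schur p.1.1 p.2 m).PosDef := shift_posDef p.1 p.2 _ m hpd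
  have hSX : (schur p.1.1 p.2 m).det ≤ |X| := by
    refine le_trans (det_le_trace_pow hS.posSemidef) (le_trans ?_ (le_abs_self X))
    have htr : (schur p.1.1 p.2 m).trace ≤ (ratR t.1).trace := by
      refine Finset.sum_le_sum fun i _ => ?_
      have := schur_apply_self_add_le hN hm hp hpd i
      have h0 : 0 ≤ ((p.2 i : ℝ) + 2 * m * divVecR N A i) ^ 2 / (4 * m) := by positivity
      simp only [Matrix.diag_apply]
      linarith
    have := hS.posSemidef.trace_nonneg
    rw [hX]
    gcongr
  -- Equality of the block determinants reads m' det D' = m det D, and m' ≥ 1.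
  have hdet : (schur T.1 r m').det ≤ m * |X| := by
    rw [det_blockMatrix _ _ hm, det_blockMatrix _ _ hm'0] at h3
    have e1 : (schur T.1 r m').det ≤ m' * (schur T.1 r m').det :=
      le_mul_of_one_le_left hS'.det_pos.le hm'1
    have e2 : m * (schur p.1.1 p.2 m).det ≤ m * |X| := by gcongr
    linarith
  rw [h1]
  calc _ ≤ _ := hcoeff
    _ ≤ (∑ k ∈ Finset.range (M + 1), B k) * (m * |X|) ^ ((κ : ℝ) / 4) *
        Real.exp (2 * Real.pi * n) := by
        have := hS'.det_pos.le
        have := (hB0 m').trans hBle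
        gcongr
    _ = _ := by rw [Real.mul_rpow hm'.le (abs_nonneg _)]; ring

/-- Once the exponent is fixed, r determines T, so the terms of a torsion coefficient can be counted
by r. -/
theorem exponentH_injective_snd {N : ℕ} (hN : 0 < N) (A : Fin n → ℤ) (m : ℕ) (t : HalfInt n) :
    Function.Injective fun p : {p : HalfInt n × (Fin n → ℤ) // exponentH N A m p = t} => p.1.2 := by
  rintro ⟨⟨T, r⟩, h⟩ ⟨⟨T', r'⟩, h'⟩ hr
  simp only at hr
  subst hr
  have hN' : (N : ℚ) ≠ 0 := by exact_mod_cast hN.ne'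
  have : T = T' := by
    apply Subtype.ext
    ext i j
    have h1 := congrFun (congrFun (congrArg Subtype.val (h.trans h'.symm)) i) j
    simp only [exponentH, exponent, Matrix.of_apply] at h1
    have h2 : (N : ℚ) ^ 2 * T.1 i j = (N : ℚ) ^ 2 * T'.1 i j := by linarith
    exact mul_left_cancel₀ (pow_ne_zero 2 hN') h2
  subst this
  rfl

theorem card_Icc_ceil_floor_le (x : ℝ) {ρ : ℝ} (hρ : 0 ≤ ρ) :
    ((Finset.Icc ⌈x - ρ⌉ ⌊x + ρ⌋).card : ℝ) ≤ 2 * ρ + 1 := by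
  rw [Int.card_Icc]
  have h1 := Int.le_ceil (x - ρ)
  have h2 := Int.floor_le (x + ρ)
  rcases le_total 0 (⌊x + ρ⌋ + 1 - ⌈x - ρ⌉) with h | h
  · have : (((⌊x + ρ⌋ + 1 - ⌈x - ρ⌉).toNat : ℤ) : ℝ) = ((⌊x + ρ⌋ + 1 - ⌈x - ρ⌉ : ℤ) : ℝ) := by
      rw [Int.toNat_of_nonneg h]
    rw [← Int.cast_natCast, this]
    push_cast
    linarith
  · rw [Int.toNat_of_nonpos h]
    simp only [Nat.cast_zero]
    linarith

theorem norm_tsum_le_card_mul {X : Type} {f : X → ℂ} (S : Finset X) (hS : ∀ x ∉ S, f x = 0)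
    {K : ℝ} (hK : ∀ x, ‖f x‖ ≤ K) : ‖∑' x, f x‖ ≤ S.card * K := by
  rw [tsum_eq_sum hS]
  refine (norm_sum_le_of_le _ fun x _ => hK x).trans_eq ?_
  simp

theorem exists_torsionCoeff_le (hn : 1 ≤ n) (hκ : 0 ≤ κ) (hj : ∀ m, IsJacobiForm n κ m (φ m))
    (hc : FJCoeff n κ φ c) (hcusp : IsCuspidal φ) {N : ℕ} (hN : 0 < N) (t : HalfInt n) :
    ∃ K : ℝ, 0 ≤ K ∧ ∀ m : ℕ, 0 < m → ∀ A U : Fin n → ℤ,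
      ‖torsionCoeff N (fun T r => c (blockMatrix T r m)) A U m t‖ ≤
        K * (m : ℝ) ^ ((κ : ℝ) / 2 + (n : ℝ) / 2) := by
  obtain ⟨K, hK0, hK⟩ := exists_coeff_le hn hκ hj hc hcusp hN t
  set s : ℝ := Real.sqrt |(ratR t.1).trace| with hs
  refine ⟨(4 * s + 1) ^ n * K, by positivity, fun m hm A U => ?_⟩
  have hm' : (0 : ℝ) < m := by exact_mod_cast hm
  have hm1 : (1 : ℝ) ≤ m := by exact_mod_cast hm
  have hκ4 : (0 : ℝ) ≤ (κ : ℝ) := by exact_mod_cast hκ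
  -- A contributing r satisfies (r_i + 2mλ_i)² ≤ 4m t_ii ≤ ρ², which leaves O(√m) values per
  -- coordinate.
  set ρ : ℝ := 2 * (Real.sqrt m * s) with hρ
  have hρ0 : 0 ≤ ρ := by positivity
  set R : Finset (Fin n → ℤ) := Fintype.piFinset fun i =>
    Finset.Icc ⌈-(2 * m * divVecR N A i) - ρ⌉ ⌊-(2 * m * divVecR N A i) + ρ⌋ with hR
  have hsq : 1 ≤ Real.sqrt m := Real.one_le_sqrt.2 hm1
  have hcard : (R.card : ℝ) ≤ ((4 * s + 1) * Real.sqrt m) ^ n := by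
    rw [hR, Fintype.card_piFinset]
    push_cast
    calc _ ≤ ∏ _i : Fin n, ((4 * s + 1) * Real.sqrt m) := by
          refine Finset.prod_le_prod (fun i _ => by positivity) fun i _ =>
            (card_Icc_ceil_floor_le _ hρ0).trans ?_
          rw [hρ]; linarith
      _ = _ := by simp
  set Q := R.preimage (fun p : {p : HalfInt n × (Fin n → ℤ) // exponentH N A m p = t} => p.1.2)
    (exponentH_injective_snd hN A m t).injOn with hQ
  have hQcard : Q.card ≤ R.card := by
    refine Finset.card_le_card_of_injOn (fun p => p.1.2) (fun p hp => ?_)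
      (exponentH_injective_snd hN A m t).injOn
    simpa [hQ] using hp
  have hpd : ∀ p : HalfInt n × (Fin n → ℤ), c (blockMatrix p.1.1 p.2 m) ≠ 0 →
      (ratR (blockMatrix p.1.1 p.2 m)).PosDef := fun p hp =>
    hc.posDef hcusp (halfIntegral_blockMatrix p.1 p.2 m) ((hc.expansion m).1 p.1 p.2 hp) hp
  have hmain : ‖torsionCoeff N (fun T r => c (blockMatrix T r m)) A U m t‖ ≤
      Q.card * (K * (m : ℝ) ^ ((κ : ℝ) / 4)) := by
    refine norm_tsum_le_card_mul Q (fun p hp => ?_) fun p => ?_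
    · by_contra hne
      have hp0 := hpd p.1 (left_ne_zero_of_mul hne)
      apply hp
      rw [hQ, Finset.mem_preimage, hR, Fintype.mem_piFinset]
      intro i
      have h1 := schur_apply_self_add_le hN hm p.2 hp0 i
      have h2 : 0 ≤ schur p.1.1.1 p.1.2 m i i :=
        (shift_posDef p.1.1 p.1.2 _ m hp0).posSemidef.diag_nonneg
      have htpd : (ratR t.1).PosDef := by
        have := exponent_posDef hN A m p.1 hp0
        rwa [p.2] at this
      have h3 : ratR t.1 i i ≤ |(ratR t.1).trace| :=
        (Finset.single_le_sum (f := fun i => ratR t.1 i i)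
          (fun j _ => htpd.posSemidef.diag_nonneg) (Finset.mem_univ i)).trans (le_abs_self _)
      have h4 : ((p.1.2 i : ℝ) + 2 * m * divVecR N A i) ^ 2 ≤ ρ ^ 2 := by
        have e1 : ((p.1.2 i : ℝ) + 2 * m * divVecR N A i) ^ 2 / (4 * m) ≤
          |(ratR t.1).trace| := by linarith
        rw [div_le_iff₀ (by positivity)] at e1
        rw [hρ, mul_pow, mul_pow, hs, Real.sq_sqrt hm'.le, Real.sq_sqrt (abs_nonneg _)]
        linarith
      have h5 := abs_le_of_sq_le_sq' h4 hρ0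
      rw [Finset.mem_Icc, Int.ceil_le, Int.le_floor]
      constructor <;> linarith [h5.1, h5.2]
    · rw [norm_mul, norm_e_intCast_dotProduct, mul_one]
      by_cases h0 : c (blockMatrix p.1.1.1 p.1.2 m) = 0
      · simp only [h0, norm_zero]; positivity
      · exact hK m hm A p.1 p.2 (hpd p.1 h0)
  -- The estimate found is m^{k/2 + n/2}; since m ≥ 1 and k ≥ 0 it is weakened to m^{k + n/2}.
  have hpow : (Real.sqrt m) ^ n * (m : ℝ) ^ ((κ : ℝ) / 4) ≤
      (m : ℝ) ^ ((κ : ℝ) / 2 + (n : ℝ) / 2) := by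
    rw [Real.sqrt_eq_rpow, ← Real.rpow_mul_natCast hm'.le, ← Real.rpow_add hm']
    refine Real.rpow_le_rpow_of_exponent_le hm1 ?_
    linarith
  calc _ ≤ _ := hmain
    _ ≤ ((4 * s + 1) * Real.sqrt m) ^ n * (K * (m : ℝ) ^ ((κ : ℝ) / 4)) := by
        gcongr
        exact le_trans (by exact_mod_cast hQcard) hcard
    _ = (4 * s + 1) ^ n * K * ((Real.sqrt m) ^ n * (m : ℝ) ^ ((κ : ℝ) / 4)) := by
        rw [mul_pow]; ring
    _ ≤ _ := by gcongr

end Coefficients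

/-! ### Self-improvement and the uniform bound -/

section Uniform

variable {n : ℕ} {κ : ℤ} {φ : ℕ → Matrix (Fin n) (Fin n) ℂ → (Fin n → ℂ) → ℂ}
  {c : Matrix (Fin n ⊕ Unit) (Fin n ⊕ Unit) ℚ → ℂ}

/-- The group `(1/N) ℤ`. -/
noncomputable def torsionGroup (N : ℕ) : AddSubgroup ℝ := AddSubgroup.zmultiples ((N : ℝ)⁻¹)

theorem divVecR_mem (N : ℕ) (A : Fin n → ℤ) (i : Fin n) : divVecR N A i ∈ torsionGroup N :=
  AddSubgroup.mem_zmultiples_iff.2 ⟨A i, by simp [divVecR, div_eq_mul_inv]⟩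

theorem exists_divVecR {N : ℕ} {l : Fin n → ℝ} (hl : ∀ i, l i ∈ torsionGroup N) :
    ∃ A : Fin n → ℤ, l = divVecR N A := by
  choose A hA using fun i => AddSubgroup.mem_zmultiples_iff.1 (hl i)
  exact ⟨A, funext fun i => by rw [← hA]; simp [divVecR, div_eq_mul_inv]⟩

theorem one_le_apply_self {t : HalfInt n} (ht : (ratR t.1).PosDef) (i : Fin n) :
    1 ≤ ratR t.1 i i := by
  obtain ⟨a, ha⟩ := t.2.2.1 i
  have h1 : ratR t.1 i i = a := by
    rw [show ratR t.1 i i = ((t.1 i i : ℚ) : ℝ) from rfl, ha]; simp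
  have h2 : 0 < ratR t.1 i i := ht.diag_pos
  rw [h1] at h2 ⊢
  exact_mod_cast h2

/-- Half of t_ii y_ii is bounded using t_ii ≥ 1, the other half using y_ii ≥ 1/2. Decay in y absorbs
the determinant, decay in t makes the series converge. -/
theorem trace_mul_ge_of_posDef {t : HalfInt n} (ht : (ratR t.1).PosDef) {c₀ : ℝ} (hc₀ : 0 < c₀)
    {y : Matrix (Fin n) (Fin n) ℝ} (hd : ∀ i, 1 / 2 ≤ y i i)
    (hq : ∀ x : Fin n → ℝ, c₀ * ∑ i, y i i * x i ^ 2 ≤ quad y x) :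
    c₀ / 2 * y.trace + c₀ / 4 * (ratR t.1).trace ≤ (ratR t.1 * y).trace := by
  refine le_trans ?_ (trace_mul_ge ht.posSemidef hq)
  have hi : ∀ i, y i i / 2 + ratR t.1 i i / 4 ≤ ratR t.1 i i * y i i := by
    intro i
    nlinarith [hd i, one_le_apply_self ht i]
  have hs := Finset.sum_le_sum fun i (_ : i ∈ Finset.univ) => hi i
  rw [Finset.sum_add_distrib, ← Finset.sum_div, ← Finset.sum_div] at hs
  have := mul_le_mul_of_nonneg_left hs hc₀.le
  calc _ = c₀ * (y.trace / 2 + (ratR t.1).trace / 4) := by ring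
    _ ≤ _ := this

theorem torsionCoeff_le_of_boundedAt (hc : FJCoeff n κ φ c) {N : ℕ} (hN : 0 < N) {m : ℕ} {B : ℝ}
    (hB : ∀ τ ∈ siegelUpperHalfSpace n, BoundedAt κ m (φ m) (torsionGroup N) B τ) {a : ℝ}
    (ha : 0 < a) (A U : Fin n → ℤ) (t : HalfInt n) :
    ‖torsionCoeff N (fun T r => c (blockMatrix T r m)) A U m t‖ ≤
      B * (a ^ n) ^ (-((κ : ℝ) / 4)) *
        Real.exp (2 * Real.pi * (a * (ratR t.1).trace / (N ^ 2 : ℕ))) := by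
  have hy := smul_one_posDef (n := n) ha
  have hdet : (a • (1 : Matrix (Fin n) (Fin n) ℝ)).det = a ^ n := by simp
  have h := siegel_coeff_le (M := N ^ 2) (pow_pos hN 2)
    (fun τ hτ => torsion_hasSum hN (hc.expansion m) hτ A U) hy
    (B := B * (a ^ n) ^ (-((κ : ℝ) / 4))) (fun x hx => ?_) t
  · simpa using h
  · have h1 := hB _ (mkTau_mem hx hy) (divVecR N A) (divVecR N U) (divVecR_mem N A)
      (divVecR_mem N U)
    rw [im_mkTau, hdet] at h1
    rw [Real.rpow_neg (by positivity), ← div_eq_mul_inv, le_div_iff₀ (by positivity)]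
    exact h1

/-- The self-improving property of bounds for the specializations of `φ m`. -/
theorem exists_boundedAt_half (hn : 1 ≤ n) (hκ : 0 ≤ κ) (hj : ∀ m, IsJacobiForm n κ m (φ m))
    (hc : FJCoeff n κ φ c) (hcusp : IsCuspidal φ) {N : ℕ} (hN : 0 < N) :
    ∃ C : ℝ, 0 < C ∧ ∀ m : ℕ, 0 < m → ∀ B : ℝ, 0 ≤ B →
      (∀ τ ∈ siegelUpperHalfSpace n, BoundedAt κ m (φ m) (torsionGroup N) B τ) →
      ∀ τ ∈ siegelUpperHalfSpace n, BoundedAt κ m (φ m) (torsionGroup N)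
        (B / 2 + C * (m : ℝ) ^ ((κ : ℝ) / 2 + (n : ℝ) / 2)) τ := by
  obtain ⟨c₀, hc₀, hind⟩ := siegel_induction n
  have hN' : (0 : ℝ) < (N ^ 2 : ℕ) := by exact_mod_cast pow_pos hN 2
  have hpi := Real.pi_pos
  obtain ⟨K₁, hK₁, hKy⟩ := exists_det_rpow_le (n := n) ((κ : ℝ) / 4)
    (a := Real.pi * c₀ / (N ^ 2 : ℕ)) (by positivity) hc₀
  -- Coefficients are estimated at y = (c₀/8)·1, where their growth in tr t is exactly half of the
  -- decay on the Siegel set; the other half remains as the summable weight.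
  set K₀ : ℝ := ((c₀ / 8) ^ n) ^ (-((κ : ℝ) / 4)) with hK₀
  have hK₀pos : 0 < K₀ := by positivity
  have hw := summable_weight (n := n) (b := Real.pi * c₀ / (4 * (N ^ 2 : ℕ))) (by positivity)
  -- This tolerance makes the tail B K₀ K₁ ε equal to B/2. S is fixed before m and the torsion
  -- point, so its coefficient bounds are uniform in both.
  obtain ⟨S, hS⟩ := exists_finset_tail hw (ε := 1 / (2 * (K₀ * K₁))) (by positivity)
  choose K hK0 hK using fun t => exists_torsionCoeff_le hn hκ hj hc hcusp hN t
  have hsum : 0 ≤ ∑ t ∈ S, K t := Finset.sum_nonneg fun t _ => hK0 t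
  refine ⟨S.card * (K₁ * ∑ t ∈ S, K t) + 1, by positivity, fun m hm B hB0 hB => hind _
    (fun g τ hτ h => h.of_moebius (hj m) g hτ) fun τ hτ hd hq l u hl hu => ?_⟩
  obtain ⟨A, rfl⟩ := exists_divVecR hl
  obtain ⟨U, rfl⟩ := exists_divVecR hu
  set y := τ.map Complex.im with hy
  set E : ℝ := (m : ℝ) ^ ((κ : ℝ) / 2 + (n : ℝ) / 2) with hE
  have hE0 : 0 ≤ E := by positivity
  have hdet0 : 0 ≤ y.det ^ ((κ : ℝ) / 4) := Real.rpow_nonneg hτ.2.det_pos.le _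
  have hdetle := hKy y hτ.2 hd hq
  have hf := (torsion_hasSum hN (hc.expansion m) hτ A U).mul_right
    ((y.det ^ ((κ : ℝ) / 4) : ℝ) : ℂ)
  set a := torsionCoeff N (fun T r => c (blockMatrix T r m)) A U m with ha
  have hnorm : ∀ t : HalfInt n, ‖a t * e (traceMul t.1 τ / (N ^ 2 : ℕ)) *
      ((y.det ^ ((κ : ℝ) / 4) : ℝ) : ℂ)‖ ≤
      ‖a t‖ * (K₁ * Real.exp (-(2 * (Real.pi * c₀ / (4 * (N ^ 2 : ℕ)) * (ratR t.1).trace)))) := by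
    intro t
    by_cases h0 : a t = 0
    · simp [h0]
    have ht := torsionCoeff_posDef hc hcusp hN A U m t h0
    have he : ‖e (traceMul t.1 τ / (N ^ 2 : ℕ))‖ =
        Real.exp (-(2 * Real.pi * ((ratR t.1 * y).trace / (N ^ 2 : ℕ)))) := by
      rw [norm_e, traceMul_eq_traceC, Complex.div_natCast_im, traceC_im]
    rw [norm_mul, norm_mul, he, Complex.norm_real, Real.norm_of_nonneg hdet0, mul_assoc]
    refine mul_le_mul_of_nonneg_left ?_ (norm_nonneg _)
    have htr := trace_mul_ge_of_posDef (y := y) ht hc₀ hd hq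
    calc _ ≤ Real.exp (-(2 * Real.pi * ((ratR t.1 * y).trace / (N ^ 2 : ℕ)))) *
          (K₁ * Real.exp (Real.pi * c₀ / (N ^ 2 : ℕ) * y.trace)) := by gcongr
      _ = K₁ * Real.exp (-(2 * Real.pi * ((ratR t.1 * y).trace / (N ^ 2 : ℕ))) +
          Real.pi * c₀ / (N ^ 2 : ℕ) * y.trace) := by rw [Real.exp_add]; ring
      _ ≤ _ := by
          gcongr
          have : 2 * Real.pi / (N ^ 2 : ℕ) * (c₀ / 2 * y.trace + c₀ / 4 * (ratR t.1).trace) ≤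
              2 * Real.pi / (N ^ 2 : ℕ) * (ratR t.1 * y).trace := by gcongr
          have e1 : 2 * Real.pi / (N ^ 2 : ℕ) * (c₀ / 2 * y.trace + c₀ / 4 * (ratR t.1).trace) =
              Real.pi * c₀ / (N ^ 2 : ℕ) * y.trace +
                2 * (Real.pi * c₀ / (4 * (N ^ 2 : ℕ)) * (ratR t.1).trace) := by
            field_simp
          have e2 : 2 * Real.pi * ((ratR t.1 * y).trace / (N ^ 2 : ℕ)) =
              2 * Real.pi / (N ^ 2 : ℕ) * (ratR t.1 * y).trace := by ring
          rw [e2]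
          linarith
  have h := norm_le_of_finite_of_tail hf hw S (b := B * (K₀ * K₁)) (α := K₁ * (∑ t ∈ S, K t) * E)
    (by positivity) hS (fun t => ?_) fun t ht => ?_
  · rw [norm_mul, Complex.norm_real, Real.norm_of_nonneg hdet0] at h
    refine h.trans ?_
    have e1 : B * (K₀ * K₁) * (1 / (2 * (K₀ * K₁))) = B / 2 := by field_simp
    rw [e1]
    linarith
  · by_cases h0 : a t = 0
    · rw [h0, zero_mul, zero_mul, norm_zero]
      have := weight_nonneg (Real.pi * c₀ / (4 * (N ^ 2 : ℕ))) t
      positivity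
    have ht := torsionCoeff_posDef hc hcusp hN A U m t h0
    refine (hnorm t).trans ?_
    have h1 := torsionCoeff_le_of_boundedAt hc hN hB (a := c₀ / 8) (by positivity) A U t
    rw [← hK₀, ← ha] at h1
    rw [weight, if_pos ht]
    calc _ ≤ B * K₀ * Real.exp (2 * Real.pi * (c₀ / 8 * (ratR t.1).trace / (N ^ 2 : ℕ))) *
          (K₁ * Real.exp (-(2 * (Real.pi * c₀ / (4 * (N ^ 2 : ℕ)) * (ratR t.1).trace)))) := by
          gcongr
      _ = B * (K₀ * K₁) * (Real.exp (2 * Real.pi * (c₀ / 8 * (ratR t.1).trace / (N ^ 2 : ℕ))) *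
          Real.exp (-(2 * (Real.pi * c₀ / (4 * (N ^ 2 : ℕ)) * (ratR t.1).trace)))) := by ring
      _ = _ := by
          rw [← Real.exp_add]
          congr 2
          field_simp
          ring
  · refine (hnorm t).trans ?_
    have h1 : ‖a t‖ ≤ (∑ t ∈ S, K t) * E := (hK t m hm A U).trans (by
      gcongr
      exact Finset.single_le_sum (f := K) (fun k _ => hK0 k) ht)
    by_cases h0 : a t = 0
    · rw [h0, norm_zero, zero_mul]
      positivity
    have htpd := torsionCoeff_posDef hc hcusp hN A U m t h0
    have h2 : Real.exp (-(2 * (Real.pi * c₀ / (4 * (N ^ 2 : ℕ)) * (ratR t.1).trace))) ≤ 1 := by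
      have := htpd.posSemidef.trace_nonneg
      rw [Real.exp_le_one_iff, neg_nonpos]
      positivity
    calc _ ≤ (∑ t ∈ S, K t) * E * (K₁ * 1) := by gcongr
      _ = _ := by ring

/-- Iterating B ↦ B/2 + C E from the finite but uncontrolled bound at index m makes that initial
bound decay geometrically and leaves 2C E. -/
theorem exists_boundedAt_uniform (hn : 1 ≤ n) (hκ : 0 ≤ κ) (hj : ∀ m, IsJacobiForm n κ m (φ m))
    (hc : FJCoeff n κ φ c) (hcusp : IsCuspidal φ) {N : ℕ} (hN : 0 < N) :
    ∃ C : ℝ, 0 < C ∧ ∀ m : ℕ, 0 < m → ∀ τ ∈ siegelUpperHalfSpace n,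
      BoundedAt κ m (φ m) (torsionGroup N) (C * (m : ℝ) ^ ((κ : ℝ) / 2 + (n : ℝ) / 2)) τ := by
  obtain ⟨C, hC, hhalf⟩ := exists_boundedAt_half hn hκ hj hc hcusp hN
  refine ⟨2 * C, by positivity, fun m hm τ hτ l u hl hu => ?_⟩
  set E : ℝ := (m : ℝ) ^ ((κ : ℝ) / 2 + (n : ℝ) / 2) with hE
  have hE0 : 0 ≤ E := by positivity
  obtain ⟨B, hB0, hB⟩ := exists_boundedAt hj hc hcusp hm (torsionGroup N)
  have hk : ∀ k : ℕ, ∀ τ ∈ siegelUpperHalfSpace n,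
      BoundedAt κ m (φ m) (torsionGroup N) (B * (1 / 2) ^ k + 2 * C * E) τ := by
    intro k
    induction k with
    | zero =>
      intro τ hτ l u hl hu
      have := hB τ hτ l u hl hu
      have h0 : 0 ≤ 2 * C * E := by positivity
      rw [pow_zero, mul_one]
      linarith
    | succ k ih =>
      intro τ hτ l u hl hu
      refine (hhalf m hm _ (by positivity) ih τ hτ l u hl hu).trans_eq ?_
      rw [pow_succ]; ring
  have hlim : Filter.Tendsto (fun k : ℕ => B * (1 / 2 : ℝ) ^ k + 2 * C * E) Filter.atTop
      (nhds (B * 0 + 2 * C * E)) :=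
    ((tendsto_pow_atTop_nhds_zero_of_lt_one (by norm_num) (by norm_num)).const_mul B).add_const _
  rw [mul_zero, zero_add] at hlim
  exact ge_of_tendsto' hlim fun k => hk k τ hτ l u hl hu

theorem eta_eq_zero_of_neg (hn : 1 ≤ n) (hκ : κ < 0) (hj : ∀ m, IsJacobiForm n κ m (φ m))
    (hc : FJCoeff n κ φ c) (hcusp : IsCuspidal φ) {m : ℕ} (hm : 0 < m)
    {τ : Matrix (Fin n) (Fin n) ℂ} (hτ : τ ∈ siegelUpperHalfSpace n) (l u : Fin n → ℝ) :
    eta m (φ m) (vecC l) (vecC u) τ = 0 := by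
  obtain ⟨B, -, hB⟩ := exists_boundedAt hj hc hcusp hm ⊤
  have h := eta_hasSum (hc.expansion m) hτ l u
  have h0 := fun p : HalfInt n × (Fin n → ℤ) =>
    coeff_eq_zero_of_neg hn hκ (hc.expansion m) hB p.1 p.2
  simp only [h0, zero_mul] at h
  exact h.unique hasSum_zero

theorem exists_heckeNorm_le (hn : 1 ≤ n) (hj : ∀ m, IsJacobiForm n κ m (φ m))
    (hc : FJCoeff n κ φ c) (hcusp : IsCuspidal φ) {N : ℕ} (hN : 0 < N) :
    ∃ C : ℝ, 0 < C ∧ ∀ A U : Fin n → ℤ, ∀ m : ℕ, 0 < m →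
      heckeNorm κ (torsionSpecialization φ (divVec N A) (divVec N U) m) ≤
        ENNReal.ofReal (C * (m : ℝ) ^ ((κ : ℝ) / 2 + (n : ℝ) / 2)) := by
  rcases lt_or_ge κ 0 with hκ | hκ
  -- In negative weight every specialization of positive index vanishes, so any constant works.
  · refine ⟨1, one_pos, fun A U m hm => iSup₂_le fun τ hτ => ?_⟩
    rw [torsionSpecialization_eq, eta_eq_zero_of_neg hn hκ hj hc hcusp hm hτ]
    simp
  · obtain ⟨C, hC, h⟩ := exists_boundedAt_uniform hn hκ hj hc hcusp hN
    refine ⟨C, hC, fun A U m hm => iSup₂_le fun τ hτ => ENNReal.ofReal_le_ofReal ?_⟩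
    rw [torsionSpecialization_eq]
    exact h m hm τ hτ _ _ (divVecR_mem N A) (divVecR_mem N U)

end Uniform

end FormalFJ

/-- Genus `g = n + 1 ≥ 2`, weight `k = κ / 2`. -/
theorem mainTheorem2 (n : ℕ) (hn : 1 ≤ n) (κ : ℤ)
    (φ : ℕ → Matrix (Fin n) (Fin n) ℂ → (Fin n → ℂ) → ℂ)
    (hφ : FormalFJ.IsSymmetricFormalFJ n κ φ) (hcusp : FormalFJ.IsCuspidal φ)
    (N : ℕ) (hN : 0 < N) :
    (∀ lam mu : Fin n → ℚ, FormalFJ.InTorsionLattice N lam → FormalFJ.InTorsionLattice N mu →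
      ∀ m : ℕ, FormalFJ.IsSiegelCuspForm n κ (N ^ 2)
        (FormalFJ.torsionSpecialization φ lam mu m)) ∧
    ∃ C : ℝ, 0 < C ∧
      ∀ lam mu : Fin n → ℚ, FormalFJ.InTorsionLattice N lam → FormalFJ.InTorsionLattice N mu →
        ∀ m : ℕ, 0 < m →
          FormalFJ.heckeNorm κ (FormalFJ.torsionSpecialization φ lam mu m) ≤
            ENNReal.ofReal (C * (m : ℝ) ^ ((κ : ℝ) / 2 + (n : ℝ) / 2)) := by
  obtain ⟨c, h1, h2⟩ := hφ.symmetric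
  have hc : FormalFJ.FJCoeff n κ φ c := ⟨h1, h2⟩
  refine ⟨fun lam mu hlam hmu m => ?_, ?_⟩
  · obtain ⟨A, rfl⟩ := hlam.exists_eq hN
    obtain ⟨U, rfl⟩ := hmu.exists_eq hN
    exact FormalFJ.isSiegelCuspForm_torsionSpecialization hφ.jacobi hc hcusp hN A U m
  · obtain ⟨C, hC, h⟩ := FormalFJ.exists_heckeNorm_le hn hφ.jacobi hc hcusp hN
    refine ⟨C, hC, fun lam mu hlam hmu m hm => ?_⟩
    obtain ⟨A, rfl⟩ := hlam.exists_eq hN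
    obtain ⟨U, rfl⟩ := hmu.exists_eq hN
    exact h A U m hm
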